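/- A \emph{mixed 1D crease pattern} consists of a line segment (the paper) with rational endpoints, together with a finite set of rational points in its interior (the creases), each of which is assigned mountain, assigned valley, or left unassigned. The pattern is encoded as the string that lists the left end, the creases from left to right with their labels, and the right end, every rational coordinate being written in lowest terms with sign, numerator and denominator in binary. A \emph{some-layers simple fold} of a flat state of the paper chooses a point $x$ of the line and rotates by $\pm 180^\circ$ about $x$ the part of the paper on one side of $x$ that belongs to the top $k$ layers (upwards) or to the bottom $k$ layers (downwards), for some $k$. The moving part is connected to the stationary part only at creases lying at $x$, which are unfolded before the fold and become folded by it; and wherever the moving part overlaps stationary paper, it lies above it (below it, for a downward fold). The moving layers land in reversed order on top of (respectively below) all the other layers. The pattern \emph{can be folded flat using some-layers simple folds} if some finite sequence of such folds leads from the unfolded paper to a state in which every crease is folded, each assigned crease being folded in its assigned direction. \textbf{Statement.} There is a deterministic multi-stack (equivalently, multi-tape) Turing machine that, given any encoded mixed 1D crease pattern, decides whether the pattern can be folded flat using some-layers simple folds, in a number of steps bounded by a polynomial in the length of the encoding. -/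

import Mathlib

namespace SimpleFolding

/-- The two directions in which a crease can be folded. -/
inductive Direction
  | mountain
  | valley
  deriving DecidableEq

/-- A mixed 1D crease pattern. The paper is the segment from `vertex 0` to
`vertex (Fin.last _)` (its two ends); the vertices strictly in between are the creases, and
crease `j` is the vertex with index `j + 1`. Each crease is assigned mountain or valley, or is
unassigned (`none`). Coordinates are rational, so that a pattern is a finite input. -/
structure MixedPattern where
  numCreases : ℕ
  vertex : Fin (numCreases + 2) → ℚ
  vertex_strictMono : StrictMono vertex
  assignment : Fin numCreases → Option Direction

/-- A flat state of a piece of paper with `n` creases and hence `n + 1` segments; segment `s` joins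
vertices `s` and `s + 1`, and crease `j` joins segments `j` and `j + 1`.
`pos` gives the horizontal positions of the vertices, and `height` the level of each segment in
the layer order (only the comparison of overlapping segments matters). -/
@[ext]
structure FoldedState (n : ℕ) where
  pos : Fin (n + 2) → ℚ
  height : Fin (n + 1) → ℤ

namespace FoldedState

variable {n : ℕ}

/-- The left end of the image of segment `s`. -/
def lo (A : FoldedState n) (s : Fin (n + 1)) : ℚ := min (A.pos s.castSucc) (A.pos s.succ)

/-- The right end of the image of segment `s`. -/
def hi (A : FoldedState n) (s : Fin (n + 1)) : ℚ := max (A.pos s.castSucc) (A.pos s.succ)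

/-- The images of two segments overlap in more than a point. -/
def Overlap (A : FoldedState n) (s t : Fin (n + 1)) : Prop := A.lo s < A.hi t ∧ A.lo t < A.hi s

/-- The top side of the paper faces up on segment `s`. Segments only ever move by half-turns in the
vertical plane, so this holds exactly when the segment still runs from left to right. -/
def FaceUp (A : FoldedState n) (s : Fin (n + 1)) : Prop := A.pos s.castSucc < A.pos s.succ

/-- The position of crease `j`. -/
def creasePos (A : FoldedState n) (j : Fin n) : ℚ := A.pos j.succ.castSucc

/-- Crease `j` is folded: its two segments face opposite ways. -/
def Folded (A : FoldedState n) (j : Fin n) : Prop := ¬ (A.FaceUp j.castSucc ↔ A.FaceUp j.succ)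

open Classical in
/-- The direction of a folded crease: a valley if the top sides of its two segments face each other,
that is, if the second segment lies on the side to which the top side of the first one faces;
otherwise a mountain. -/
noncomputable def direction (A : FoldedState n) (j : Fin n) : Direction :=
  if (A.FaceUp j.castSucc ↔ A.height j.castSucc < A.height j.succ) then .valley else .mountain

/-- `S` is the set of segments moved by a fold at the point `x`: a nonempty part of the paper, not
all of it, lying on one side of `x`, and connected to the rest of the paper only by unfolded
creases positioned at `x`. In particular a fold never unfolds a crease, and it bends the paper
only at creases. -/
def Movable (A : FoldedState n) (x : ℚ) (S : Set (Fin (n + 1))) : Prop :=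
  S.Nonempty ∧ Sᶜ.Nonempty ∧
    ((∀ s ∈ S, x ≤ A.lo s) ∨ (∀ s ∈ S, A.hi s ≤ x)) ∧
    ∀ j : Fin n, (j.castSucc ∈ S ↔ j.succ ∈ S) ∨ (¬ A.Folded j ∧ A.creasePos j = x)

/-- `B` arises from `A` by a half-turn of the segments in `S` about the point of the vertical plane
with coordinates `(x, c)`, all other segments staying fixed. -/
def HalfTurn (A B : FoldedState n) (x : ℚ) (c : ℤ) (S : Set (Fin (n + 1))) : Prop :=
  (∀ s ∈ S, B.pos s.castSucc = 2 * x - A.pos s.castSucc ∧ B.pos s.succ = 2 * x - A.pos s.succ ∧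
    B.height s = 2 * c - A.height s) ∧
  (∀ s ∉ S, B.pos s.castSucc = A.pos s.castSucc ∧ B.pos s.succ = A.pos s.succ ∧
    B.height s = A.height s)

/-- A some-layers simple fold upwards: the moved segments `S` are the topmost layers on their side of
`x` (each lies above every stationary segment that it overlaps), so that the layers folded at
`x` are the top `k` ones for some `k`. They are turned over, and land in reversed order on top of
everything else. -/
def FoldUp (A B : FoldedState n) : Prop :=
  ∃ (x : ℚ) (c : ℤ) (S : Set (Fin (n + 1))), A.Movable x S ∧
    (∀ s ∈ S, ∀ t ∉ S, A.Overlap s t → A.height t < A.height s) ∧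
    (∀ t, A.height t < c) ∧ HalfTurn A B x c S

/-- A some-layers simple fold downwards: the same with the bottom layers, which land in reversed
order below everything else. -/
def FoldDown (A B : FoldedState n) : Prop :=
  ∃ (x : ℚ) (c : ℤ) (S : Set (Fin (n + 1))), A.Movable x S ∧
    (∀ s ∈ S, ∀ t ∉ S, A.Overlap s t → A.height s < A.height t) ∧
    (∀ t, c < A.height t) ∧ HalfTurn A B x c S

/-- A some-layers simple fold of the top or bottom `k` layers, for any `k`. -/
def SomeLayersFold (A B : FoldedState n) : Prop := FoldUp A B ∨ FoldDown A B

end FoldedState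

namespace MixedPattern

/-- The unfolded paper: all segments in place, at the same level. -/
def unfolded (P : MixedPattern) : FoldedState P.numCreases where
  pos := P.vertex
  height := fun _ => 0

/-- The pattern can be folded flat by some-layers simple folds: some finite sequence of such folds
leads from the unfolded paper to a state in which every crease is folded, in its assigned
direction if it has one. (A crease once folded stays folded, in the same direction.) -/
def FlatFoldableSomeLayers (P : MixedPattern) : Prop :=
  ∃ B : FoldedState P.numCreases,
    Relation.ReflTransGen FoldedState.SomeLayersFold P.unfolded B ∧
      ∀ j, B.Folded j ∧ ∀ d, P.assignment j = some d → B.direction j = d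

end MixedPattern

/-- The alphabet for writing crease patterns. The symbols `paperEnd`, `unassigned` and
`assigned d` introduce a vertex and say what it is; the others write rational numbers. -/
inductive Letter
  | paperEnd
  | unassigned
  | assigned (d : Direction)
  | minus
  | slash
  | bit (b : Bool)
  deriving DecidableEq

/-- A rational number in lowest terms: sign, numerator and denominator in binary. -/
def encodeRat (q : ℚ) : List Letter :=
  (if q < 0 then [Letter.minus] else []) ++
    (Computability.encodeNat q.num.natAbs).map Letter.bit ++
    [Letter.slash] ++ (Computability.encodeNat q.den).map Letter.bit

/-- The letter that introduces a crease. -/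
def creaseLetter : Option Direction → Letter
  | none => Letter.unassigned
  | some d => Letter.assigned d

/-- A crease pattern as a string: the left end, the creases from left to right, the right end. -/
def MixedPattern.encode (P : MixedPattern) : List Letter :=
  Letter.paperEnd :: encodeRat (P.vertex 0) ++
    (List.finRange P.numCreases).flatMap
      (fun j => creaseLetter (P.assignment j) :: encodeRat (P.vertex j.succ.castSucc)) ++
    Letter.paperEnd :: encodeRat (P.vertex (Fin.last _))

end SimpleFolding

/-! When every crease is folded, consecutive segments run in opposite directions, so the horizontal
picture is forced: up to reflection and translation, vertex `k` lies at `(-1) ^ k * z k`, and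
segment `k` has length `z k + z (k + 1)`. Only the layer order is open. A pattern thus becomes a
word of numbers with labels, and for a choice of directions two conditions on words matter. The word
is `Flat` if its zigzag has a layer order without self-crossing. It is `Reducible` if it shrinks to
a single segment by folding over an end segment that is no longer than its neighbour, or by
crimping, that is, removing two consecutive creases of opposite direction whose common segment is no
longer than either neighbour.

Three facts close a cycle. Simple folds never create a crossing, because the moved layers keep their
place in the circular order around the fold point (`NonCrossing.foldUp`); hence foldable patterns
have flat words (`mixedFlat_of_foldable`). Reductions can be executed by simple folds, one for an
end segment and two for a crimp (`Strip.foldAll`); hence reducible words come from foldable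
patterns. Finally, the greedy procedure `scan` accepts every flat word, and every word that it
accepts is reducible (`scan_spec`).

The greedy choices are safe because flatness survives every crimp (`Flat.crimp`) and the removal of
the first vertex (`Flat.tail`). Consider a maximal run of equal segments between strictly longer
ones. Crimps inside the run cancel neighbouring creases of opposite direction and preserve the
excess of mountains over valleys, until the remaining creases all agree. Two or more of them would
form a spiral in which the longer segment at its end is trapped (`Layering.no_spiral`). So the
excess is 0 or ±1, according to parity. With unassigned creases the possible excesses are all
numbers of one parity in an interval; hence the run can be replaced by nothing, or by one crease
whose label records the possible signs (`mixed_run`). The scan keeps a stack of weakly decreasing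
segments and collapses the run on top as soon as a longer segment follows. A decreasing stack that
remains at the end can be folded up from its right end.

As for time, every round of an insertion either ends it or shortens the stack. The folded positions
are computed as integers over a common denominator, with two bits more than the input has symbols.
The procedure is written in a small language of structured stack programs, whose only costs are loop
tests, and is translated into a multi-stack machine (`Runs.steps`, `nonempty_computable`). -/

namespace SimpleFolding

/-! ### Structured stack programs and their running time -/

/-- Structured programs over finitely many stacks, indexed by `K`, with symbols in `Γ`. -/
inductive Prog (K Γ : Type) : Type
  | skip : Prog K Γ
  | push (k : K) (a : Γ) : Prog K Γ
  | seq (p q : Prog K Γ) : Prog K Γ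
  | pop (k : K) (f : Option Γ → Prog K Γ) : Prog K Γ
  | loop (k : K) (c : Option Γ → Bool) (p : Prog K Γ) : Prog K Γ

namespace Prog

variable {K Γ : Type}

infixr:65 " ;; " => Prog.seq

variable [DecidableEq K]

/-- `Runs p s s' t`: started on the stacks `s`, the program `p` ends with the stacks `s'` after `t`
tests of loop conditions. -/
inductive Runs : Prog K Γ → (K → List Γ) → (K → List Γ) → ℕ → Prop
  | skip (s) : Runs .skip s s 0
  | push (k a s) : Runs (.push k a) s (Function.update s k (a :: s k)) 0
  | seq {p q s₁ s₂ s₃ t₁ t₂} : Runs p s₁ s₂ t₁ → Runs q s₂ s₃ t₂ → Runs (.seq p q) s₁ s₃ (t₁ + t₂)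
  | pop {k f s s' t} : Runs (f (s k).head?) (Function.update s k (s k).tail) s' t →
      Runs (.pop k f) s s' t
  | loopDone {k c p s} : c (s k).head? = false → Runs (.loop k c p) s s 1
  | loopStep {k c p s₁ s₂ s₃ t₁ t₂} : c (s₁ k).head? = true → Runs p s₁ s₂ t₁ →
      Runs (.loop k c p) s₂ s₃ t₂ → Runs (.loop k c p) s₁ s₃ (t₁ + t₂ + 1)

/-- The program ends within `t` tests of loop conditions. -/
def Run (p : Prog K Γ) (s s' : K → List Γ) (t : ℕ) : Prop := ∃ t' ≤ t, Runs p s s' t'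

theorem Run.mono {p : Prog K Γ} {s s' : K → List Γ} {t t' : ℕ} (h : Run p s s' t) (ht : t ≤ t') :
    Run p s s' t' := by
  obtain ⟨u, hu, h⟩ := h
  exact ⟨u, hu.trans ht, h⟩

theorem run_skip (s : K → List Γ) (t : ℕ) : Run .skip s s t := ⟨0, Nat.zero_le _, .skip s⟩

theorem run_push (k : K) (a : Γ) (s : K → List Γ) (t : ℕ) :
    Run (.push k a) s (Function.update s k (a :: s k)) t := ⟨0, Nat.zero_le _, .push k a s⟩

theorem Run.seq {p q : Prog K Γ} {s₁ s₂ s₃ : K → List Γ} {t₁ t₂ : ℕ} (h₁ : Run p s₁ s₂ t₁)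
    (h₂ : Run q s₂ s₃ t₂) : Run (p ;; q) s₁ s₃ (t₁ + t₂) := by
  obtain ⟨u, hu, h₁⟩ := h₁
  obtain ⟨v, hv, h₂⟩ := h₂
  exact ⟨u + v, by omega, .seq h₁ h₂⟩

theorem Run.seq_le {p q : Prog K Γ} {s₁ s₂ s₃ : K → List Γ} {t₁ t₂ t : ℕ} (h₁ : Run p s₁ s₂ t₁)
    (h₂ : Run q s₂ s₃ t₂) (ht : t₁ + t₂ ≤ t) : Run (p ;; q) s₁ s₃ t :=
  (h₁.seq h₂).mono ht

theorem run_pop {k : K} {f : Option Γ → Prog K Γ} {s s' : K → List Γ} {t : ℕ}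
    (h : Run (f (s k).head?) (Function.update s k (s k).tail) s' t) : Run (.pop k f) s s' t := by
  obtain ⟨u, hu, h⟩ := h
  exact ⟨u, hu, .pop h⟩

theorem run_loop_done {k : K} {c : Option Γ → Bool} {p : Prog K Γ} {s : K → List Γ} {t : ℕ}
    (h : c (s k).head? = false) (ht : 1 ≤ t) : Run (.loop k c p) s s t :=
  ⟨1, ht, .loopDone h⟩

theorem run_loop_step {k : K} {c : Option Γ → Bool} {p : Prog K Γ} {s₁ s₂ s₃ : K → List Γ}
    {t₁ t₂ t : ℕ} (h : c (s₁ k).head? = true) (h₁ : Run p s₁ s₂ t₁)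
    (h₂ : Run (.loop k c p) s₂ s₃ t₂) (ht : t₁ + t₂ + 1 ≤ t) : Run (.loop k c p) s₁ s₃ t := by
  obtain ⟨u, hu, h₁⟩ := h₁
  obtain ⟨v, hv, h₂⟩ := h₂
  exact ⟨u + v + 1, by omega, .loopStep h h₁ h₂⟩

end Prog

/-! ### Translation to Turing machines with several stacks -/

namespace Prog

open Turing

variable {K Γ : Type}

/-- The labels needed for a program: one for each loop. -/
def Lab : Prog K Γ → Type
  | .skip => Empty
  | .push _ _ => Empty
  | .seq p q => Lab p ⊕ Lab q
  | .pop _ f => Σ o, Lab (f o)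
  | .loop _ _ p => Option (Lab p)

theorem finite_lab [Finite Γ] (p : Prog K Γ) : Finite (Lab p) := by
  induction p with
  | skip => exact inferInstanceAs (Finite Empty)
  | push => exact inferInstanceAs (Finite Empty)
  | seq p q hp hq => exact inferInstanceAs (Finite (Lab p ⊕ Lab q))
  | pop k f ih => exact inferInstanceAs (Finite (Σ o, Lab (f o)))
  | loop k c p ih => exact inferInstanceAs (Finite (Option (Lab p)))

/-- The stack alphabets: an output stack of booleans besides the stacks of the program. -/
@[reducible] def Alph (K Γ : Type) : Option K → Type
  | none => Bool
  | some _ => Γ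

/-- The stacks of the machine, with empty output. -/
def embed (s : K → List Γ) : ∀ k, List (Alph K Γ k)
  | none => ([] : List Bool)
  | some k => s k

variable {Λ : Type}

/-- Continue with `g v`, where `v` is the internal state. -/
def switch [DecidableEq Γ] (g : Option Γ → TM2.Stmt (Alph K Γ) Λ (Option Γ)) :
    List (Option Γ) → TM2.Stmt (Alph K Γ) Λ (Option Γ)
  | [] => .halt
  | o :: os => .branch (fun v => decide (v = o)) (g o) (switch g os)

variable [DecidableEq K]

theorem update_embed (s : K → List Γ) (k : K) (l : List Γ) :
    Function.update (embed s) (some k) l = embed (Function.update s k l) := by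
  funext o
  cases o with
  | none => rfl
  | some j =>
    by_cases h : j = k
    · subst h; simp [embed]
    · rw [Function.update_of_ne (by simpa using h)]
      simp [embed, Function.update_of_ne h]

theorem stepAux_switch [DecidableEq Γ] (g : Option Γ → TM2.Stmt (Alph K Γ) Λ (Option Γ)) (os : List (Option Γ))
    (v : Option Γ) (S : ∀ k, List (Alph K Γ k)) (hv : v ∈ os) :
    TM2.stepAux (switch g os) v S = TM2.stepAux (g v) v S := by
  induction os with
  | nil => simp at hv
  | cons o os ih =>
    simp only [switch, TM2.stepAux]
    by_cases h : v = o
    · simp [h]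
    · simp only [h, decide_false, cond_false]
      exact ih (by simpa [h] using hv)

/-- Several steps of a machine. -/
def Steps (M : Λ → TM2.Stmt (Alph K Γ) Λ (Option Γ)) (n : ℕ)
    (c c' : TM2.Cfg (Alph K Γ) Λ (Option Γ)) : Prop :=
  (flip bind (TM2.step M))^[n] (some c) = some c'

theorem Steps.trans {M : Λ → TM2.Stmt (Alph K Γ) Λ (Option Γ)} {n m : ℕ}
    {c₁ c₂ c₃ : TM2.Cfg (Alph K Γ) Λ (Option Γ)} (h₁ : Steps M n c₁ c₂) (h₂ : Steps M m c₂ c₃) :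
    Steps M (n + m) c₁ c₃ := by
  unfold Steps at *
  rw [add_comm, Function.iterate_add_apply, h₁, h₂]

variable [Fintype Γ] [DecidableEq Γ]

/-- The statement for a program that goes on with `cont`. -/
noncomputable def code : (p : Prog K Γ) → (Lab p → Λ) →
    TM2.Stmt (Alph K Γ) Λ (Option Γ) → TM2.Stmt (Alph K Γ) Λ (Option Γ)
  | .skip, _, cont => cont
  | .push k a, _, cont => .push (some k) (fun _ => a) cont
  | .seq p q, ι, cont => code p (fun l => ι (Sum.inl l)) (code q (fun l => ι (Sum.inr l)) cont)
  | .pop k f, ι, cont => .pop (some k) (fun _ o => o)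
      (switch (fun o => code (f o) (fun l => ι ⟨o, l⟩) cont) Finset.univ.toList)
  | .loop _ _ _, ι, _ => .goto fun _ => ι none

/-- The statements at the labels of a program that goes on with `cont`. -/
noncomputable def labCode : (p : Prog K Γ) → (Lab p → Λ) →
    TM2.Stmt (Alph K Γ) Λ (Option Γ) → Lab p → TM2.Stmt (Alph K Γ) Λ (Option Γ)
  | .skip, _, _, _ => .halt
  | .push _ _, _, _, _ => .halt
  | .seq p q, ι, cont, l => match l with
    | Sum.inl l => labCode p (fun l => ι (Sum.inl l)) (code q (fun l => ι (Sum.inr l)) cont) l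
    | Sum.inr l => labCode q (fun l => ι (Sum.inr l)) cont l
  | .pop _ f, ι, cont, ⟨o, l⟩ => labCode (f o) (fun l => ι ⟨o, l⟩) cont l
  | .loop k c p, ι, cont, l => match l with
    | none => .peek (some k) (fun _ o => o)
        (.branch c (code p (fun l => ι (some l)) (.goto fun _ => ι none)) cont)
    | some l => labCode p (fun l => ι (some l)) (.goto fun _ => ι none) l

/-- Pushes, pops and case distinctions become parts of one `TM2` statement and cost no step of their
own; control passes to a new label only at a loop test. This is why `Runs` counts loop tests: the
count is exactly the number of machine steps. The internal state is a mere scratch value, whence the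
arbitrary `v` at the beginning and the unspecified `v'` at the end. -/
theorem Runs.steps {p : Prog K Γ} {s s' : K → List Γ} {t : ℕ} (h : Runs p s s' t) :
    ∀ (M : Λ → TM2.Stmt (Alph K Γ) Λ (Option Γ)) (ι : Lab p → Λ)
      (cont : TM2.Stmt (Alph K Γ) Λ (Option Γ)), (∀ l, M (ι l) = labCode p ι cont l) →
      ∀ v, ∃ v', Steps M t (TM2.stepAux (code p ι cont) v (embed s))
        (TM2.stepAux cont v' (embed s')) := by
  induction h with
  | skip s => exact fun M ι cont _ v => ⟨v, rfl⟩
  | push k a s =>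
    intro M ι cont _ v
    refine ⟨v, ?_⟩
    simp only [code, TM2.stepAux]
    rw [← update_embed]
    rfl
  | seq _ _ ih₁ ih₂ =>
    intro M ι cont hM v
    obtain ⟨v', h₁⟩ := ih₁ M (fun l => ι (Sum.inl l)) (code _ (fun l => ι (Sum.inr l)) cont)
      (fun l => hM (Sum.inl l)) v
    obtain ⟨v'', h₂⟩ := ih₂ M (fun l => ι (Sum.inr l)) cont (fun l => hM (Sum.inr l)) v'
    exact ⟨v'', h₁.trans h₂⟩
  | @pop k f s s' t _ ih =>
    intro M ι cont hM v
    obtain ⟨v', h⟩ := ih M (fun l => ι ⟨_, l⟩) cont (fun l => hM ⟨_, l⟩) (s k).head?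
    refine ⟨v', ?_⟩
    simp only [code, TM2.stepAux]
    rw [stepAux_switch _ _ _ _ (Finset.mem_toList.2 (Finset.mem_univ _)), ← update_embed] at *
    exact h
  | @loopDone k c p s hc =>
    intro M ι cont hM v
    refine ⟨(s k).head?, ?_⟩
    have h := hM none
    simp only [labCode] at h
    simp only [Steps, code, TM2.stepAux, Function.iterate_one, flip, Option.bind_eq_bind,
      Option.bind_some, TM2.step, h]
    change some (cond (c (s k).head?) _ _) = _
    rw [hc]
    rfl
  | @loopStep k c p s₁ s₂ s₃ t₁ t₂ hc _ _ ih₁ ih₂ =>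
    intro M ι cont hM v
    obtain ⟨v', h₁⟩ := ih₁ M (fun l => ι (some l)) (.goto fun _ => ι none)
      (fun l => hM (some l)) (s₁ k).head?
    obtain ⟨v'', h₂⟩ := ih₂ M ι cont hM v'
    refine ⟨v'', ?_⟩
    -- One step executes the whole statement at the loop label: the test, and the body up to its
    -- next `goto`.
    have h0 : Steps M 1 (TM2.stepAux (code (.loop k c p) ι cont) v (embed s₁))
        (TM2.stepAux (code p (fun l => ι (some l)) (.goto fun _ => ι none)) (s₁ k).head?
          (embed s₁)) := by
      have h := hM none
      simp only [labCode] at h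
      simp only [Steps, code, TM2.stepAux, Function.iterate_one, flip, Option.bind_eq_bind,
        Option.bind_some, TM2.step, h]
      change some (cond (c (s₁ k).head?) _ _) = _
      rw [hc]
      rfl
    have := (h0.trans h₁).trans h₂
    rwa [show 1 + t₁ + t₂ = t₁ + t₂ + 1 by omega] at this

/-- The last statement of the machine: whether the stack `r` is nonempty is the answer. -/
def finish (Λ : Type) (r : K) : TM2.Stmt (Alph K Γ) Λ (Option Γ) :=
  .pop (some r) (fun _ o => o) (.branch (fun v => v.isSome)
    (.push none (fun _ => true) (.load (fun _ => none) .halt))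
    (.push none (fun _ => false) (.load (fun _ => none) .halt)))

/-- The machine that runs `p` and answers whether it left a symbol on the stack `r`. -/
@[reducible] noncomputable def machine [Fintype K] (p : Prog K Γ) (k₀ r : K) : FinTM2 where
  K := Option K
  k₀ := some k₀
  k₁ := none
  Γ := Alph K Γ
  Λ := Option (Lab p)
  main := none
  ΛFin := @Fintype.ofFinite _ (@instFiniteOption _ (finite_lab p))
  σ := Option Γ
  initialState := none
  Γk₀Fin := inferInstanceAs (Fintype Γ)
  m := fun l => match l with
    | none => code p some (finish (Option (Lab p)) r)
    | some l => labCode p some (finish (Option (Lab p)) r) l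

/-- A `TM2` computation has to end with all stacks empty except for the output, and with the
internal state reset. Therefore `p` must leave nothing behind but at most one symbol on `r`, which
`finish` turns into a boolean. -/
theorem nonempty_computable [Fintype K] {α : Type} (enc : α → List Γ) (f : α → Bool)
    (p : Prog K Γ) (k₀ r : K) (T : Polynomial ℕ)
    (h : ∀ a, ∃ w : List Γ, w.length = (f a).toNat ∧
      Run p (Function.update (fun _ => []) k₀ (enc a)) (Function.update (fun _ => []) r w)
        (T.eval (enc a).length)) :
    Nonempty (TM2ComputableInPolyTime enc Computability.encodeBool f) := by
  refine ⟨{ tm := machine p k₀ r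
            inputAlphabet := Equiv.refl Γ
            outputAlphabet := Equiv.refl Bool
            time := T + 1
            outputsFun := fun a => ?_ }⟩
  have key : ∃ n ≤ T.eval (enc a).length + 1, (flip bind (machine p k₀ r).step)^[n]
      (some (initList (machine p k₀ r) (enc a : List Γ))) =
      some (haltList (machine p k₀ r) ([f a] : List Bool)) := by
    obtain ⟨w, hw, t, ht, hr⟩ := h a
    obtain ⟨v', hs⟩ := hr.steps (machine p k₀ r).m some (finish (Option (Lab p)) r)
      (fun l => rfl) none
    -- The additional step is the one that leaves the initial label.
    refine ⟨1 + t, by omega, ?_⟩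
    have e₁ : initList (machine p k₀ r) (enc a : List Γ) =
        ⟨some none, none, embed (Function.update (fun _ => []) k₀ (enc a))⟩ := by
      unfold initList
      congr 1
      funext k
      cases k with
      | none => rfl
      | some k =>
        by_cases hk : k = k₀
        · subst hk
          simp [machine, embed]
        · have : ¬ (some k = (machine p k₀ r).k₀) := by simpa [machine] using hk
          rw [dif_neg this]
          simp [embed, Function.update_of_ne hk]
    have e₂ : TM2.stepAux (finish (Option (Lab p)) r) v'
        (embed (Function.update (fun _ => []) r w)) =
        haltList (machine p k₀ r) ([f a] : List Bool) := by
      have hl : ∀ u : List Γ, u.length = (f a).toNat → u.tail = [] ∧ u.head?.isSome = f a := by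
        intro u hu
        cases hf : f a <;> rw [hf] at hu
        · have : u = [] := List.length_eq_zero_iff.1 (by simpa using hu)
          simp [this]
        · obtain ⟨b, rfl⟩ := List.length_eq_one_iff.1 (by simpa using hu)
          simp
      have hstk : ∀ b : Bool, Function.update (embed (Function.update (fun _ : K => ([] : List Γ)) r []))
          none (([b] : List Bool)) = (haltList (machine p k₀ r) ([b] : List Bool)).stk := by
        intro b
        funext k
        cases k with
        | none => simp [haltList, machine]
        | some k =>
          rw [Function.update_of_ne (by simp)]
          have : ¬ (some k = (machine p k₀ r).k₁) := by simp [machine]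
          simp only [haltList]
          rw [dif_neg this]
          by_cases hk : k = r
          · subst hk; simp [embed]
          · simp [embed, Function.update_of_ne hk]
      have h1 : (embed (Function.update (fun _ : K => ([] : List Γ)) r w)) (some r) = w := by
        simp [embed]
      simp only [finish, TM2.stepAux]
      rw [h1, update_embed, Function.update_idem, (hl w hw).1]
      change cond ((w.head?).isSome) _ _ = _
      rw [(hl w hw).2]
      cases f a
      · change TM2.Cfg.mk none none _ = _
        exact congrArg (TM2.Cfg.mk none none) (hstk false)
      · change TM2.Cfg.mk none none _ = _
        exact congrArg (TM2.Cfg.mk none none) (hstk true)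
    rw [← e₂, e₁]
    exact Steps.trans (n := 1) (M := (machine p k₀ r).m) rfl hs
  refine
    { steps := key.choose
      evals_in_steps := ?_
      steps_le_m := by simpa using key.choose_spec.1 }
  have := key.choose_spec.2
  convert this using 2
  · simp
  · rfl

end Prog

end SimpleFolding

namespace SimpleFolding

/-! ### Layer orders of zigzags -/

/-- A layer order `h` of the `m` segments of the zigzag with vertices `x 0, …, x m` in which the
paper does not cross itself. -/
structure Layering (m : ℕ) (x : ℕ → ℚ) (h : ℕ → ℤ) : Prop where
  turn : ∀ i, i + 1 < m → (x i < x (i + 1) ↔ x (i + 2) < x (i + 1))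
  ne : ∀ i < m, x i ≠ x (i + 1)
  inj : ∀ i < m, ∀ j < m, h i = h j → i = j
  through : ∀ i, i + 1 < m → ∀ w < m, min (x w) (x (w + 1)) < x (i + 1) →
    x (i + 1) < max (x w) (x (w + 1)) → (h i < h w ↔ h (i + 1) < h w)
  cross : ∀ i j, i + 1 < m → j + 1 < m → i ≠ j → x (i + 1) = x (j + 1) →
    (x i < x (i + 1) ↔ x j < x (j + 1)) →
    ((h i < h j ↔ h (i + 1) < h j) ↔ (h i < h (j + 1) ↔ h (i + 1) < h (j + 1)))

namespace Layering

variable {m : ℕ} {x : ℕ → ℚ} {h : ℕ → ℤ}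

theorem lt_iff (L : Layering m x h) {i : ℕ} (hi : i + 1 < m) :
    x (i + 1) < x i ↔ x (i + 1) < x (i + 2) := by
  have h1 := L.turn i hi
  have h2 := L.ne i (by omega)
  have h3 := L.ne (i + 1) hi
  constructor
  · intro h
    exact lt_of_le_of_ne (not_lt.1 fun h' => absurd (h1.2 h') h.not_gt) h3
  · intro h
    exact lt_of_le_of_ne (not_lt.1 fun h' => absurd (h1.1 h') h.not_gt) (Ne.symm h2)

theorem tail (L : Layering (m + 1) x h) : Layering m (fun i => x (i + 1)) (fun i => h (i + 1)) where
  turn i hi := by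
    have h1 := L.turn (i + 1) (by omega)
    exact h1
  ne i hi := L.ne (i + 1) (by omega)
  inj i hi j hj e := by
    have := L.inj (i + 1) (by omega) (j + 1) (by omega) e
    omega
  through i hi w hw := L.through (i + 1) (by omega) (w + 1) (by omega)
  cross i j hi hj hij := L.cross (i + 1) (j + 1) (by omega) (by omega) (by omega)

theorem neg (L : Layering m x h) : Layering m (fun i => - x i) h where
  turn i hi := by
    simp only [neg_lt_neg_iff]
    exact L.lt_iff hi
  ne i hi := by simpa using L.ne i hi
  inj := L.inj
  through i hi w hw h1 h2 := by
    apply L.through i hi w hw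
    · simp only [max_neg_neg] at h2; simpa using h2
    · simp only [min_neg_neg] at h1; simpa using h1
  cross i j hi hj hij e1 e2 := by
    refine L.cross i j hi hj hij (by simpa using e1) ?_
    simp only [neg_lt_neg_iff] at e2
    have e3 : x (i + 1) = x (j + 1) := by simpa using e1
    have h1 := L.ne i (by omega)
    have h2 := L.ne j (by omega)
    rw [← not_le, ← not_le, not_iff_not, le_iff_lt_or_eq, le_iff_lt_or_eq]
    constructor
    · rintro (h | h)
      · exact Or.inl (e2.1 h)
      · exact absurd h.symm h1
    · rintro (h | h)
      · exact Or.inl (e2.2 h)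
      · exact absurd h.symm h2

/-- Negation reverses strict inequalities between distinct integers only, so the heights that are
compared first have to be shown distinct. -/
theorem flip (L : Layering m x h) : Layering m x (fun i => - h i) where
  turn := L.turn
  ne := L.ne
  inj i hi j hj e := L.inj i hi j hj (by simpa using e)
  through i hi w hw h1 h2 := by
    have h3 := L.through i hi w hw h1 h2
    simp only [neg_lt_neg_iff]
    by_cases e1 : w = i
    · subst e1
      rcases le_total (x w) (x (w + 1)) with hx | hx <;> simp [hx] at h1 h2
    by_cases e2 : w = i + 1
    · subst e2
      rcases le_total (x (i + 1)) (x (i + 1 + 1)) with hx | hx <;> simp [hx] at h1 h2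
    have h4 : h w ≠ h i := fun e => e1 (L.inj _ hw _ (by omega) e)
    have h5 : h w ≠ h (i + 1) := fun e => e2 (L.inj _ hw _ hi e)
    omega
  cross i j hi hj hij e1 e2 := by
    have h3 := L.cross i j hi hj hij e1 e2
    -- Two creases at the same point are not the two ends of one segment, because segments have
    -- positive length.
    have h4 : i ≠ j + 1 := by
      rintro rfl
      exact L.ne (j + 1) (by omega) e1.symm
    have h5 : j ≠ i + 1 := by
      rintro rfl
      exact L.ne (i + 1) (by omega) e1
    have k1 : h i ≠ h j := fun e => hij (L.inj _ (by omega) _ (by omega) e)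
    have k2 : h i ≠ h (j + 1) := fun e => h4 (L.inj _ (by omega) _ (by omega) e)
    have k3 : h j ≠ h (i + 1) := fun e => h5 (L.inj _ (by omega) _ (by omega) e)
    have k4 : h (i + 1) ≠ h (j + 1) :=
      fun e => hij (by have := L.inj _ (by omega) _ (by omega) e; omega)
    omega

end Layering

/-! ### Removing a crimp -/

/-- The data of a segment near a crimp whose three segments have the heights `hA < hs < hB` and whose
middle segment covers the interval from `X` to `Y`: the extent, the old heights left and right of
the crimp and the new height. -/
def CrimpData (hA hs hB : ℤ) (X Y lo hi : ℚ) (ha hb n : ℤ) : Prop :=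
  (ha = hb ∧ ((ha < hA ∧ n = ha - (hB - hA)) ∨ (hB < ha ∧ n = ha + (hB - hA)) ∨
    (hA < ha ∧ ha < hs ∧ hi ≤ Y ∧ n = ha - hA + hs) ∨
    (hA < ha ∧ ha < hs ∧ Y ≤ lo ∧ n = ha - hB + hs) ∨
    (hs < ha ∧ ha < hB ∧ hi ≤ X ∧ n = ha - hA + hs) ∨
    (hs < ha ∧ ha < hB ∧ X ≤ lo ∧ n = ha - hB + hs))) ∨
  (ha = hA ∧ hb = hB ∧ n = hs ∧ lo ≤ X ∧ Y ≤ hi)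

/-- `CrimpData` for segments that meet the interior of the interval. -/
def CrimpMid (hA hs hB ha hb n : ℤ) : Prop :=
  (ha = hb ∧ ((ha < hA ∧ n = ha - (hB - hA)) ∨ (hB < ha ∧ n = ha + (hB - hA)) ∨
    (hA < ha ∧ ha < hs ∧ n = ha - hA + hs) ∨
    (hs < ha ∧ ha < hB ∧ n = ha - hB + hs))) ∨
  (ha = hA ∧ hb = hB ∧ n = hs)

section

variable {hA hs hB : ℤ} {X Y : ℚ} (h1 : hA < hs) (h2 : hs < hB) (hXY : X < Y)
include h1 h2

/-- Over the interior of the interval the extents no longer matter: each class of layers has only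
one possible shift there. -/
theorem CrimpData.mid {lo hi : ℚ} {ha hb n : ℤ} (C : CrimpData hA hs hB X Y lo hi ha hb n)
    (hl : lo < Y) (hh : X < hi) : CrimpMid hA hs hB ha hb n := by
  unfold CrimpData at C
  unfold CrimpMid
  rcases C with ⟨e, C | C | C | C | C | C⟩ | C
  · exact Or.inl ⟨e, Or.inl C⟩
  · exact Or.inl ⟨e, Or.inr (Or.inl C)⟩
  · exact Or.inl ⟨e, Or.inr (Or.inr (Or.inl ⟨C.1, C.2.1, C.2.2.2⟩))⟩
  · exact absurd C.2.2.1 hl.not_ge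
  · exact absurd C.2.2.1 hh.not_ge
  · exact Or.inl ⟨e, Or.inr (Or.inr (Or.inr ⟨C.1, C.2.1, C.2.2.2⟩))⟩
  · exact Or.inr ⟨C.1, C.2.1, C.2.2.1⟩

-- To the left of `X` the new height is an increasing function of the old height `ha`, the merged
-- segment counting as `hA`. To the right of `Y` the same holds with `hb` and `hB`.
include hXY in
theorem CrimpData.left {lo hi : ℚ} {ha hb n : ℤ} (C : CrimpData hA hs hB X Y lo hi ha hb n)
    (hl : lo < X) : (ha < hA ∧ n = ha - (hB - hA)) ∨ (hB < ha ∧ n = ha + (hB - hA)) ∨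
      (hA ≤ ha ∧ ha < hB ∧ n = ha - hA + hs) := by
  unfold CrimpData at C
  rcases C with ⟨e, C | C | C | C | C | C⟩ | C
  · omega
  · omega
  · omega
  · exact absurd C.2.2.1 (hl.trans hXY).not_ge
  · omega
  · exact absurd C.2.2.1 hl.not_ge
  · omega

include hXY in
theorem CrimpData.right {lo hi : ℚ} {ha hb n : ℤ} (C : CrimpData hA hs hB X Y lo hi ha hb n)
    (hl : Y < hi) : (hb < hA ∧ n = hb - (hB - hA)) ∨ (hB < hb ∧ n = hb + (hB - hA)) ∨
      (hA < hb ∧ hb ≤ hB ∧ n = hb - hB + hs) := by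
  unfold CrimpData at C
  rcases C with ⟨e, C | C | C | C | C | C⟩ | C
  · omega
  · omega
  · exact absurd C.2.2.1 hl.not_ge
  · omega
  · exact absurd C.2.2.1 (hXY.trans hl).not_ge
  · omega
  · omega

theorem CrimpData.inj {lo hi lo' hi' : ℚ} {ha hb n ha' hb' n' : ℤ}
    (C : CrimpData hA hs hB X Y lo hi ha hb n) (C' : CrimpData hA hs hB X Y lo' hi' ha' hb' n')
    (e : n = n') : ha = ha' := by
  unfold CrimpData at C C'
  omega

end

/-- The vertices that remain when the vertices `a + 1` and `a + 2` are removed. -/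
def skipTwo (a i : ℕ) : ℕ := if i ≤ a then i else i + 2

/-- New heights for the segments when the crimp at the vertices `a + 1` and `a + 2` is removed, in
the original numbering. -/
noncomputable def crimpHeight (a : ℕ) (x : ℕ → ℚ) (h : ℕ → ℤ) (w : ℕ) : ℤ :=
  if h w < h a then h w - (h (a + 2) - h a) else if h (a + 2) < h w then h w + (h (a + 2) - h a)
  else if (h w < h (a + 1) ∧ max (x w) (x (w + 1)) ≤ x (a + 1)) ∨
    (h (a + 1) < h w ∧ max (x w) (x (w + 1)) ≤ x (a + 2)) then h w - h a + h (a + 1)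
  else h w - h (a + 2) + h (a + 1)

/-- The heights of the remaining segments. -/
noncomputable def crimpedHeight (a : ℕ) (x : ℕ → ℚ) (h : ℕ → ℤ) (i : ℕ) : ℤ :=
  if i < a then crimpHeight a x h i else if i = a then h (a + 1) else crimpHeight a x h (i + 2)

/-- The three segments of the crimp merge at the height of the middle one. No layer passes through
the crease at `x (a + 1)`, so a layer between the lower two segments lies on one side of it;
likewise at `x (a + 2)` for a layer between the upper two. A layer on the left has to stay above the
part of the merged segment that was at height `h a`, a layer on the right below the part that was at
height `h (a + 2)`; this dictates the shifts. Layers outside the crimp move away by its thickness to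
make room. -/
theorem crimpData_of_layering {m : ℕ} {x : ℕ → ℚ} {h : ℕ → ℤ} (L : Layering m x h) {a : ℕ}
    (ha : a + 2 < m) (hup : x a < x (a + 1)) (h1 : h a < h (a + 1)) (h2 : h (a + 1) < h (a + 2))
    (l1 : x a ≤ x (a + 2)) (l2 : x (a + 1) ≤ x (a + 3)) {i : ℕ} (hi : i + 2 < m) :
    CrimpData (h a) (h (a + 1)) (h (a + 2)) (x (a + 2)) (x (a + 1))
      (min (x (skipTwo a i)) (x (skipTwo a (i + 1)))) (max (x (skipTwo a i)) (x (skipTwo a (i + 1))))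
      (h (skipTwo a i)) (h (if i < a then i else i + 2)) (crimpedHeight a x h i) := by
  have hXY : x (a + 2) < x (a + 1) := (L.turn a (by omega)).1 hup
  have gen : ∀ w < m, w ≠ a → w ≠ a + 1 → w ≠ a + 2 →
      CrimpData (h a) (h (a + 1)) (h (a + 2)) (x (a + 2)) (x (a + 1)) (min (x w) (x (w + 1)))
        (max (x w) (x (w + 1))) (h w) (h w) (crimpHeight a x h w) := by
    intro w hw n1 n2 n3
    have k1 : h w ≠ h a := fun e => n1 (L.inj _ hw _ (by omega) e)
    have k2 : h w ≠ h (a + 1) := fun e => n2 (L.inj _ hw _ (by omega) e)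
    have k3 : h w ≠ h (a + 2) := fun e => n3 (L.inj _ hw _ (by omega) e)
    have t1 := L.through a (by omega) w hw
    have t2 := L.through (a + 1) (by omega) w hw
    refine Or.inl ⟨rfl, ?_⟩
    unfold crimpHeight
    by_cases c1 : h w < h a
    · rw [if_pos c1]; exact Or.inl ⟨c1, rfl⟩
    rw [if_neg c1]
    by_cases c2 : h (a + 2) < h w
    · rw [if_pos c2]; exact Or.inr (Or.inl ⟨c2, rfl⟩)
    rw [if_neg c2]
    have c1' : h a < h w := by omega
    have c2' : h w < h (a + 2) := by omega
    rcases lt_or_gt_of_ne k2 with c3 | c3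
    · by_cases c4 : max (x w) (x (w + 1)) ≤ x (a + 1)
      · rw [if_pos (Or.inl ⟨c3, c4⟩)]
        exact Or.inr (Or.inr (Or.inl ⟨c1', c3, c4, rfl⟩))
      · rw [if_neg (by rintro (⟨-, c⟩ | ⟨c, -⟩) <;> [exact c4 c; omega])]
        refine Or.inr (Or.inr (Or.inr (Or.inl ⟨c1', c3, ?_, rfl⟩)))
        by_contra c5
        have := t1 (not_le.1 c5) (not_le.1 c4)
        omega
    · by_cases c4 : max (x w) (x (w + 1)) ≤ x (a + 2)
      · rw [if_pos (Or.inr ⟨c3, c4⟩)]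
        exact Or.inr (Or.inr (Or.inr (Or.inr (Or.inl ⟨c3, c2', c4, rfl⟩))))
      · rw [if_neg (by rintro (⟨c, -⟩ | ⟨-, c⟩) <;> [omega; exact c4 c])]
        refine Or.inr (Or.inr (Or.inr (Or.inr (Or.inr ⟨c3, c2', ?_, rfl⟩))))
        by_contra c5
        have := t2 (not_le.1 c5) (not_le.1 c4)
        simp only [show a + 1 + 1 = a + 2 from rfl] at this
        omega
  unfold crimpedHeight skipTwo
  rcases lt_trichotomy i a with c | c | c
  · rw [if_pos c, if_pos c.le, if_pos (by omega), if_pos c]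
    exact gen i (by omega) (by omega) (by omega) (by omega)
  · subst c
    rw [if_neg (lt_irrefl _), if_pos rfl, if_pos le_rfl, if_neg (by omega), if_neg (lt_irrefl _)]
    exact Or.inr ⟨rfl, rfl, rfl, (min_le_left _ _).trans l1, l2.trans (le_max_right _ _)⟩
  · rw [if_neg (by omega), if_neg (by omega), if_neg (by omega), if_neg (by omega),
      if_neg (by omega)]
    exact gen (i + 2) hi (by omega) (by omega) (by omega)

end SimpleFolding

/-! ### The layer order after the removal of a crimp -/

namespace SimpleFolding

section

variable {hA hs hB : ℤ} (h1 : hA < hs) (h2 : hs < hB)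
include h1 h2

/-- Layers over the left end of the crimp: those between `hs` and `hB` move below all others. -/
theorem CrimpMid.lt_iff_left {ha hb n ha' hb' n' : ℤ} (C : CrimpMid hA hs hB ha hb n)
    (C' : CrimpMid hA hs hB ha' hb' n') :
    n < n' ↔ if hs < ha ∧ ha < hB then (if hs < ha' ∧ ha' < hB then ha < ha' else hA ≤ ha')
      else (if hs < ha' ∧ ha' < hB then ha < hA else ha < ha') := by
  unfold CrimpMid at C C'
  split_ifs <;> omega

/-- Over the right end of the crimp it is the layers between `hA` and `hs` that change place: they
move up past everything as far as `hB`. -/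
theorem CrimpMid.lt_iff_right {ha hb n ha' hb' n' : ℤ} (C : CrimpMid hA hs hB ha hb n)
    (C' : CrimpMid hA hs hB ha' hb' n') :
    n < n' ↔ if hA < hb ∧ hb < hs then (if hA < hb' ∧ hb' < hs then hb < hb' else hB < hb')
      else (if hA < hb' ∧ hb' < hs then hb ≤ hB else hb < hb') := by
  unfold CrimpMid at C C'
  split_ifs <;> omega

theorem CrimpMid.lt_iff_middle {ha hb n ha' hb' n' : ℤ} (C : CrimpMid hA hs hB ha hb n)
    (C' : CrimpMid hA hs hB ha' hb' n') (k1 : ha < hA ↔ ha' < hA) (k2 : ha < hs ↔ ha' < hs)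
    (k3 : ha < hB ↔ ha' < hB) (n1 : ha ≠ hA) (n2 : ha' ≠ hA) : n < n' ↔ ha < ha' := by
  unfold CrimpMid at C C'
  omega

/-- The three layers of the crimp divide the others into four classes. If the third layer belongs to
the crimp or to another class, it is on the same side of both given layers, before and after. If it
belongs to the same class, all three are shifted by the same amount. -/
theorem CrimpMid.middle_iff {ha hb n ha' hb' n' hc hd k : ℤ} (C : CrimpMid hA hs hB ha hb n)
    (C' : CrimpMid hA hs hB ha' hb' n') (k1 : ha < hA ↔ ha' < hA) (k2 : ha < hs ↔ ha' < hs)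
    (k3 : ha < hB ↔ ha' < hB) (n1 : ha ≠ hA) (n2 : ha' ≠ hA) (D : CrimpMid hA hs hB hc hd k) :
    ((n < k ↔ n' < k) ∧ (ha < hc ↔ ha' < hc)) ∨
      ((n < k ↔ ha < hc) ∧ (n' < k ↔ ha' < hc)) := by
  unfold CrimpMid at C C' D
  omega

theorem CrimpMid.through_middle {ha hb n ha' hb' n' hc hd k : ℤ} (C : CrimpMid hA hs hB ha hb n)
    (C' : CrimpMid hA hs hB ha' hb' n') (k1 : ha < hA ↔ ha' < hA) (k2 : ha < hs ↔ ha' < hs)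
    (k3 : ha < hB ↔ ha' < hB) (n1 : ha ≠ hA) (n2 : ha' ≠ hA) (D : CrimpMid hA hs hB hc hd k)
    (t : ha < hc ↔ ha' < hc) : n < k ↔ n' < k := by
  have := C.middle_iff h1 h2 C' k1 k2 k3 n1 n2 D
  tauto

theorem CrimpMid.cross_left {a₁ b₁ n₁ a₂ b₂ n₂ a₃ b₃ n₃ a₄ b₄ n₄ : ℤ}
    (C₁ : CrimpMid hA hs hB a₁ b₁ n₁) (C₂ : CrimpMid hA hs hB a₂ b₂ n₂)
    (C₃ : CrimpMid hA hs hB a₃ b₃ n₃) (C₄ : CrimpMid hA hs hB a₄ b₄ n₄)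
    (k₁ : hs < a₁ ∧ a₁ < hB ↔ hs < a₂ ∧ a₂ < hB) (k₂ : hs < a₃ ∧ a₃ < hB ↔ hs < a₄ ∧ a₄ < hB)
    (k : (a₁ < a₃ ↔ a₂ < a₃) ↔ (a₁ < a₄ ↔ a₂ < a₄)) :
    (n₁ < n₃ ↔ n₂ < n₃) ↔ (n₁ < n₄ ↔ n₂ < n₄) := by
  rw [C₁.lt_iff_left h1 h2 C₃, C₂.lt_iff_left h1 h2 C₃, C₁.lt_iff_left h1 h2 C₄,
    C₂.lt_iff_left h1 h2 C₄]
  simp only [k₁, k₂]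
  split_ifs
  · exact k
  · exact iff_of_true Iff.rfl Iff.rfl
  · exact Iff.rfl
  · exact k

theorem CrimpMid.cross_right {a₁ b₁ n₁ a₂ b₂ n₂ a₃ b₃ n₃ a₄ b₄ n₄ : ℤ}
    (C₁ : CrimpMid hA hs hB a₁ b₁ n₁) (C₂ : CrimpMid hA hs hB a₂ b₂ n₂)
    (C₃ : CrimpMid hA hs hB a₃ b₃ n₃) (C₄ : CrimpMid hA hs hB a₄ b₄ n₄)
    (k₁ : hA < b₁ ∧ b₁ < hs ↔ hA < b₂ ∧ b₂ < hs) (k₂ : hA < b₃ ∧ b₃ < hs ↔ hA < b₄ ∧ b₄ < hs)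
    (k : (b₁ < b₃ ↔ b₂ < b₃) ↔ (b₁ < b₄ ↔ b₂ < b₄)) :
    (n₁ < n₃ ↔ n₂ < n₃) ↔ (n₁ < n₄ ↔ n₂ < n₄) := by
  rw [C₁.lt_iff_right h1 h2 C₃, C₂.lt_iff_right h1 h2 C₃, C₁.lt_iff_right h1 h2 C₄,
    C₂.lt_iff_right h1 h2 C₄]
  simp only [k₁, k₂]
  split_ifs
  · exact k
  · exact iff_of_true Iff.rfl Iff.rfl
  · exact Iff.rfl
  · exact k

theorem CrimpMid.lt_iff_lt {ha hb n ha' hb' n' hc hd k : ℤ} (C : CrimpMid hA hs hB ha hb n)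
    (C' : CrimpMid hA hs hB ha' hb' n') (k1 : ha < hA ↔ ha' < hA) (k2 : ha < hs ↔ ha' < hs)
    (k3 : ha < hB ↔ ha' < hB) (n1 : ha ≠ hA) (n2 : ha' ≠ hA) (D : CrimpMid hA hs hB hc hd k)
    (hne : ¬ ((ha < hA ↔ hc < hA) ∧ (ha < hs ↔ hc < hs) ∧ (ha < hB ↔ hc < hB))) :
    n < k ↔ n' < k := by
  unfold CrimpMid at C C' D
  rcases C with ⟨e, C | C | C | C⟩ | C <;> rcases C' with ⟨e', C' | C' | C' | C'⟩ | C' <;>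
    first | (exfalso; omega) | skip
  all_goals
    rcases D with ⟨e'', D | D | D | D⟩ | D <;>
      omega

end

-- Only comparisons between segments that meet have to be controlled. Left of `X` the new heights
-- are ordered like the old heights `H`, in which the merged segment counts as segment `a`; right of
-- `Y` they are ordered like `G`, in which it counts as segment `a + 2`. Strictly between `X` and
-- `Y` the two segments at a crease are in the same class relative to the three crimp layers, and so
-- move together. A crease exactly at `X` or `Y` that opens towards the interval is compared with
-- the crimp's own crease there by means of `cross`.
set_option maxHeartbeats 2000000 in
theorem Layering.exists_crimp_aux {m : ℕ} {x : ℕ → ℚ} {h : ℕ → ℤ} (L : Layering (m + 2) x h)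
    {a : ℕ} (ha : a < m) (hup : x a < x (a + 1)) (h1 : h a < h (a + 1)) (h2 : h (a + 1) < h (a + 2))
    (l1 : x a ≤ x (a + 2)) (l2 : x (a + 1) ≤ x (a + 3)) :
    ∃ h' : ℕ → ℤ, Layering m (fun i => x (skipTwo a i)) h' ∧ ∀ i, i + 1 < m →
      (h' i < h' (i + 1) ↔ h (skipTwo a (i + 1) - 1) < h (skipTwo a (i + 1))) := by
  have hXY : x (a + 2) < x (a + 1) := (L.turn a (by omega)).1 hup
  set X := x (a + 2) with hX
  set Y := x (a + 1) with hY
  set y : ℕ → ℚ := fun i => x (skipTwo a i) with hy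
  set N : ℕ → ℤ := crimpedHeight a x h with hN
  set r : ℕ → ℕ := fun i => if i < a then i else i + 2 with hr
  set H : ℕ → ℤ := fun i => h (skipTwo a i) with hH
  set G : ℕ → ℤ := fun i => h (r i) with hG
  have D : ∀ i < m, CrimpData (h a) (h (a + 1)) (h (a + 2)) X Y (min (y i) (y (i + 1)))
      (max (y i) (y (i + 1))) (H i) (G i) (N i) := fun i hi =>
    crimpData_of_layering L (by omega) hup h1 h2 l1 l2 (by omega)
  have s_le : ∀ {i}, i ≤ a → skipTwo a i = i := fun h => if_pos h
  have s_gt : ∀ {i}, a < i → skipTwo a i = i + 2 := fun h => if_neg (by omega)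
  have r_lt : ∀ {i}, i < a → r i = i := fun h => if_pos h
  have r_ge : ∀ {i}, a ≤ i → r i = i + 2 := fun h => if_neg (by omega)
  have ya : y a = x a := by simp only [hy, s_le le_rfl]
  have ya1 : y (a + 1) = x (a + 3) := by simp only [hy, s_gt (Nat.lt_succ_self a)]
  have s_lt : ∀ i < m, skipTwo a i < m + 2 := by
    intro i hi; unfold skipTwo; split_ifs <;> omega
  have r_bd : ∀ i < m, r i < m + 2 := by
    intro i hi; simp only [hr]; split_ifs <;> omega
  have s_inj : ∀ i j, skipTwo a i = skipTwo a j → i = j := by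
    intro i j; unfold skipTwo; split_ifs <;> omega
  have r_inj : ∀ i j, r i = r j → i = j := by
    intro i j; simp only [hr]; split_ifs <;> omega
  have s_ne : ∀ i, skipTwo a i ≠ a + 1 ∧ skipTwo a i ≠ a + 2 := by
    intro i; unfold skipTwo; split_ifs <;> omega
  have r_ne : ∀ i, r i ≠ a + 1 ∧ r i ≠ a := by
    intro i; simp only [hr]; split_ifs <;> omega
  have Hne : ∀ i < m, H i ≠ h (a + 1) ∧ H i ≠ h (a + 2) := fun i hi =>
    ⟨fun e => (s_ne i).1 (L.inj _ (s_lt i hi) _ (by omega) e),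
      fun e => (s_ne i).2 (L.inj _ (s_lt i hi) _ (by omega) e)⟩
  have Gne : ∀ i < m, G i ≠ h (a + 1) ∧ G i ≠ h a := fun i hi =>
    ⟨fun e => (r_ne i).1 (L.inj _ (r_bd i hi) _ (by omega) e),
      fun e => (r_ne i).2 (L.inj _ (r_bd i hi) _ (by omega) e)⟩
  -- creases of the new zigzag as creases of the old one
  have cr1 : ∀ i, i + 1 < m → y (i + 1) < Y → skipTwo a (i + 1) = skipTwo a i + 1 := by
    intro i hi hp
    have : i ≠ a := by
      rintro rfl
      rw [ya1] at hp
      exact absurd l2 hp.not_ge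
    unfold skipTwo
    split_ifs <;> omega
  have cr3 : ∀ i, i + 1 < m → X < y (i + 1) → r (i + 1) = r i + 1 ∧ x (r i + 1) = y (i + 1) ∧
      (y i < y (i + 1) ↔ x (r i) < x (r i + 1)) := by
    intro i hi hp
    have hi1 : i + 1 ≠ a := by
      rintro e
      rw [e, ya] at hp
      exact absurd l1 hp.not_ge
    rcases lt_trichotomy i a with c | c | c
    · rw [r_lt c, r_lt (by omega)]
      simp only [hy, s_le c.le, s_le (show i + 1 ≤ a by omega), and_self]
    · subst c
      rw [r_ge le_rfl, r_ge (by omega), ya, ya1]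
      refine ⟨by omega, rfl, ?_⟩
      have e1 : x i < x (i + 3) := lt_of_lt_of_le hup l2
      have e2 : x (i + 2) < x (i + 3) := lt_of_lt_of_le hXY l2
      simp only [e1, show i + 2 + 1 = i + 3 from rfl, e2]
    · rw [r_ge c.le, r_ge (by omega)]
      refine ⟨by omega, ?_, ?_⟩ <;> simp only [hy, s_gt c, s_gt (show a < i + 1 by omega)]
  -- To the left of `Y`, a point inside the merged segment is also inside segment `a`.
  have ex1 : ∀ w < m, ∀ p, p < Y → min (y w) (y (w + 1)) < p → p < max (y w) (y (w + 1)) →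
      min (x (skipTwo a w)) (x (skipTwo a w + 1)) < p ∧
        p < max (x (skipTwo a w)) (x (skipTwo a w + 1)) := by
    intro w hw p hp c1 c2
    rcases lt_trichotomy w a with c | c | c
    · simp only [hy, s_le c.le, s_le (show w + 1 ≤ a by omega)] at c1 c2 ⊢
      exact ⟨c1, c2⟩
    · subst c
      have e1 : x w < x (w + 3) := lt_of_lt_of_le hup l2
      rw [ya, ya1, min_eq_left e1.le] at c1
      rw [s_le le_rfl, min_eq_left hup.le, max_eq_right hup.le]
      exact ⟨c1, hp⟩
    · simp only [hy, s_gt c, s_gt (show a < w + 1 by omega)] at c1 c2 ⊢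
      exact ⟨c1, c2⟩
  have ex3 : ∀ w < m, ∀ p, X < p → min (y w) (y (w + 1)) < p → p < max (y w) (y (w + 1)) →
      min (x (r w)) (x (r w + 1)) < p ∧ p < max (x (r w)) (x (r w + 1)) := by
    intro w hw p hp c1 c2
    rcases lt_trichotomy w a with c | c | c
    · simp only [hy, s_le c.le, s_le (show w + 1 ≤ a by omega)] at c1 c2
      rw [r_lt c]
      exact ⟨c1, c2⟩
    · subst c
      have e1 : x w < x (w + 3) := lt_of_lt_of_le hup l2
      have e2 : x (w + 2) < x (w + 3) := lt_of_lt_of_le hXY l2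
      rw [ya, ya1, max_eq_right e1.le] at c2
      rw [r_ge le_rfl, show w + 2 + 1 = w + 3 from rfl, min_eq_left e2.le, max_eq_right e2.le]
      exact ⟨hp, c2⟩
    · simp only [hy, s_gt c, s_gt (show a < w + 1 by omega)] at c1 c2
      rw [r_ge c.le]
      exact ⟨c1, c2⟩
  have th1 : ∀ i, i + 1 < m → ∀ w < m, y (i + 1) < Y → min (y w) (y (w + 1)) < y (i + 1) →
      y (i + 1) < max (y w) (y (w + 1)) → (H i < H w ↔ H (i + 1) < H w) := by
    intro i hi w hw hp c1 c2
    obtain ⟨e1, e2⟩ := ex1 w hw _ hp c1 c2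
    have e := cr1 i hi hp
    have := s_lt (i + 1) hi
    have e' : y (i + 1) = x (skipTwo a i + 1) := by simp only [hy, e]
    rw [e'] at e1 e2
    have k := L.through (skipTwo a i) (by omega) (skipTwo a w) (s_lt w hw) e1 e2
    simp only [hH, e]
    exact k
  have th3 : ∀ i, i + 1 < m → ∀ w < m, X < y (i + 1) → min (y w) (y (w + 1)) < y (i + 1) →
      y (i + 1) < max (y w) (y (w + 1)) → (G i < G w ↔ G (i + 1) < G w) := by
    intro i hi w hw hp c1 c2
    obtain ⟨e1, e2⟩ := ex3 w hw _ hp c1 c2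
    obtain ⟨e, e', -⟩ := cr3 i hi hp
    have := r_bd (i + 1) hi
    rw [← e'] at e1 e2
    have k := L.through (r i) (by omega) (r w) (r_bd w hw) e1 e2
    simp only [hG, e]
    exact k
  have co1 : ∀ i j, i + 1 < m → j + 1 < m → i ≠ j → y (i + 1) < Y → y (i + 1) = y (j + 1) →
      (y i < y (i + 1) ↔ y j < y (j + 1)) →
      ((H i < H j ↔ H (i + 1) < H j) ↔ (H i < H (j + 1) ↔ H (i + 1) < H (j + 1))) := by
    intro i j hi hj hij hp e1 e2
    have ei := cr1 i hi hp
    have ej := cr1 j hj (e1 ▸ hp)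
    have k1 := s_lt (i + 1) hi
    have k2 := s_lt (j + 1) hj
    simp only [hy, ei, ej] at e1 e2
    have k := L.cross (skipTwo a i) (skipTwo a j) (by omega) (by omega)
      (fun e => hij (s_inj _ _ e)) e1 e2
    simp only [hH, ei, ej]
    exact k
  have co3 : ∀ i j, i + 1 < m → j + 1 < m → i ≠ j → X < y (i + 1) → y (i + 1) = y (j + 1) →
      (y i < y (i + 1) ↔ y j < y (j + 1)) →
      ((G i < G j ↔ G (i + 1) < G j) ↔ (G i < G (j + 1) ↔ G (i + 1) < G (j + 1))) := by
    intro i j hi hj hij hp e1 e2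
    obtain ⟨ei, ei', ei''⟩ := cr3 i hi hp
    obtain ⟨ej, ej', ej''⟩ := cr3 j hj (e1 ▸ hp)
    have k1 := r_bd (i + 1) hi
    have k2 := r_bd (j + 1) hj
    rw [ei'', ej''] at e2
    rw [← ei', ← ej'] at e1
    have k := L.cross (r i) (r j) (by omega) (by omega) (fun e => hij (r_inj _ _ e)) e1 e2
    simp only [hG, ei, ej]
    exact k
  -- the new zigzag turns
  have turn' : ∀ i, i + 1 < m → (y i < y (i + 1) ↔ y (i + 2) < y (i + 1)) := by
    intro i hi
    by_cases c1 : i + 1 < a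
    · simp only [hy, s_le (show i ≤ a by omega), s_le (show i + 1 ≤ a by omega),
        s_le (show i + 2 ≤ a by omega)]
      exact L.turn i (by omega)
    by_cases c2 : i + 1 = a
    · subst c2
      have e0 : y i = x i := by simp only [hy, s_le (Nat.le_succ i)]
      rw [ya, e0, show i + 2 = i + 1 + 1 from rfl, ya1, L.turn i (by omega)]
      exact iff_of_false hup.not_gt (lt_of_lt_of_le hup l2).not_gt
    by_cases c3 : i = a
    · subst c3
      have e0 : y (i + 2) = x (i + 4) := by simp only [hy, s_gt (show i < i + 2 by omega)]
      rw [ya, ya1, e0]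
      have e2 : x (i + 2) < x (i + 3) := lt_of_lt_of_le hXY l2
      exact iff_of_true (lt_of_lt_of_le hup l2) ((L.turn (i + 2) (by omega)).1 e2)
    · simp only [hy, s_gt (show a < i by omega), s_gt (show a < i + 1 by omega),
        s_gt (show a < i + 2 by omega)]
      exact L.turn (i + 2) (by omega)
  have ne' : ∀ i < m, y i ≠ y (i + 1) := by
    intro i hi
    rcases lt_trichotomy i a with c | c | c
    · simp only [hy, s_le c.le, s_le (show i + 1 ≤ a by omega)]
      exact L.ne i (by omega)
    · subst c
      rw [ya, ya1]
      exact (lt_of_lt_of_le hup l2).ne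
    · simp only [hy, s_gt c, s_gt (show a < i + 1 by omega)]
      exact L.ne (i + 2) (by omega)
  -- the zones around a crease
  have ends : ∀ i, i + 1 < m →
      (y i < y (i + 1) ∧ min (y i) (y (i + 1)) < y (i + 1) ∧
        min (y (i + 1)) (y (i + 1 + 1)) < y (i + 1) ∧ max (y i) (y (i + 1)) = y (i + 1) ∧
        max (y (i + 1)) (y (i + 1 + 1)) = y (i + 1)) ∨
      (¬ y i < y (i + 1) ∧ y (i + 1) < max (y i) (y (i + 1)) ∧
        y (i + 1) < max (y (i + 1)) (y (i + 1 + 1)) ∧ min (y i) (y (i + 1)) = y (i + 1) ∧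
        min (y (i + 1)) (y (i + 1 + 1)) = y (i + 1)) := by
    intro i hi
    have t := turn' i hi
    have n1 := ne' i (by omega)
    have n2 := ne' (i + 1) hi
    by_cases c : y i < y (i + 1)
    · have c' := t.1 c
      left
      exact ⟨c, by simp [c], by simp; exact c', by simp [c.le], by simp; exact c'.le⟩
    · have c1 : y (i + 1) < y i := lt_of_le_of_ne (not_lt.1 c) (Ne.symm n1)
      have c2 : y (i + 1) < y (i + 1 + 1) :=
        lt_of_le_of_ne (not_lt.1 fun h => c (t.2 h)) n2
      right
      exact ⟨c, by simp [c1], by simp; exact c2, by simp [c1.le], by simp [c2.le]⟩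
  -- The given crease and the crimp's crease at `X` both open to the right. As they do not
  -- interlock, both segments of the given crease lie between the upper two crimp layers or neither
  -- does.
  have xs1 : ∀ i, i + 1 < m → y (i + 1) = X → ¬ y i < y (i + 1) →
      ((h (a + 1) < H i ∧ H i < h (a + 2)) ↔ (h (a + 1) < H (i + 1) ∧ H (i + 1) < h (a + 2))) := by
    intro i hi hp hl
    have e := cr1 i hi (hp ▸ hXY)
    have k1 := s_lt (i + 1) hi
    have k := L.cross (a + 1) (skipTwo a i) (by omega) (by omega) (fun e => (s_ne i).1 e.symm)
      (by rw [← e]; exact hp.symm) (by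
        refine iff_of_false hXY.not_gt ?_
        rw [← e]; exact hl)
    rw [← e] at k
    have n1 := Hne i (by omega)
    have n2 := Hne (i + 1) hi
    simp only [hH] at n1 n2 ⊢
    simp only [show a + 1 + 1 = a + 2 from rfl] at k
    omega
  have xs2 : ∀ w < m, min (y w) (y (w + 1)) < X → X < max (y w) (y (w + 1)) →
      ¬ (h (a + 1) < H w ∧ H w < h (a + 2)) := by
    intro w hw c1 c2
    obtain ⟨e1, e2⟩ := ex1 w hw _ hXY c1 c2
    have k := L.through (a + 1) (by omega) (skipTwo a w) (s_lt w hw) e1 e2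
    simp only [hH, show a + 1 + 1 = a + 2 from rfl] at k ⊢
    omega
  have ys1 : ∀ i, i + 1 < m → y (i + 1) = Y → y i < y (i + 1) →
      ((h a < G i ∧ G i < h (a + 1)) ↔ (h a < G (i + 1) ∧ G (i + 1) < h (a + 1))) := by
    intro i hi hp hl
    obtain ⟨e, e', e''⟩ := cr3 i hi (hp ▸ hXY)
    have k1 := r_bd (i + 1) hi
    have k := L.cross a (r i) (by omega) (by omega) (fun e => (r_ne i).2 e.symm)
      (by rw [e']; exact hp.symm) (by
        refine iff_of_true hup ?_
        rw [← e'']; exact hl)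
    rw [← e] at k
    have n1 := Gne i (by omega)
    have n2 := Gne (i + 1) hi
    simp only [hG] at n1 n2 ⊢
    omega
  have ys2 : ∀ w < m, min (y w) (y (w + 1)) < Y → Y < max (y w) (y (w + 1)) →
      ¬ (h a < G w ∧ G w < h (a + 1)) := by
    intro w hw c1 c2
    obtain ⟨e1, e2⟩ := ex3 w hw _ hXY c1 c2
    have k := L.through a (by omega) (r w) (r_bd w hw) e1 e2
    simp only [hG] at k ⊢
    omega
  -- All three segments of the crimp cover a point strictly between `X` and `Y`, so none of them
  -- separates the two layers joined by a crease at that point.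
  have ms : ∀ i, i + 1 < m → X < y (i + 1) → y (i + 1) < Y →
      ((H i < h a ↔ H (i + 1) < h a) ∧ (H i < h (a + 1) ↔ H (i + 1) < h (a + 1)) ∧
        (H i < h (a + 2) ↔ H (i + 1) < h (a + 2))) ∧ H i ≠ h a ∧ H (i + 1) ≠ h a := by
    intro i hi c1 c2
    have e := cr1 i hi c2
    have k1 := s_lt (i + 1) hi
    have e' : y (i + 1) = x (skipTwo a i + 1) := by simp only [hy, e]
    rw [e'] at c1 c2
    have t0 := L.through (skipTwo a i) (by omega) a (by omega)
      (by rw [min_eq_left hup.le]; exact lt_of_le_of_lt l1 c1) (by rw [max_eq_right hup.le]; exact c2)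
    have t1 := L.through (skipTwo a i) (by omega) (a + 1) (by omega)
      (by rw [show a + 1 + 1 = a + 2 from rfl, min_eq_right hXY.le]; exact c1)
      (by rw [show a + 1 + 1 = a + 2 from rfl, max_eq_left hXY.le]; exact c2)
    have e2 : x (a + 2) ≤ x (a + 3) := (lt_of_lt_of_le hXY l2).le
    have t2 := L.through (skipTwo a i) (by omega) (a + 2) (by omega)
      (by rw [show a + 2 + 1 = a + 3 from rfl, min_eq_left e2]; exact c1)
      (by rw [show a + 2 + 1 = a + 3 from rfl, max_eq_right e2]; exact lt_of_lt_of_le c2 l2)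
    rw [← e] at t0 t1 t2
    refine ⟨⟨t0, t1, t2⟩, ?_, ?_⟩
    · intro eq
      have : skipTwo a i = a := L.inj _ (by omega) _ (by omega) eq
      have : i = a := by
        unfold skipTwo at this; split_ifs at this <;> omega
      subst this
      rw [← e', ya1] at c2
      exact absurd l2 c2.not_ge
    · intro eq
      have : skipTwo a (i + 1) = a := L.inj _ (by omega) _ (by omega) eq
      have : i + 1 = a := by
        unfold skipTwo at this; split_ifs at this <;> omega
      rw [← e', this, ya] at c1
      exact absurd l1 c1.not_ge
  -- A crease at `X` belongs to the left zone if its segments lie to its left, and to the middle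
  -- zone otherwise; symmetrically at `Y`.
  have zone : ∀ i, i + 1 < m →
      (y (i + 1) ≤ X ∧ min (y i) (y (i + 1)) < X ∧ min (y (i + 1)) (y (i + 1 + 1)) < X ∧
        (y (i + 1) = X → y i < y (i + 1))) ∨
      (Y ≤ y (i + 1) ∧ Y < max (y i) (y (i + 1)) ∧ Y < max (y (i + 1)) (y (i + 1 + 1)) ∧
        (y (i + 1) = Y → ¬ y i < y (i + 1))) ∨
      ((min (y i) (y (i + 1)) < Y ∧ X < max (y i) (y (i + 1)) ∧
        min (y (i + 1)) (y (i + 1 + 1)) < Y ∧ X < max (y (i + 1)) (y (i + 1 + 1))) ∧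
        ((y (i + 1) = X ∧ ¬ y i < y (i + 1)) ∨ (y (i + 1) = Y ∧ y i < y (i + 1)) ∨
          (X < y (i + 1) ∧ y (i + 1) < Y))) := by
    intro i hi
    have u1 : min (y i) (y (i + 1)) ≤ y (i + 1) := min_le_right _ _
    have u2 : min (y (i + 1)) (y (i + 1 + 1)) ≤ y (i + 1) := min_le_left _ _
    have u3 : y (i + 1) ≤ max (y i) (y (i + 1)) := le_max_right _ _
    have u4 : y (i + 1) ≤ max (y (i + 1)) (y (i + 1 + 1)) := le_max_left _ _
    rcases lt_trichotomy (y (i + 1)) X with c | c | c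
    · exact Or.inl ⟨c.le, u1.trans_lt c, u2.trans_lt c, fun e => absurd e c.ne⟩
    · rcases ends i hi with ⟨k, k1, k2, -, -⟩ | ⟨k, k1, k2, k3, k4⟩
      · exact Or.inl ⟨c.le, c ▸ k1, c ▸ k2, fun _ => k⟩
      · refine Or.inr (Or.inr ⟨⟨?_, c ▸ k1, ?_, c ▸ k2⟩, Or.inl ⟨c, k⟩⟩)
        · rw [k3, c]; exact hXY
        · rw [k4, c]; exact hXY
    · rcases lt_trichotomy (y (i + 1)) Y with d | d | d
      · exact Or.inr (Or.inr ⟨⟨u1.trans_lt d, c.trans_le u3, u2.trans_lt d, c.trans_le u4⟩,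
          Or.inr (Or.inr ⟨c, d⟩)⟩)
      · rcases ends i hi with ⟨k, k1, k2, k3, k4⟩ | ⟨k, k1, k2, -, -⟩
        · refine Or.inr (Or.inr ⟨⟨d ▸ k1, ?_, d ▸ k2, ?_⟩, Or.inr (Or.inl ⟨d, k⟩)⟩)
          · rw [k3]; exact c
          · rw [k4]; exact c
        · exact Or.inr (Or.inl ⟨d.ge, d ▸ k1, d ▸ k2, fun _ => k⟩)
      · exact Or.inr (Or.inl ⟨d.le, d.trans_le u3, d.trans_le u4, fun e => absurd e d.ne'⟩)
  have left_iso : ∀ i < m, ∀ j < m, min (y i) (y (i + 1)) < X → min (y j) (y (j + 1)) < X →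
      (N i < N j ↔ H i < H j) := by
    intro i hi j hj c1 c2
    have d1 := (D i hi).left h1 h2 hXY c1
    have d2 := (D j hj).left h1 h2 hXY c2
    omega
  have right_iso : ∀ i < m, ∀ j < m, Y < max (y i) (y (i + 1)) → Y < max (y j) (y (j + 1)) →
      (N i < N j ↔ G i < G j) := by
    intro i hi j hj c1 c2
    have d1 := (D i hi).right h1 h2 hXY c1
    have d2 := (D j hj).right h1 h2 hXY c2
    omega
  refine ⟨N, ⟨turn', ne', ?_, ?_, ?_⟩, ?_⟩
  · intro i hi j hj e
    have := (D i hi).inj h1 h2 (D j hj) e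
    exact s_inj _ _ (L.inj _ (s_lt i hi) _ (s_lt j hj) this)
  · intro i hi w hw c1 c2
    rcases zone i hi with ⟨z1, z2, z3, -⟩ | ⟨z1, z2, z3, -⟩ | ⟨⟨z1, z2, z3, z4⟩, z⟩
    · rw [left_iso i (by omega) w hw z2 (c1.trans_le z1),
        left_iso (i + 1) hi w hw z3 (c1.trans_le z1)]
      exact th1 i hi w hw (z1.trans_lt hXY) c1 c2
    · rw [right_iso i (by omega) w hw z2 (z1.trans_lt c2),
        right_iso (i + 1) hi w hw z3 (z1.trans_lt c2)]
      exact th3 i hi w hw (hXY.trans_le z1) c1 c2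
    · have M1 := (D i (by omega)).mid h1 h2 z1 z2
      have M2 := (D (i + 1) hi).mid h1 h2 z3 z4
      rcases z with ⟨z5, z6⟩ | ⟨z5, z6⟩ | ⟨z5, z6⟩
      · have M3 := (D w hw).mid h1 h2 (c1.trans (z5 ▸ hXY)) (z5 ▸ c2)
        have k1 := xs1 i hi z5 z6
        have k2 := xs2 w hw (z5 ▸ c1) (z5 ▸ c2)
        have k3 := th1 i hi w hw (z5 ▸ hXY) c1 c2
        rw [M1.lt_iff_left h1 h2 M3, M2.lt_iff_left h1 h2 M3]
        simp only [k1, k2, if_false, k3]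
      · have M3 := (D w hw).mid h1 h2 (z5 ▸ c1) ((z5 ▸ hXY).trans c2)
        have k1 := ys1 i hi z5 z6
        have k2 := ys2 w hw (z5 ▸ c1) (z5 ▸ c2)
        have k3 := th3 i hi w hw (z5 ▸ hXY) c1 c2
        rw [M1.lt_iff_right h1 h2 M3, M2.lt_iff_right h1 h2 M3]
        simp only [k1, k2, if_false, k3]
      · have M3 := (D w hw).mid h1 h2 (c1.trans z6) (z5.trans c2)
        have k3 := th1 i hi w hw z6 c1 c2
        obtain ⟨⟨k4, k5, k6⟩, k7, k8⟩ := ms i hi z5 z6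
        exact M1.through_middle h1 h2 M2 k4 k5 k6 k7 k8 M3 k3
  · intro i j hi hj hij e1 e2
    rcases zone i hi with ⟨z1, z2, z3, z0⟩ | ⟨z1, z2, z3, z0⟩ | ⟨⟨z1, z2, z3, z4⟩, z⟩
    · have k := co1 i j hi hj hij (z1.trans_lt hXY) e1 e2
      -- Creases at the same point that open to the same side are in the same zone.
      have w1 : min (y j) (y (j + 1)) < X ∧ min (y (j + 1)) (y (j + 1 + 1)) < X := by
        rcases zone j hj with ⟨_, w2, w3, _⟩ | ⟨w1, _⟩ | ⟨-, w | w | w⟩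
        · exact ⟨w2, w3⟩
        · exact absurd (e1 ▸ z1) ((hXY.trans_le w1).not_ge)
        · exact absurd (e2.1 (z0 (e1.trans w.1))) w.2
        · exact absurd (e1 ▸ z1) (w.1 ▸ hXY.not_ge)
        · exact absurd (e1 ▸ z1) w.1.not_ge
      rw [left_iso i (by omega) j (by omega) z2 w1.1, left_iso (i + 1) hi j (by omega) z3 w1.1,
        left_iso i (by omega) (j + 1) hj z2 w1.2, left_iso (i + 1) hi (j + 1) hj z3 w1.2]
      exact k
    · have k := co3 i j hi hj hij (hXY.trans_le z1) e1 e2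
      have w1 : Y < max (y j) (y (j + 1)) ∧ Y < max (y (j + 1)) (y (j + 1 + 1)) := by
        rcases zone j hj with ⟨w1, _⟩ | ⟨_, w2, w3, _⟩ | ⟨-, w | w | w⟩
        · exact absurd (e1 ▸ z1) ((w1.trans_lt hXY).not_ge)
        · exact ⟨w2, w3⟩
        · exact absurd (e1 ▸ z1) (w.1 ▸ hXY.not_ge)
        · exact absurd (e2.2 w.2) (z0 (e1.trans w.1))
        · exact absurd (e1 ▸ z1) w.2.not_ge
      rw [right_iso i (by omega) j (by omega) z2 w1.1, right_iso (i + 1) hi j (by omega) z3 w1.1,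
        right_iso i (by omega) (j + 1) hj z2 w1.2, right_iso (i + 1) hi (j + 1) hj z3 w1.2]
      exact k
    · have M1 := (D i (by omega)).mid h1 h2 z1 z2
      have M2 := (D (i + 1) hi).mid h1 h2 z3 z4
      have w1 : (min (y j) (y (j + 1)) < Y ∧ X < max (y j) (y (j + 1))) ∧
          min (y (j + 1)) (y (j + 1 + 1)) < Y ∧ X < max (y (j + 1)) (y (j + 1 + 1)) := by
        rcases zone j hj with ⟨w1, _, _, w2⟩ | ⟨w1, _, _, w2⟩ | ⟨⟨w1, w2, w3, w4⟩, -⟩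
        · rcases z with z | z | z
          · exact absurd (e2.2 (w2 (e1.symm.trans z.1))) z.2
          · exact absurd (e1 ▸ w1) (z.1 ▸ hXY.not_ge)
          · exact absurd (e1 ▸ w1) z.1.not_ge
        · rcases z with z | z | z
          · exact absurd (e1 ▸ w1) (z.1 ▸ hXY.not_ge)
          · exact absurd (e2.1 z.2) (w2 (e1.symm.trans z.1))
          · exact absurd (e1 ▸ w1) z.2.not_ge
        · exact ⟨⟨w1, w2⟩, w3, w4⟩
      have M3 := (D j (by omega)).mid h1 h2 w1.1.1 w1.1.2
      have M4 := (D (j + 1) hj).mid h1 h2 w1.2.1 w1.2.2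
      rcases z with ⟨z5, z6⟩ | ⟨z5, z6⟩ | ⟨z5, z6⟩
      · have k1 := xs1 i hi z5 z6
        have k2 := xs1 j hj (e1 ▸ z5) (fun h => z6 (e2.2 h))
        have k3 := co1 i j hi hj hij (z5 ▸ hXY) e1 e2
        exact M1.cross_left h1 h2 M2 M3 M4 k1 k2 k3
      · have k1 := ys1 i hi z5 z6
        have k2 := ys1 j hj (e1 ▸ z5) (e2.1 z6)
        have k3 := co3 i j hi hj hij (z5 ▸ hXY) e1 e2
        exact M1.cross_right h1 h2 M2 M3 M4 k1 k2 k3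
      · have k3 := co1 i j hi hj hij z6 e1 e2
        obtain ⟨⟨k4, k5, k6⟩, k7, k8⟩ := ms i hi z5 z6
        obtain ⟨⟨k9, k10, k11⟩, k12, k13⟩ := ms j hj (e1 ▸ z5) (e1 ▸ z6)
        -- Creases of the same class are shifted by the same amount. If the classes differ, both
        -- segments at the first crease are on the same side of each segment at the second.
        by_cases same : (H i < h a ↔ H j < h a) ∧ (H i < h (a + 1) ↔ H j < h (a + 1)) ∧
          (H i < h (a + 2) ↔ H j < h (a + 2))
        · obtain ⟨s1, s2, s3⟩ := same
          rw [M1.lt_iff_middle h1 h2 M3 s1 s2 s3 k7 k12,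
            M2.lt_iff_middle h1 h2 M3 (k4.symm.trans s1) (k5.symm.trans s2) (k6.symm.trans s3) k8 k12,
            M1.lt_iff_middle h1 h2 M4 (s1.trans k9) (s2.trans k10) (s3.trans k11) k7 k13,
            M2.lt_iff_middle h1 h2 M4 (k4.symm.trans (s1.trans k9)) (k5.symm.trans (s2.trans k10))
              (k6.symm.trans (s3.trans k11)) k8 k13]
          exact k3
        · have i1 := M1.lt_iff_lt h1 h2 M2 k4 k5 k6 k7 k8 M3 same
          have i2 := M1.lt_iff_lt h1 h2 M2 k4 k5 k6 k7 k8 M4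
            (fun c => same ⟨c.1.trans k9.symm, c.2.1.trans k10.symm, c.2.2.trans k11.symm⟩)
          simp only [i1, i2]
  · intro i hi
    rcases zone i hi with ⟨z1, z2, z3, -⟩ | ⟨z1, z2, z3, -⟩ | ⟨⟨z1, z2, z3, z4⟩, z⟩
    · have e := cr1 i hi (z1.trans_lt hXY)
      rw [left_iso i (by omega) (i + 1) hi z2 z3, e]
      simp only [hH, e, Nat.add_sub_cancel]
    · have hi' : i + 1 ≠ a := by
        intro e
        rw [e, ya] at z1
        exact absurd (hXY.trans_le (z1.trans l1)) (lt_irrefl _)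
      rw [right_iso i (by omega) (i + 1) hi z2 z3]
      simp only [hG, hr, skipTwo]
      rcases lt_or_ge i a with c | c
      · rw [if_pos c, if_pos (by omega), if_pos (by omega), Nat.add_sub_cancel]
      · rw [if_neg (by omega), if_neg (by omega), if_neg (by omega)]
        rfl
    · have M1 := (D i (by omega)).mid h1 h2 z1 z2
      have M2 := (D (i + 1) hi).mid h1 h2 z3 z4
      rcases z with ⟨z5, z6⟩ | ⟨z5, z6⟩ | ⟨z5, z6⟩
      · have k1 := xs1 i hi z5 z6
        have e := cr1 i hi (z5 ▸ hXY)
        rw [M1.lt_iff_left h1 h2 M2]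
        simp only [k1]
        simp only [hH, e, Nat.add_sub_cancel]
        split_ifs <;> rfl
      · have k1 := ys1 i hi z5 z6
        obtain ⟨e, -, -⟩ := cr3 i hi (z5 ▸ hXY)
        have hi' : i + 1 ≠ a := by
          intro e
          rw [e, ya] at z5
          exact absurd (z5 ▸ l1) hXY.not_ge
        rw [M1.lt_iff_right h1 h2 M2]
        have goal : G i < G (i + 1) ↔ h (skipTwo a (i + 1) - 1) < h (skipTwo a (i + 1)) := by
          simp only [hG, hr, skipTwo]
          rcases lt_or_ge i a with c | c
          · rw [if_pos c, if_pos (by omega), if_pos (by omega), Nat.add_sub_cancel]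
          · rw [if_neg (by omega), if_neg (by omega), if_neg (by omega)]
            rfl
        rw [← goal]
        simp only [k1]
        split_ifs <;> rfl
      · have e := cr1 i hi z6
        obtain ⟨⟨k4, k5, k6⟩, k7, k8⟩ := ms i hi z5 z6
        rw [M1.lt_iff_middle h1 h2 M2 k4 k5 k6 k7 k8, e]
        simp only [hH, e, Nat.add_sub_cancel]

end SimpleFolding

/-! ### Crimps in all orientations, and the impossibility of spirals -/

namespace SimpleFolding

/-- A reflection of the line and a reversal of the layer order reduce everything to
`exists_crimp_aux`. In the last clause, vertex `i + 1` of the new zigzag is vertex `skipTwo a (i +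
1)` of the old one; thus the remaining creases keep the order of their two layers, and later their
directions. -/
theorem Layering.exists_crimp {m : ℕ} {x : ℕ → ℚ} {h : ℕ → ℤ} (L : Layering (m + 2) x h)
    {a : ℕ} (ha : a < m) (hmono : h a < h (a + 1) ↔ h (a + 1) < h (a + 2))
    (l : (x a < x (a + 1) ∧ x a ≤ x (a + 2) ∧ x (a + 1) ≤ x (a + 3)) ∨
      (x (a + 1) < x a ∧ x (a + 2) ≤ x a ∧ x (a + 3) ≤ x (a + 1))) :
    ∃ h' : ℕ → ℤ, Layering m (fun i => x (skipTwo a i)) h' ∧ ∀ i, i + 1 < m →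
      (h' i < h' (i + 1) ↔ h (skipTwo a (i + 1) - 1) < h (skipTwo a (i + 1))) := by
  have key : ∀ (x : ℕ → ℚ), Layering (m + 2) x h → x a < x (a + 1) → x a ≤ x (a + 2) →
      x (a + 1) ≤ x (a + 3) → ∃ h' : ℕ → ℤ, Layering m (fun i => x (skipTwo a i)) h' ∧
        ∀ i, i + 1 < m →
          (h' i < h' (i + 1) ↔ h (skipTwo a (i + 1) - 1) < h (skipTwo a (i + 1))) := by
    intro x L h0 l1 l2
    by_cases c : h a < h (a + 1)
    · exact L.exists_crimp_aux ha h0 c (hmono.1 c) l1 l2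
    · have ne : ∀ i < m + 2, ∀ j < m + 2, i ≠ j → h i ≠ h j := fun i hi j hj n e =>
        n (L.inj i hi j hj e)
      have n1 := ne a (by omega) (a + 1) (by omega) (by omega)
      have n2 := ne (a + 1) (by omega) (a + 2) (by omega) (by omega)
      obtain ⟨h', L', hd⟩ := L.flip.exists_crimp_aux ha h0 (by omega) (by omega) l1 l2
      refine ⟨fun i => - h' i, L'.flip, fun i hi => ?_⟩
      have k := hd i hi
      have n3 : h' i ≠ h' (i + 1) := fun e => by
        have := L'.inj i (by omega) (i + 1) hi e
        omega
      have hs : skipTwo a (i + 1) < m + 2 ∧ 1 ≤ skipTwo a (i + 1) := by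
        unfold skipTwo; split_ifs <;> omega
      have n4 := ne (skipTwo a (i + 1) - 1) (by omega) (skipTwo a (i + 1)) hs.1 (by omega)
      simp only [neg_lt_neg_iff] at k ⊢
      omega
  rcases l with ⟨h0, l1, l2⟩ | ⟨h0, l1, l2⟩
  · exact key x L h0 l1 l2
  · obtain ⟨h', L', hd⟩ := key (fun i => - x i) L.neg (neg_lt_neg h0) (neg_le_neg l1) (neg_le_neg l2)
    refine ⟨h', ?_, hd⟩
    have := L'.neg
    simpa using this

/-- Equal segments between two longer ones cannot all turn in the same direction. -/
theorem Layering.no_spiral {m : ℕ} {x : ℕ → ℚ} {h : ℕ → ℤ} (L : Layering m x h) {a k : ℕ}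
    (hk : 1 ≤ k) (hm : a + k + 1 < m) (eq : ∀ i, a + 1 ≤ i → i + 1 ≤ a + k → x (i + 2) = x i)
    (first : min (x a) (x (a + 1)) < x (a + 2) ∧ x (a + 2) < max (x a) (x (a + 1)))
    (last : min (x (a + k + 1)) (x (a + k + 2)) < x (a + k) ∧
      x (a + k) < max (x (a + k + 1)) (x (a + k + 2)))
    (same : ∀ i, a ≤ i → i + 1 ≤ a + k → (h i < h (i + 1) ↔ ¬ h (i + 1) < h (i + 2))) : False := by
  have ne : ∀ i < m, ∀ j < m, i ≠ j → h i ≠ h j := fun i hi j hj n e => n (L.inj i hi j hj e)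
  -- By `same` the heights alternately rise and fall. The claim is that each layer lies between the
  -- two before it: the paper winds inwards.
  have key : ∀ j, j + 1 ≤ k → (h (a + j) < h (a + j + 2) ↔ h (a + j + 2) < h (a + j + 1)) := by
    intro j
    induction j with
    | zero =>
      intro _
      -- The long segment `a` runs past the crease at vertex `a + 2`, so it does not lie between the
      -- two layers joined there.
      have t := L.through (a + 1) (by omega) a (by omega) first.1 first.2
      have s := same a le_rfl (by omega)
      have n1 := ne a (by omega) (a + 1) (by omega) (by omega)
      have n2 := ne a (by omega) (a + 2) (by omega) (by omega)
      have n3 := ne (a + 1) (by omega) (a + 2) (by omega) (by omega)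
      simp only [show a + 1 + 1 = a + 2 from rfl, Nat.add_zero] at *
      omega
    | succ j ih =>
      intro hj
      have p := ih (by omega)
      have o1 := L.turn (a + j) (by omega)
      have o2 := L.turn (a + j + 1) (by omega)
      have e := eq (a + j + 1) (by omega) (by omega)
      have ne1 := L.ne (a + j + 1) (by omega)
      -- The creases at vertices `a + j + 1` and `a + j + 3` lie at the same point and open to the
      -- same side. As they do not interlock, the next layer is also inside.
      have c := L.cross (a + j) (a + j + 2) (by omega) (by omega) (by omega) e.symm (by
        rw [o1, show a + j + 2 + 1 = a + j + 1 + 2 from by omega, e])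
      have s := same (a + j + 1) (by omega) (by omega)
      have n1 := ne (a + j) (by omega) (a + j + 1) (by omega) (by omega)
      have n2 := ne (a + j) (by omega) (a + j + 2) (by omega) (by omega)
      have n3 := ne (a + j + 1) (by omega) (a + j + 2) (by omega) (by omega)
      have n4 := ne (a + j + 3) (by omega) (a + j + 2) (by omega) (by omega)
      have n5 := ne (a + j + 3) (by omega) (a + j + 1) (by omega) (by omega)
      have n6 := ne (a + j + 3) (by omega) (a + j) (by omega) (by omega)
      simp only [show a + (j + 1) = a + j + 1 from rfl, show a + j + 1 + 1 = a + j + 2 from rfl,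
        show a + j + 1 + 2 = a + j + 3 from rfl] at *
      omega
  obtain ⟨k, rfl⟩ : ∃ k', k = k' + 1 := ⟨k - 1, by omega⟩
  have p := key k le_rfl
  -- The long segment at the end runs past the crease of the two layers between which `p` places it.
  have t := L.through (a + k) (by omega) (a + k + 2) (by omega) last.1 last.2
  have n1 := ne (a + k) (by omega) (a + k + 1) (by omega) (by omega)
  have n2 := ne (a + k) (by omega) (a + k + 2) (by omega) (by omega)
  have n3 := ne (a + k + 1) (by omega) (a + k + 2) (by omega) (by omega)
  omega

/-! ### Words -/

/-- A zigzag as a word: for each vertex its position, with alternating sign, and the direction of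
the crease there. The segment between two neighbours has the sum of their entries as its length, and
the directions at the two ends are immaterial. -/
abbrev Word := List (ℚ × Direction)

/-- The entry of a word at a vertex. -/
def Word.z (L : Word) (i : ℕ) : ℚ := (L.getD i (0, .mountain)).1

/-- The direction at a vertex. -/
def Word.dir (L : Word) (i : ℕ) : Direction := (L.getD i (0, .mountain)).2

/-- The positions of the vertices. -/
def Word.pos (ε : ℚ) (L : Word) (i : ℕ) : ℚ := ε * (-1) ^ i * L.z i

/-- The zigzag described by a word has a layer order without crossings. -/
def Flat (L : Word) : Prop :=
  (∀ i, i + 1 < L.length → 0 < L.z i + L.z (i + 1)) ∧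
  ∃ ε : ℚ, (ε = 1 ∨ ε = -1) ∧ ∃ h : ℕ → ℤ, Layering (L.length - 1) (L.pos ε) h ∧
    ∀ i, i + 1 < L.length - 1 →
      (L.dir (i + 1) = .valley ↔ (L.pos ε i < L.pos ε (i + 1) ↔ h i < h (i + 1)))

/-- Removing a crimp from a word. -/
inductive Crimp : Word → Word → Prop
  | mk (pre : Word) (a b c d : ℚ × Direction) (post : Word) : c.1 ≤ a.1 → b.1 ≤ d.1 → b.2 ≠ c.2 →
      Crimp (pre ++ a :: b :: c :: d :: post) (pre ++ a :: d :: post)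

/-- Without the first vertex all indices drop by one, which the opposite sign `-ε` compensates. -/
theorem Flat.tail {a : ℚ × Direction} {L : Word} (h : Flat (a :: L)) : Flat L := by
  cases L with
  | nil =>
    exact ⟨by simp, 1, Or.inl rfl, fun _ => 0, ⟨by simp, by simp, by simp, by simp, by simp⟩, by simp⟩
  | cons b L =>
    obtain ⟨hp, ε, hε, h, Lay, hd⟩ := h
    have hz : ∀ i, Word.pos ε (a :: b :: L) (i + 1) = Word.pos (-ε) (b :: L) i := by
      intro i
      simp only [Word.pos, Word.z, List.getD_cons_succ, pow_succ]
      ring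
    refine ⟨fun i hi => hp (i + 1) (by simpa using hi), -ε, ?_, fun i => h (i + 1), ?_, ?_⟩
    · rcases hε with rfl | rfl <;> simp
    · have := Lay.tail
      simp only [hz] at this
      exact this
    · intro i hi
      have := hd (i + 1) (by simp at hi ⊢; omega)
      rw [hz, hz] at this
      exact this

theorem getD_skipTwo {α : Type*} (pre : List α) (a b c d : α) (post : List α) (i : ℕ) (e : α) :
    (pre ++ a :: d :: post).getD i e =
      (pre ++ a :: b :: c :: d :: post).getD (skipTwo pre.length i) e := by
  unfold skipTwo
  rcases lt_trichotomy i pre.length with h | h | h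
  · rw [if_pos h.le, List.getD_append _ _ _ _ h, List.getD_append _ _ _ _ h]
  · subst h
    rw [if_pos le_rfl, List.getD_append_right _ _ _ _ le_rfl, List.getD_append_right _ _ _ _ le_rfl]
    simp
  · rw [if_neg (by omega), List.getD_append_right _ _ _ _ h.le,
      List.getD_append_right _ _ _ _ (by omega)]
    obtain ⟨j, rfl⟩ : ∃ j, i = pre.length + 1 + j := ⟨i - pre.length - 1, by omega⟩
    rw [show pre.length + 1 + j - pre.length = j + 1 by omega,
      show pre.length + 1 + j + 2 - pre.length = j + 3 by omega]
    simp

theorem iff_of_turns {P Q U A B : Prop} (h₁ : P ↔ (U ↔ A)) (h₂ : Q ↔ (¬ U ↔ B)) (h : P ↔ ¬ Q) :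
    A ↔ B := by
  tauto

/-- The orientation of the segments alternates, so two consecutive creases have opposite directions
exactly if the heights of the three segments are monotone. The inequalities between the entries say
that the middle segment is no longer than its neighbours, as `Layering.exists_crimp` requires. -/
theorem Flat.crimp {L L' : Word} (hc : Crimp L L') (hL : Flat L) : Flat L' := by
  obtain ⟨pre, a, b, c, d, post, hca, hbd, hdir⟩ := hc
  set L := pre ++ a :: b :: c :: d :: post with hLdef
  set L' := pre ++ a :: d :: post with hLdef'
  obtain ⟨hp, ε, hε, h, Lay, hd⟩ := hL
  set p := pre.length with hpdef
  have len : L.length = p + post.length + 4 := by simp [hLdef, hpdef]; omega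
  have len' : L'.length = p + post.length + 2 := by simp [hLdef', hpdef]; omega
  have hz : ∀ i, L'.z i = L.z (skipTwo p i) := fun i => by
    simp only [Word.z, hLdef, hLdef', getD_skipTwo pre a b c d post]; rfl
  have hdr : ∀ i, L'.dir i = L.dir (skipTwo p i) := fun i => by
    simp only [Word.dir, hLdef, hLdef', getD_skipTwo pre a b c d post]; rfl
  have gz : ∀ j, L.getD (p + j) (0, .mountain) = (a :: b :: c :: d :: post).getD j (0, .mountain) := by
    intro j
    rw [hLdef, List.getD_append_right _ _ _ _ (by omega)]
    congr 1; omega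
  have za : L.z p = a.1 := by have := gz 0; simp only [Word.z]; rw [← Nat.add_zero p, this]; rfl
  have zb : L.z (p + 1) = b.1 := by simp only [Word.z]; rw [gz]; rfl
  have zc : L.z (p + 2) = c.1 := by simp only [Word.z]; rw [gz]; rfl
  have zd : L.z (p + 3) = d.1 := by simp only [Word.z]; rw [gz]; rfl
  have db : L.dir (p + 1) = b.2 := by simp only [Word.dir]; rw [gz]; rfl
  have dc : L.dir (p + 2) = c.2 := by simp only [Word.dir]; rw [gz]; rfl
  have pab := hp p (by omega)
  have pbc := hp (p + 1) (by omega)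
  have pcd := hp (p + 2) (by omega)
  simp only [show p + 1 + 1 = p + 2 from rfl, show p + 2 + 1 = p + 3 from rfl] at pab pbc pcd
  rw [za, zb] at pab
  rw [zb, zc] at pbc
  rw [zc, zd] at pcd
  have hpos : ∀ i, L'.pos ε i = L.pos ε (skipTwo p i) := by
    intro i
    simp only [Word.pos, hz]
    congr 2
    unfold skipTwo
    split_ifs
    · rfl
    · rw [pow_add]; simp
  -- positions of the four vertices
  obtain ⟨s, hs, ha, hb, hc', hd'⟩ : ∃ s : ℚ, (s = 1 ∨ s = -1) ∧ L.pos ε p = s * a.1 ∧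
      L.pos ε (p + 1) = -(s * b.1) ∧ L.pos ε (p + 2) = s * c.1 ∧ L.pos ε (p + 3) = -(s * d.1) := by
    refine ⟨ε * (-1) ^ p, ?_, ?_, ?_, ?_, ?_⟩
    · rcases hε with rfl | rfl <;> rcases neg_one_pow_eq_or ℚ p with e | e <;> simp [e]
    · simp only [Word.pos, za]
    · simp only [Word.pos, zb, pow_add]; ring
    · simp only [Word.pos, zc, pow_add]; ring
    · simp only [Word.pos, zd, pow_add]; ring
  rw [show L.length - 1 = (p + post.length + 1) + 2 by omega] at Lay hd
  have d1 := hd p (by omega)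
  have d2 := hd (p + 1) (by omega)
  simp only [show p + 1 + 1 = p + 2 from rfl] at d2
  rw [db] at d1
  rw [dc] at d2
  have t := Lay.turn p (by omega)
  have hne1 : h p ≠ h (p + 1) := fun e => by
    have := Lay.inj p (by omega) (p + 1) (by omega) e; omega
  have hne2 : h (p + 1) ≠ h (p + 2) := fun e => by
    have := Lay.inj (p + 1) (by omega) (p + 2) (by omega) e; omega
  have hdir' : b.2 = .valley ↔ ¬ c.2 = .valley := by
    cases hb : b.2 <;> cases hc : c.2 <;> simp_all
  have ne2 := Lay.ne (p + 1) (by omega)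
  have ht : L.pos ε (p + 1) < L.pos ε (p + 2) ↔ ¬ L.pos ε p < L.pos ε (p + 1) := by
    rw [t, not_lt]
    exact ⟨fun h => h.le, fun h => lt_of_le_of_ne h ne2⟩
  have hmono : h p < h (p + 1) ↔ h (p + 1) < h (p + 2) := by
    rw [ht] at d2
    exact iff_of_turns d1 d2 hdir'
  have hl : (L.pos ε p < L.pos ε (p + 1) ∧ L.pos ε p ≤ L.pos ε (p + 2) ∧
        L.pos ε (p + 1) ≤ L.pos ε (p + 3)) ∨
      (L.pos ε (p + 1) < L.pos ε p ∧ L.pos ε (p + 2) ≤ L.pos ε p ∧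
        L.pos ε (p + 3) ≤ L.pos ε (p + 1)) := by
    rw [ha, hb, hc', hd']
    rcases hs with rfl | rfl
    · right; refine ⟨?_, ?_, ?_⟩ <;> linarith
    · left; refine ⟨?_, ?_, ?_⟩ <;> linarith
  obtain ⟨h', Lay', hh'⟩ := Lay.exists_crimp (a := p) (by omega) hmono hl
  refine ⟨?_, ε, hε, h', ?_, ?_⟩
  · intro i hi
    rw [hz, hz]
    by_cases e : i = p
    · subst e
      have e1 : skipTwo p p = p := if_pos le_rfl
      have e2 : skipTwo p (p + 1) = p + 3 := if_neg (by omega)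
      rw [e1, e2, za, zd]
      linarith
    · have e1 : skipTwo p (i + 1) = skipTwo p i + 1 := by
        unfold skipTwo; split_ifs <;> omega
      rw [e1]
      apply hp
      unfold skipTwo; split_ifs <;> omega
  · rw [show L'.length - 1 = p + post.length + 1 by omega]
    have : L'.pos ε = fun i => L.pos ε (skipTwo p i) := funext hpos
    rw [this]
    exact Lay'
  · intro i hi
    have k := hh' i (by omega)
    have e1 : 1 ≤ skipTwo p (i + 1) ∧ skipTwo p (i + 1) < p + post.length + 3 := by
      unfold skipTwo; split_ifs <;> omega
    have k' := hd (skipTwo p (i + 1) - 1) (by omega)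
    rw [show skipTwo p (i + 1) - 1 + 1 = skipTwo p (i + 1) by omega] at k'
    rw [hdr, k', ← k, hpos, hpos]
    by_cases e : i = p
    · subst e
      have e1 : skipTwo p p = p := if_pos le_rfl
      have e2 : skipTwo p (p + 1) = p + 3 := if_neg (by omega)
      rw [e1, e2, show p + 3 - 1 = p + 2 by omega, ha, hc', hd']
      -- The segment that ends at `d` now comes from `a` instead of `c`, with the same orientation.
      have : s * c.1 < -(s * d.1) ↔ s * a.1 < -(s * d.1) := by
        rcases hs with rfl | rfl
        · constructor <;> intro <;> linarith
        · constructor <;> intro <;> linarith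
      rw [this]
    · have e1 : skipTwo p (i + 1) = skipTwo p i + 1 := by
        unfold skipTwo; split_ifs <;> omega
      rw [e1, Nat.add_sub_cancel]

end SimpleFolding

namespace SimpleFolding

/-! ### Runs of equal segments -/

theorem iff_not_of_turn {P U A B : Prop} (h : P ↔ (U ↔ A)) (h' : P ↔ (¬ U ↔ B)) : A ↔ ¬ B := by
  tauto

/-- Consecutive segments `i` and `i + 1` have equal length exactly if `z (i + 2) = z i`, and equal
directions at consecutive creases make the heights alternate. So this is `Layering.no_spiral`, read
off from the word. -/
theorem Flat.no_spiral {L : Word} (hL : Flat L) {a k : ℕ} (hk : 1 ≤ k) (hm : a + k + 2 < L.length)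
    (eq : ∀ i, a + 1 ≤ i → i + 1 ≤ a + k → L.z (i + 2) = L.z i) (first : L.z (a + 2) < L.z a)
    (last : L.z (a + k) < L.z (a + k + 2))
    (same : ∀ i, a ≤ i → i + 1 ≤ a + k → L.dir (i + 1) = L.dir (i + 2)) : False := by
  obtain ⟨hp, ε, hε, h, Lay, hd⟩ := hL
  have sgn : ∀ i, ∃ s : ℚ, (s = 1 ∨ s = -1) ∧ L.pos ε i = s * L.z i ∧
      L.pos ε (i + 1) = -(s * L.z (i + 1)) ∧ L.pos ε (i + 2) = s * L.z (i + 2) := by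
    intro i
    refine ⟨ε * (-1) ^ i, ?_, rfl, ?_, ?_⟩
    · rcases hε with rfl | rfl <;> rcases neg_one_pow_eq_or ℚ i with e | e <;> simp [e]
    · simp only [Word.pos, pow_add]; ring
    · simp only [Word.pos, pow_add]; ring
  refine Lay.no_spiral hk (a := a) (by omega) ?_ ?_ ?_ ?_
  · intro i h1 h2
    obtain ⟨s, -, e1, -, e3⟩ := sgn i
    rw [e1, e3, eq i h1 h2]
  · obtain ⟨s, hs, e1, e2, e3⟩ := sgn a
    have p1 := hp a (by omega)
    have p2 := hp (a + 1) (by omega)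
    rw [e1, e2, e3]
    simp only [show a + 1 + 1 = a + 2 from rfl] at p2
    rcases hs with rfl | rfl
    · exact ⟨min_lt_iff.2 (Or.inr (by linarith)), lt_max_iff.2 (Or.inl (by linarith))⟩
    · exact ⟨min_lt_iff.2 (Or.inl (by linarith)), lt_max_iff.2 (Or.inr (by linarith))⟩
  · obtain ⟨s, hs, e1, e2, e3⟩ := sgn (a + k)
    have p1 := hp (a + k) (by omega)
    have p2 := hp (a + k + 1) (by omega)
    rw [e1, e2, e3]
    simp only [show a + k + 1 + 1 = a + k + 2 from rfl] at p2
    rcases hs with rfl | rfl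
    · exact ⟨min_lt_iff.2 (Or.inl (by linarith)), lt_max_iff.2 (Or.inr (by linarith))⟩
    · exact ⟨min_lt_iff.2 (Or.inr (by linarith)), lt_max_iff.2 (Or.inl (by linarith))⟩
  · intro i h1 h2
    have d1 := hd i (by omega)
    have d2 := hd (i + 1) (by omega)
    have s := same i h1 h2
    have t := Lay.turn i (by omega)
    have n2 := Lay.ne (i + 1) (by omega)
    simp only [show i + 1 + 1 = i + 2 from rfl] at *
    rw [s] at d1
    have ht : L.pos ε (i + 1) < L.pos ε (i + 2) ↔ ¬ L.pos ε i < L.pos ε (i + 1) := by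
      rw [t, not_lt]
      exact ⟨fun h => h.le, fun h => lt_of_le_of_ne h n2⟩
    rw [ht] at d2
    exact iff_not_of_turn d1 d2

/-- The alternating sequence `p, q, p, …` with the given labels. -/
def alt {β : Type*} (p q : ℚ) : List β → List (ℚ × β)
  | [] => []
  | d :: R => (p, d) :: alt q p R

@[simp] theorem length_alt {β : Type*} (p q : ℚ) (R : List β) : (alt p q R).length = R.length := by
  induction R generalizing p q with
  | nil => rfl
  | cons d R ih => simp [alt, ih]

theorem alt_append {β : Type*} (p q : ℚ) (R R' : List β) :
    alt p q (R ++ R') = alt p q R ++ if Even R.length then alt p q R' else alt q p R' := by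
  induction R generalizing p q with
  | nil => simp [alt]
  | cons d R ih =>
    simp only [List.cons_append, alt, ih, List.length_cons, Nat.even_add_one]
    split_ifs <;> simp_all

theorem reverse_alt {β : Type*} (p q : ℚ) (R : List β) :
    (alt p q R).reverse = if Even R.length then alt q p R.reverse else alt p q R.reverse := by
  induction R generalizing p q with
  | nil => simp [alt]
  | cons d R ih =>
    simp only [alt, List.reverse_cons, ih, List.length_cons, Nat.even_add_one]
    split_ifs with h <;> simp_all [alt_append, alt]

theorem getD_alt {β : Type*} (p q : ℚ) (R : List β) (i : ℕ) (hi : i < R.length) (e : ℚ × β)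
    (e' : β) : (alt p q R).getD i e = (if Even i then p else q, R.getD i e') := by
  induction R generalizing p q i with
  | nil => simp at hi
  | cons d R ih =>
    cases i with
    | zero => simp [alt]
    | succ i =>
      simp only [alt, List.getD_cons_succ]
      rw [ih q p i (by simpa using hi)]
      simp only [Nat.even_add_one]
      split_ifs <;> simp_all

/-- Mountains count positively, valleys negatively. -/
def Direction.sign : Direction → ℤ
  | .mountain => 1
  | .valley => -1

/-- The excess of mountains over valleys. -/
def signSum (R : List Direction) : ℤ := (R.map Direction.sign).sum

theorem signSum_replicate (j : ℕ) (d : Direction) : signSum (List.replicate j d) = j * d.sign := by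
  simp [signSum]

theorem signSum_emod (R : List Direction) : signSum R % 2 = R.length % 2 := by
  induction R with
  | nil => rfl
  | cons d R ih =>
    simp only [signSum, List.map_cons, List.sum_cons, List.length_cons] at *
    cases d <;> simp only [Direction.sign] <;> omega

/-- A run of equal segments can be crimped until all its creases have the same direction. -/
theorem exists_crimps (R : List Direction) (y : ℚ × Direction) (post : Word) :
    ∀ (pre : Word) (a : ℚ × Direction) (p q : ℚ), q ≤ a.1 → (Even R.length → p ≤ y.1) →
      (¬ Even R.length → q ≤ y.1) → ∃ j d, signSum R = signSum (List.replicate j d) ∧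
        Relation.ReflTransGen Crimp (pre ++ a :: (alt p q R ++ y :: post))
          (pre ++ a :: (alt p q (List.replicate j d) ++ y :: post)) := by
  induction R with
  | nil => exact fun pre a p q _ _ _ => ⟨0, .mountain, rfl, .refl⟩
  | cons b R ih =>
    intro pre a p q ha h1 h2
    simp only [List.length_cons, Nat.even_add_one, not_not] at h1 h2
    obtain ⟨j, d, hs, hc⟩ := ih (pre ++ [a]) (p, b) q p le_rfl h2 h1
    have hpar := signSum_emod R
    rw [hs, signSum_emod, List.length_replicate] at hpar
    simp only [List.append_assoc, List.singleton_append] at hc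
    have hsum : signSum (b :: R) = b.sign + signSum (List.replicate j d) := by
      rw [← hs]; simp [signSum]
    -- The creases to the right have been crimped to `j` creases of direction `d`. The new crease
    -- either extends them or cancels against the first of them.
    by_cases hbd : b = d
    · subst hbd
      refine ⟨j + 1, b, ?_, ?_⟩
      · rw [hsum, List.replicate_succ]; simp [signSum]
      · exact hc
    cases j with
    | zero =>
      refine ⟨1, b, ?_, hc⟩
      rw [hsum]; simp [signSum]
    | succ j =>
      refine ⟨j, d, ?_, hc.tail ?_⟩
      · rw [hsum, List.replicate_succ]
        simp only [signSum, List.map_cons, List.sum_cons]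
        cases b <;> cases d <;> simp_all [Direction.sign]
      -- Behind the cancelled pair comes either the vertex `y` after the run or another vertex of
      -- the run; the crimp is permitted in both cases.
      · cases j with
        | zero =>
          have : ¬ Even R.length := by rw [Nat.even_iff]; omega
          exact Crimp.mk pre a (p, b) (q, d) y post ha (h1 this) hbd
        | succ j =>
          exact Crimp.mk pre a (p, b) (q, d) (p, d) (alt q p (List.replicate j d) ++ y :: post)
            ha le_rfl hbd

theorem Flat.crimps {L L' : Word} (hL : Flat L) (h : Relation.ReflTransGen Crimp L L') : Flat L' := by
  induction h with
  | refl => exact hL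
  | tail _ h ih => exact ih.crimp h

/-- Between strictly longer segments, `j` creases of one direction bound `j - 1` equal segments,
which for `j ≥ 2` form the forbidden spiral. -/
theorem Flat.run_le_one {pre post : Word} {a y : ℚ × Direction} {p q : ℚ} {j : ℕ} {d : Direction}
    (hL : Flat (pre ++ a :: (alt p q (List.replicate j d) ++ y :: post))) (ha : q < a.1)
    (h1 : Even j → p < y.1) (h2 : ¬ Even j → q < y.1) : j ≤ 1 := by
  by_contra hj
  set L := pre ++ a :: (alt p q (List.replicate j d) ++ y :: post) with hLdef
  have g0 : ∀ i, L.getD (pre.length + i) (0, .mountain) =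
      (a :: (alt p q (List.replicate j d) ++ y :: post)).getD i (0, .mountain) := by
    intro i
    rw [hLdef, List.getD_append_right _ _ _ _ (by omega)]
    congr 1; omega
  have g1 : ∀ i, i < j → L.getD (pre.length + i + 1) (0, .mountain) =
      (if Even i then p else q, d) := by
    intro i hi
    rw [add_assoc, g0, List.getD_cons_succ, List.getD_append _ _ _ _ (by simpa using hi),
      getD_alt p q _ i (by simpa using hi) _ d]
    simp
  have z0 : L.z pre.length = a.1 := by
    have := g0 0
    simp only [Word.z]; rw [← Nat.add_zero pre.length, this]; rfl
  have zy : L.z (pre.length + j + 1) = y.1 := by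
    simp only [Word.z]
    rw [add_assoc, g0, List.getD_cons_succ, List.getD_append_right _ _ _ _ (by simp)]
    simp
  have z1 : ∀ i, i < j → L.z (pre.length + i + 1) = if Even i then p else q := by
    intro i hi
    simp only [Word.z, g1 i hi]
  have d1 : ∀ i, i < j → L.dir (pre.length + i + 1) = d := by
    intro i hi
    simp only [Word.dir, g1 i hi]
  refine hL.no_spiral (a := pre.length) (k := j - 1) (by omega) ?_ ?_ ?_ ?_ ?_
  · simp [hLdef]; omega
  · intro i h3 h4
    obtain ⟨i, rfl⟩ : ∃ i', i = pre.length + i' + 1 := ⟨i - pre.length - 1, by omega⟩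
    rw [show pre.length + i + 1 + 2 = pre.length + (i + 2) + 1 by omega, z1 _ (by omega),
      z1 _ (by omega)]
    simp [Nat.even_add]
  · rw [show pre.length + 2 = pre.length + 1 + 1 by omega, z1 1 (by omega), z0]
    simpa using ha
  · rw [show pre.length + (j - 1) + 2 = pre.length + j + 1 by omega, zy,
      show pre.length + (j - 1) = pre.length + (j - 2) + 1 by omega, z1 _ (by omega)]
    have : Even (j - 2) ↔ Even j := by
      rw [Nat.even_sub (by omega)]; simp
    split_ifs with h
    · exact h1 (this.1 h)
    · exact h2 (fun h' => h (this.2 h'))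
  · intro i h3 h4
    obtain ⟨i, rfl⟩ : ∃ i', i = pre.length + i' := ⟨i - pre.length, by omega⟩
    rw [d1 i (by omega), show pre.length + i + 2 = pre.length + (i + 1) + 1 by omega,
      d1 (i + 1) (by omega)]

/-- Words that can be reduced to a single segment by removing crimps and end segments. -/
inductive Reducible : Word → Prop
  | pair (a b : ℚ × Direction) : Reducible [a, b]
  | left {a b c : ℚ × Direction} {L : Word} : a.1 ≤ c.1 → Reducible (b :: c :: L) →
      Reducible (a :: b :: c :: L)
  | right {a b c : ℚ × Direction} {L : Word} : c.1 ≤ a.1 → Reducible (L ++ [a, b]) →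
      Reducible (L ++ [a, b, c])
  | crimp {L L' : Word} : Crimp L L' → Reducible L' → Reducible L

theorem Reducible.crimps {L L' : Word} (hL : Reducible L') (h : Relation.ReflTransGen Crimp L L') :
    Reducible L := by
  induction h using Relation.ReflTransGen.head_induction_on with
  | refl => exact hL
  | head h _ ih => exact .crimp h ih

/-! ### Words with labels -/

/-- The direction agrees with the label if the label prescribes one. -/
def Allowed (d : Direction) (l : Letter) : Prop := ∀ d', l = .assigned d' → d = d'

/-- `L` is the word `M` with directions that agree with the labels. -/
def Agrees (L : Word) (M : List (ℚ × Letter)) : Prop :=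
  List.Forall₂ (fun v w => v.1 = w.1 ∧ Allowed v.2 w.2) L M

/-- The least sign that the label allows. -/
def loSign : Letter → ℤ
  | .assigned .mountain => 1
  | _ => -1

/-- The greatest sign that the label allows. -/
def hiSign : Letter → ℤ
  | .assigned .valley => -1
  | _ => 1

theorem Allowed.bounds {d : Direction} {l : Letter} (h : Allowed d l) :
    loSign l ≤ d.sign ∧ d.sign ≤ hiSign l := by
  unfold Allowed at h
  cases d <;> cases l <;> simp_all [loSign, hiSign, Direction.sign] <;>
    (rename_i d; cases d <;> simp_all)

theorem signSum_bounds {R : List Direction} {cs : List Letter} (h : List.Forall₂ Allowed R cs) :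
    (cs.map loSign).sum ≤ signSum R ∧ signSum R ≤ (cs.map hiSign).sum := by
  induction h with
  | nil => simp [signSum]
  | cons h _ ih =>
    have := h.bounds
    simp only [signSum, List.map_cons, List.sum_cons] at *
    omega

theorem sum_loSign_emod (cs : List Letter) : (cs.map loSign).sum % 2 = cs.length % 2 := by
  induction cs with
  | nil => rfl
  | cons c cs ih =>
    have : loSign c = 1 ∨ loSign c = -1 := by
      cases c <;> simp [loSign] <;> (rename_i d; cases d <;> simp)
    simp only [List.map_cons, List.sum_cons, List.length_cons]
    omega

theorem sum_hiSign_emod (cs : List Letter) : (cs.map hiSign).sum % 2 = cs.length % 2 := by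
  induction cs with
  | nil => rfl
  | cons c cs ih =>
    have : hiSign c = 1 ∨ hiSign c = -1 := by
      cases c <;> simp [hiSign] <;> (rename_i d; cases d <;> simp)
    simp only [List.map_cons, List.sum_cons, List.length_cons]
    omega

theorem sum_loSign_le (cs : List Letter) : (cs.map loSign).sum ≤ (cs.map hiSign).sum := by
  induction cs with
  | nil => simp
  | cons c cs ih =>
    have : loSign c ≤ hiSign c := by
      cases c <;> simp [loSign, hiSign] <;> (rename_i d; cases d <;> simp)
    simp only [List.map_cons, List.sum_cons]
    omega

/-- Reversing an unassigned crease changes the sum by two, so every value of the right parity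
between the extremes occurs. The induction takes a valley unless the remaining creases could not
make up for it. -/
theorem exists_signSum (cs : List Letter) : ∀ s : ℤ, (cs.map loSign).sum ≤ s →
    s ≤ (cs.map hiSign).sum → s % 2 = cs.length % 2 →
    ∃ R, List.Forall₂ Allowed R cs ∧ signSum R = s := by
  induction cs with
  | nil =>
    intro s h1 h2 _
    simp only [List.map_nil, List.sum_nil] at h1 h2
    exact ⟨[], .nil, by simp [signSum]; omega⟩
  | cons c cs ih =>
    intro s h1 h2 h3
    have hlo := sum_loSign_le cs
    have hp := sum_hiSign_emod cs
    have hq := sum_loSign_emod cs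
    simp only [List.map_cons, List.sum_cons, List.length_cons] at h1 h2 h3
    have fin : ∀ d : Direction, Allowed d c → (cs.map loSign).sum ≤ s - d.sign →
        s - d.sign ≤ (cs.map hiSign).sum →
        ∃ R, List.Forall₂ Allowed R (c :: cs) ∧ signSum R = s := by
      intro d hd k1 k2
      obtain ⟨R, hR, hs⟩ := ih (s - d.sign) k1 k2 (by cases d <;> simp only [Direction.sign] <;> omega)
      refine ⟨d :: R, .cons hd hR, ?_⟩
      have : signSum (d :: R) = d.sign + signSum R := by simp [signSum]
      omega
    by_cases hM : c = .assigned .mountain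
    · subst hM
      simp only [loSign, hiSign] at h1 h2
      exact fin .mountain (by intro d' h; simpa using h) (by simp [Direction.sign]; omega)
        (by simp [Direction.sign]; omega)
    by_cases hV : c = .assigned .valley
    · subst hV
      simp only [loSign, hiSign] at h1 h2
      exact fin .valley (by intro d' h; simpa using h) (by simp [Direction.sign]; omega)
        (by simp [Direction.sign]; omega)
    have free : ∀ d, Allowed d c := by
      intro d d' h
      cases d' <;> simp_all
    have e1 : loSign c = -1 := by unfold loSign; split <;> simp_all
    have e2 : hiSign c = 1 := by unfold hiSign; split <;> simp_all
    rw [e1] at h1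
    rw [e2] at h2
    by_cases k : s + 1 ≤ (cs.map hiSign).sum
    · exact fin .valley (free _) (by simp only [Direction.sign]; omega)
        (by simp only [Direction.sign]; omega)
    · exact fin .mountain (free _) (by simp only [Direction.sign]; omega)
        (by simp only [Direction.sign]; omega)

theorem forall₂_alt {p q : ℚ} {cs : List Letter} {L : Word} :
    Agrees L (alt p q cs) ↔ ∃ R, L = alt p q R ∧ List.Forall₂ Allowed R cs := by
  unfold Agrees
  induction cs generalizing p q L with
  | nil =>
    constructor
    · intro h
      refine ⟨[], ?_, .nil⟩
      simpa [alt] using h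
    · rintro ⟨R, rfl, h⟩
      cases h
      exact .nil
  | cons c cs ih =>
    constructor
    · intro h
      cases h with
      | @cons v _ L _ h1 h2 =>
        obtain ⟨R, rfl, hR⟩ := ih.1 h2
        obtain ⟨v1, v2⟩ := v
        obtain ⟨rfl, h1⟩ := h1
        exact ⟨v2 :: R, rfl, .cons h1 hR⟩
    · rintro ⟨R, rfl, h⟩
      cases h with
      | cons h1 h2 => exact .cons ⟨rfl, h1⟩ (ih.2 ⟨_, rfl, h2⟩)

/-- Some choice of directions makes the labelled word flat. -/
def MixedFlat (M : List (ℚ × Letter)) : Prop := ∃ L, Agrees L M ∧ Flat L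

/-- Some choice of directions makes the labelled word reducible. -/
def MixedReducible (M : List (ℚ × Letter)) : Prop := ∃ L, Agrees L M ∧ Reducible L

theorem agrees_append {L : Word} {M M' : List (ℚ × Letter)} :
    Agrees L (M ++ M') ↔ ∃ L₁ L₂, L = L₁ ++ L₂ ∧ Agrees L₁ M ∧ Agrees L₂ M' := by
  constructor
  · intro h
    refine ⟨L.take M.length, L.drop M.length, (List.take_append_drop _ _).symm, ?_, ?_⟩
    · exact List.forall₂_take_append _ _ _ h
    · exact List.forall₂_drop_append _ _ _ h
  · rintro ⟨L₁, L₂, rfl, h1, h2⟩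
    exact List.rel_append h1 h2

theorem agrees_cons {L : Word} {v : ℚ × Letter} {M : List (ℚ × Letter)} :
    Agrees L (v :: M) ↔ ∃ d L', L = (v.1, d) :: L' ∧ Allowed d v.2 ∧ Agrees L' M := by
  constructor
  · intro h
    cases h with
    | @cons w _ L _ h1 h2 =>
      obtain ⟨w1, w2⟩ := w
      obtain ⟨rfl, h1⟩ := h1
      exact ⟨w2, L, rfl, h1, h2⟩
  · rintro ⟨d, L', rfl, h1, h2⟩
    exact .cons ⟨rfl, h1⟩ h2

/-- The label that remains of an odd run whose signs may sum up to anything from `lo` to `hi`. -/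
def runLetter (lo hi : ℤ) : Letter :=
  if lo = 1 then .assigned .mountain else if hi = -1 then .assigned .valley else .unassigned

/-- Forwards, crimps leave creases of a single direction with the same excess, and at most one of
them by `Flat.run_le_one`. Backwards, directions with the required excess are chosen, and crimps
lead from them to the shorter word. By parity, `lo ≤ 1` and `-1 ≤ hi` suffice for the excess 0 to be
possible in an even run, and for 1 or -1 in an odd one; `runLetter` allows exactly the possible
signs. -/
theorem mixed_run {pre post : List (ℚ × Letter)} {a y : ℚ × Letter} {p q : ℚ} {cs : List Letter}
    (ha : q < a.1) (h1 : Even cs.length → p < y.1) (h2 : ¬ Even cs.length → q < y.1) :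
    let M := pre ++ a :: (alt p q cs ++ y :: post)
    let lo := (cs.map loSign).sum
    let hi := (cs.map hiSign).sum
    let M' := pre ++ a :: (if Even cs.length then y :: post else (p, runLetter lo hi) :: y :: post)
    (MixedFlat M → lo ≤ 1 ∧ -1 ≤ hi ∧ MixedFlat M') ∧
      (lo ≤ 1 → -1 ≤ hi → MixedReducible M' → MixedReducible M) := by
  intro M lo hi M'
  have hlop : lo % 2 = cs.length % 2 := sum_loSign_emod cs
  have hhip : hi % 2 = cs.length % 2 := sum_hiSign_emod cs
  have hlohi : lo ≤ hi := sum_loSign_le cs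
  constructor
  · rintro ⟨L, hL, hF⟩
    obtain ⟨Lp, L1, rfl, hLp, hL1⟩ := agrees_append.1 hL
    obtain ⟨da, L2, rfl, hda, hL2⟩ := agrees_cons.1 hL1
    obtain ⟨L3, L4, rfl, hL3, hL4⟩ := agrees_append.1 hL2
    obtain ⟨R, rfl, hR⟩ := forall₂_alt.1 hL3
    obtain ⟨dy, L5, rfl, hdy, hL5⟩ := agrees_cons.1 hL4
    have hlen : R.length = cs.length := hR.length_eq
    obtain ⟨j, d, hs, hc⟩ := exists_crimps R (y.1, dy) L5 Lp (a.1, da) p q ha.le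
      (fun h => (h1 (hlen ▸ h)).le) (fun h => (h2 (hlen ▸ h)).le)
    have hF' := hF.crimps hc
    have hpar : (j : ℤ) % 2 = cs.length % 2 := by
      have e1 := signSum_emod R
      have e2 := signSum_emod (List.replicate j d)
      rw [List.length_replicate] at e2
      rw [hs] at e1
      omega
    have hev : Even j ↔ Even cs.length := by rw [Nat.even_iff, Nat.even_iff]; omega
    have hj := hF'.run_le_one ha (fun h => h1 (hev.1 h)) (fun h => h2 (fun h' => h (hev.2 h')))
    obtain ⟨b1, b2⟩ := signSum_bounds hR
    rw [hs, signSum_replicate] at b1 b2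
    have hds : d.sign = 1 ∨ d.sign = -1 := by cases d <;> simp [Direction.sign]
    have hjs : (j : ℤ) * d.sign ≤ 1 ∧ -1 ≤ (j : ℤ) * d.sign := by
      interval_cases j <;> rcases hds with e | e <;> simp [e]
    refine ⟨b1.trans hjs.1, hjs.2.trans b2, ?_⟩
    by_cases e : Even cs.length
    · have hj0 : j = 0 := by
        have := hev.2 e
        interval_cases j
        · rfl
        · simp at this
      subst hj0
      refine ⟨_, ?_, hF'⟩
      simp only [M', if_pos e, List.replicate_zero, alt, List.nil_append]
      exact agrees_append.2 ⟨_, _, rfl, hLp, agrees_cons.2 ⟨_, _, rfl, hda, hL4⟩⟩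
    · have hj1 : j = 1 := by
        have : ¬ Even j := fun h => e (hev.1 h)
        interval_cases j
        · simp at this
        · rfl
      subst hj1
      refine ⟨_, ?_, hF'⟩
      simp only [M', if_neg e, List.replicate_one, alt, List.singleton_append]
      refine agrees_append.2 ⟨_, _, rfl, hLp, agrees_cons.2 ⟨_, _, rfl, hda, ?_⟩⟩
      refine agrees_cons.2 ⟨_, _, rfl, ?_, hL4⟩
      intro d' hd'
      simp only [runLetter] at hd'
      change lo ≤ _ at b1
      change _ ≤ hi at b2
      split_ifs at hd' with k1 k2
      · simp only [Letter.assigned.injEq] at hd'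
        subst hd'
        cases d
        · rfl
        · simp [Direction.sign] at b1; omega
      · simp only [Letter.assigned.injEq] at hd'
        subst hd'
        cases d
        · simp [Direction.sign] at b2; omega
        · rfl
  · rintro hlo hhi ⟨L, hL, hRed⟩
    obtain ⟨Lp, L1, rfl, hLp, hL1⟩ := agrees_append.1 hL
    obtain ⟨da, L2, rfl, hda, hL2⟩ := agrees_cons.1 hL1
    -- Every possible excess `s` is realised by some choice of directions, and crimping it leaves
    -- creases of one direction whose excess is still `s`.
    have fin : ∀ (s : ℤ) (Ly : Word), lo ≤ s → s ≤ hi → s % 2 = cs.length % 2 →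
        Agrees Ly (y :: post) → (∀ j d, signSum (List.replicate j d) = s →
          Reducible (Lp ++ (a.1, da) :: (alt p q (List.replicate j d) ++ Ly))) →
        MixedReducible M := by
      intro s Ly k1 k2 k3 k4 k5
      obtain ⟨R, hR, hs⟩ := exists_signSum cs s k1 k2 k3
      have hlen : R.length = cs.length := hR.length_eq
      obtain ⟨dy, L5, rfl, hdy, hL5⟩ := agrees_cons.1 k4
      obtain ⟨j, d, hs', hc⟩ := exists_crimps R (y.1, dy) L5 Lp (a.1, da) p q ha.le
        (fun h => (h1 (hlen ▸ h)).le) (fun h => (h2 (hlen ▸ h)).le)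
      refine ⟨_, ?_, (k5 j d (hs' ▸ hs)).crimps hc⟩
      exact agrees_append.2 ⟨_, _, rfl, hLp, agrees_cons.2 ⟨_, _, rfl, hda,
        agrees_append.2 ⟨_, _, rfl, forall₂_alt.2 ⟨R, rfl, hR⟩, k4⟩⟩⟩
    have hds : ∀ d : Direction, d.sign = 1 ∨ d.sign = -1 := by
      intro d; cases d <;> simp [Direction.sign]
    by_cases e : Even cs.length
    · rw [Nat.even_iff] at e
      rw [if_pos (Nat.even_iff.2 e)] at hL2
      refine fin 0 L2 (by omega) (by omega) (by omega) hL2 ?_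
      intro j d hj
      have : j = 0 := by
        rw [signSum_replicate] at hj
        rcases hds d with e | e <;> rw [e] at hj <;> omega
      subst this
      simpa [alt] using hRed
    · rw [if_neg e] at hL2
      rw [Nat.even_iff] at e
      obtain ⟨d0, L3, rfl, hd0, hL3⟩ := agrees_cons.1 hL2
      have hd1 : lo ≤ d0.sign ∧ d0.sign ≤ hi := by
        have := fun h => hd0 .mountain h
        have := fun h => hd0 .valley h
        simp only [runLetter] at *
        cases d0 <;> simp only [Direction.sign] <;> split_ifs at * <;> simp_all <;> omega
      refine fin d0.sign L3 hd1.1 hd1.2 (by have := hds d0; omega) hL3 ?_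
      intro j d hj
      have : j = 1 ∧ d = d0 := by
        rw [signSum_replicate] at hj
        cases d <;> cases d0 <;> simp only [Direction.sign] at hj <;>
          first | exact ⟨by omega, rfl⟩ | omega
      obtain ⟨rfl, rfl⟩ := this
      simpa [alt] using hRed

end SimpleFolding

namespace SimpleFolding

/-! ### A stack algorithm for flat foldability -/

theorem exists_allowed (l : Letter) : ∃ d, Allowed d l := by
  by_cases h : ∃ d, l = .assigned d
  · obtain ⟨d, rfl⟩ := h
    exact ⟨d, fun d' h => by simpa using h⟩
  · exact ⟨.mountain, fun d' h' => (h ⟨d', h'⟩).elim⟩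

theorem mixedReducible_pair (a b : ℚ × Letter) : MixedReducible [a, b] := by
  obtain ⟨d, hd⟩ := exists_allowed a.2
  obtain ⟨e, he⟩ := exists_allowed b.2
  exact ⟨[(a.1, d), (b.1, e)], .cons ⟨rfl, hd⟩ (.cons ⟨rfl, he⟩ .nil), .pair _ _⟩

theorem MixedFlat.tail {a : ℚ × Letter} {M : List (ℚ × Letter)} (h : MixedFlat (a :: M)) :
    MixedFlat M := by
  obtain ⟨L, hL, hF⟩ := h
  obtain ⟨d, L, rfl, -, h2⟩ := agrees_cons.1 hL
  exact ⟨L, h2, hF.tail⟩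

theorem MixedReducible.left {a b c : ℚ × Letter} {M : List (ℚ × Letter)} (hac : a.1 ≤ c.1)
    (h : MixedReducible (b :: c :: M)) : MixedReducible (a :: b :: c :: M) := by
  obtain ⟨L, hL, hR⟩ := h
  obtain ⟨d, hd⟩ := exists_allowed a.2
  obtain ⟨e, L, rfl, he, hL'⟩ := agrees_cons.1 hL
  obtain ⟨f, L, rfl, hf, -⟩ := agrees_cons.1 hL'
  exact ⟨_, agrees_cons.2 ⟨d, _, rfl, hd, hL⟩, .left hac hR⟩

theorem MixedReducible.right {a b c : ℚ × Letter} {M : List (ℚ × Letter)} (hca : c.1 ≤ a.1)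
    (h : MixedReducible (M ++ [a, b])) : MixedReducible (M ++ [a, b, c]) := by
  obtain ⟨L, hL, hR⟩ := h
  obtain ⟨f, hf⟩ := exists_allowed c.2
  obtain ⟨L₁, L₂, rfl, h1, h2⟩ := agrees_append.1 hL
  obtain ⟨d, L', rfl, hd, h2⟩ := agrees_cons.1 h2
  obtain ⟨e, L', rfl, he, h2⟩ := agrees_cons.1 h2
  cases h2
  refine ⟨L₁ ++ [(a.1, d), (b.1, e), (c.1, f)], agrees_append.2 ⟨_, _, rfl, h1, ?_⟩, .right hca hR⟩
  exact .cons ⟨rfl, hd⟩ (.cons ⟨rfl, he⟩ (.cons ⟨rfl, hf⟩ .nil))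

/-- The bounds for the sum of the signs and the parity, with one more crease. -/
def count (l : Letter) (s : ℤ × ℤ × Bool) : ℤ × ℤ × Bool :=
  (s.1 + loSign l, s.2.1 + hiSign l, !s.2.2)

theorem foldl_count (cs : List Letter) (s : ℤ × ℤ × Bool) :
    cs.foldl (fun s l => count l s) s =
      (s.1 + (cs.map loSign).sum, s.2.1 + (cs.map hiSign).sum, s.2.2 ^^ !decide (Even cs.length)) := by
  induction cs generalizing s with
  | nil => simp
  | cons c cs ih =>
    rw [List.foldl_cons, ih]
    simp only [count, List.map_cons, List.sum_cons, List.length_cons, Nat.even_add_one, decide_not,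
      add_assoc]
    cases s.2.2 <;> cases decide (Even cs.length) <;> rfl

section Algorithm

variable {α : Type*} [LinearOrder α]

/-- Pop the creases of a run of equal segments, up to the first one without the flag. -/
def popRun : List (α × Letter × Bool) → ℤ × ℤ × Bool → (ℤ × ℤ × Bool) × List (α × Letter × Bool)
  | [], s => (s, [])
  | (_, c, true) :: T, s => popRun T (count c s)
  | (_, c, false) :: T, s => (count c s, T)

theorem length_popRun_le (T : List (α × Letter × Bool)) (s : ℤ × ℤ × Bool) :
    (popRun T s).2.length ≤ T.length - 1 := by
  fun_induction popRun T s <;> (simp_all; try omega)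

/-- Move the current vertex `v` to the stack, after all the reductions that the next vertex `y`
makes possible. -/
def insertVertex (T : List (α × Letter × Bool)) (v : α) (c : Letter) (y : α) :
    Option (List (α × Letter × Bool)) :=
  match T with
  | [] => some [(v, c, false)]
  -- Here `w` is the end of the remaining paper, and the end segment is folded over if it is no
  -- longer than the next one. In case of equality too, so equality with the end segment is never
  -- flagged.
  | [(w, cw, fw)] => if w ≤ y then some [(v, c, false)] else some [(v, c, false), (w, cw, fw)]
  | (w, cw, fw) :: t :: T =>
    if y < w then some ((v, c, false) :: (w, cw, fw) :: t :: T)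
    else if y = w then some ((v, c, true) :: (w, cw, fw) :: t :: T)
    else
      -- The segments equal to the one from `w` to `v` now form a run between longer ones. The
      -- crease at `v` is counted as well. If the number of creases is odd, one crease at `v`
      -- remains; if it is even, the whole run disappears and the entry below becomes the current
      -- vertex.
      let r := popRun ((w, cw, fw) :: t :: T) (count c (0, 0, false))
      have hr : r.2.length ≤ T.length + 1 := length_popRun_le _ _
      if 1 < r.1.1 ∨ r.1.2.1 < -1 then none
      else if r.1.2.2 then insertVertex r.2 v (runLetter r.1.1 r.1.2.1) y
      else
        match h : r.2 with
        -- Never reached from a stack that satisfies `Decreasing`: an entry remains below every run.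
        | [] => none
        | (v', c', _) :: T' =>
          have : T'.length + 1 ≤ T.length + 1 := by rw [h] at hr; exact hr
          insertVertex T' v' c' y
  termination_by T.length
  decreasing_by all_goals simp_wf; omega

/-- The recursion without its dependent `match`, so that the result of `popRun` may be rewritten. -/
theorem insertVertex_of_lt {w v y : α} {cw c : Letter} {fw : Bool} {t : α × Letter × Bool}
    {T : List (α × Letter × Bool)} (hwy : w < y) {r : (ℤ × ℤ × Bool) × List (α × Letter × Bool)}
    (hr : popRun ((w, cw, fw) :: t :: T) (count c (0, 0, false)) = r) :
    insertVertex ((w, cw, fw) :: t :: T) v c y =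
      if 1 < r.1.1 ∨ r.1.2.1 < -1 then none
      else if r.1.2.2 then insertVertex r.2 v (runLetter r.1.1 r.1.2.1) y
      else r.2.casesOn none (fun e T' => insertVertex T' e.1 e.2.1 y) := by
  subst hr
  rw [insertVertex, if_neg (not_lt.2 hwy.le), if_neg hwy.ne']
  dsimp only
  congr 2
  split
  · next h => rw [h]
  · next h => rw [h]

/-- Read the vertices one by one. -/
def scan (T : List (α × Letter × Bool)) (v : α) (c : Letter) : List (α × Letter) → Bool
  | [] => true
  | (y, cy) :: ys =>
    match insertVertex T v c y with
    | none => false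
    | some T' => scan T' y cy ys

/-- The segments get shorter towards the current vertex `v`, weakly, and the flags tell where two
consecutive segments have the same length. -/
def Decreasing (v : α) : List (α × Letter × Bool) → Prop
  | [] => True
  | [(_, _, f)] => f = false
  | (w, _, f) :: (w', c', f') :: T =>
    (if f then v = w' ∧ T ≠ [] else v < w') ∧ Decreasing w ((w', c', f') :: T)

theorem Decreasing.tail {v w : α} {c : Letter} {f : Bool} {T : List (α × Letter × Bool)}
    (h : Decreasing v ((w, c, f) :: T)) : Decreasing w T := by
  cases T with
  | nil => trivial
  | cons t T => exact h.2

/-- The vertex with its coordinate read as a rational number. -/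
def labelled (key : α → ℚ) (e : α × Letter × Bool) : ℚ × Letter := (key e.1, e.2.1)

variable {key : α → ℚ}

/-- `Decreasing` forbids flags on the two lowest entries, so some entry `a` always remains. Along
the run the values alternate between `w` and `v`; hence the parity of the number of popped creases
decides with which of the two the remaining entry is compared. -/
theorem popRun_spec (T : List (α × Letter × Bool)) : ∀ (t : α × Letter × Bool) (w : α) (cw : Letter)
    (f : Bool) (v : α) (s : ℤ × ℤ × Bool), Decreasing v ((w, cw, f) :: t :: T) →
    ∃ cs a T', popRun ((w, cw, f) :: t :: T) s = (cs.foldl (fun s l => count l s) s, a :: T') ∧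
      ((w, cw, f) :: t :: T).map (labelled key) =
        alt (key w) (key v) cs ++ (a :: T').map (labelled key) ∧
      (Even cs.length → w < a.1 ∧ Decreasing v (a :: T')) ∧
      (¬ Even cs.length → v < a.1 ∧ Decreasing w (a :: T')) := by
  induction T with
  | nil =>
    rintro ⟨w', c', f'⟩ w cw f v s h
    cases f with
    | true => simp [Decreasing] at h
    | false =>
      simp only [Decreasing] at h
      exact ⟨[cw], (w', c', f'), [], rfl, rfl, by simp, fun _ => ⟨by simpa using h.1, h.2⟩⟩
  | cons t' T ih =>
    rintro ⟨w', c', f'⟩ w cw f v s h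
    cases f with
    | true =>
      simp only [Decreasing] at h
      obtain ⟨⟨rfl, -⟩, h2⟩ := h
      obtain ⟨cs, a, T', e1, e2, h3, h4⟩ := ih t' v c' f' w (count cw s) h2
      refine ⟨cw :: cs, a, T', e1, ?_, ?_, ?_⟩
      · rw [List.map_cons, e2]; rfl
      · rw [List.length_cons, Nat.even_add_one]; exact h4
      · rw [List.length_cons, Nat.even_add_one, not_not]; exact h3
    | false =>
      have h' := h
      simp only [Decreasing] at h
      exact ⟨[cw], (w', c', f'), t' :: T, rfl, rfl, by simp, fun _ => ⟨by simpa using h.1, h'.2⟩⟩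

/-- The word that consists of the vertices on the stack and `M`. -/
def wordOf (key : α → ℚ) (T : List (α × Letter × Bool)) (M : List (ℚ × Letter)) :
    List (ℚ × Letter) :=
  (T.map (labelled key)).reverse ++ M

/-- Flatness passes from the word before the insertion to the word after it, reducibility passes
back. The first ensures that no flat word is rejected, the second that an accepted word is
reducible. Every recursive call is one application of `mixed_run`. Its strict inequalities hold
because the run is maximal: the segment below it is longer by `popRun_spec`, and the segment to `y`
is longer because `w < y`. -/
theorem insertVertex_spec (hkey : StrictMono key) (M : List (ℚ × Letter)) (y : α) (cy : Letter) :
    ∀ (n : ℕ) (T : List (α × Letter × Bool)) (v : α) (c : Letter), T.length ≤ n → Decreasing v T →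
    (insertVertex T v c y = none → ¬ MixedFlat (wordOf key T ((key v, c) :: (key y, cy) :: M))) ∧
      ∀ T', insertVertex T v c y = some T' → Decreasing y T' ∧ T' ≠ [] ∧
        (MixedFlat (wordOf key T ((key v, c) :: (key y, cy) :: M)) →
          MixedFlat (wordOf key T' ((key y, cy) :: M))) ∧
        (MixedReducible (wordOf key T' ((key y, cy) :: M)) →
          MixedReducible (wordOf key T ((key v, c) :: (key y, cy) :: M))) := by
  intro n
  induction n with
  | zero =>
    intro T v c hn hT
    obtain rfl : T = [] := List.length_eq_zero_iff.1 (by omega)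
    unfold insertVertex
    refine ⟨by simp, ?_⟩
    intro T' h
    cases h
    exact ⟨rfl, by simp, id, id⟩
  | succ n ih =>
  intro T v c hn hT
  match T, hT, hn with
  | [], _, _ =>
    unfold insertVertex
    refine ⟨by simp, ?_⟩
    intro T' h
    cases h
    exact ⟨rfl, by simp, id, id⟩
  | [(w, cw, fw)], hT, _ =>
    unfold insertVertex
    simp only [Decreasing] at hT
    subst hT
    split_ifs with hwy
    · refine ⟨by simp, ?_⟩
      intro T' h
      cases h
      exact ⟨rfl, by simp, fun h => h.tail, fun h => h.left (hkey.le_iff_le.2 hwy)⟩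
    · refine ⟨by simp, ?_⟩
      intro T' h
      cases h
      exact ⟨⟨by simpa using hwy, rfl⟩, by simp, id, id⟩
  | (w, cw, fw) :: t :: T, hT, hn =>
    have push : ∀ f, (if f then y = w ∧ t :: T ≠ [] else y < w) →
        ∀ T', some ((v, c, f) :: (w, cw, fw) :: t :: T) = some T' → Decreasing y T' ∧ T' ≠ [] ∧
        (MixedFlat (wordOf key ((w, cw, fw) :: t :: T) ((key v, c) :: (key y, cy) :: M)) →
          MixedFlat (wordOf key T' ((key y, cy) :: M))) ∧
        (MixedReducible (wordOf key T' ((key y, cy) :: M)) →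
          MixedReducible (wordOf key ((w, cw, fw) :: t :: T)
            ((key v, c) :: (key y, cy) :: M))) := by
      intro f hf T' h
      cases h
      have : wordOf key ((v, c, f) :: (w, cw, fw) :: t :: T) ((key y, cy) :: M) =
          wordOf key ((w, cw, fw) :: t :: T) ((key v, c) :: (key y, cy) :: M) := by
        simp [wordOf, labelled]
      rw [this]
      exact ⟨⟨hf, hT⟩, by simp, id, id⟩
    by_cases h1 : y < w
    · rw [insertVertex, if_pos h1]
      exact ⟨by simp, push false h1⟩
    by_cases h2 : y = w
    · rw [insertVertex, if_neg h1, if_pos h2]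
      exact ⟨by simp, push true ⟨h2, by simp⟩⟩
    · have hwy : w < y := lt_of_le_of_ne (not_lt.1 h1) (Ne.symm h2)
      obtain ⟨cs, ⟨a, ca, fa⟩, T', e1, e2, h3, h4⟩ :=
        popRun_spec (key := key) T t w cw fw v (count c (0, 0, false)) hT
      have hlen : T'.length ≤ T.length := by
        have := length_popRun_le ((w, cw, fw) :: t :: T) (count c (0, 0, false))
        rw [e1] at this
        simpa using this
      have e3 : (popRun ((w, cw, fw) :: t :: T) (count c (0, 0, false))).1 =
          (((c :: cs).reverse.map loSign).sum, ((c :: cs).reverse.map hiSign).sum,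
            decide (Even cs.length)) := by
        rw [e1]
        change List.foldl (fun s l => count l s) (0, 0, false) (c :: cs) = _
        rw [foldl_count]
        refine Prod.ext ?_ (Prod.ext ?_ ?_)
        · simp [List.map_reverse, List.sum_reverse, add_comm]
        · simp [List.map_reverse, List.sum_reverse, add_comm]
        · simp [Nat.even_add_one, -Nat.not_even_iff_odd]
      generalize hr : popRun ((w, cw, fw) :: t :: T) (count c (0, 0, false)) = r at *
      rw [insertVertex_of_lt hwy hr]
      obtain ⟨⟨lo, hi, par⟩, T₂⟩ := r
      simp only [Prod.mk.injEq] at e1 e3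
      obtain ⟨-, rfl⟩ := e1
      obtain ⟨rfl, rfl, rfl⟩ := e3
      have key1 : wordOf key ((w, cw, fw) :: t :: T) ((key v, c) :: (key y, cy) :: M) =
          (T'.map (labelled key)).reverse ++ (key a, ca) ::
            ((alt (key v) (key w) (c :: cs)).reverse ++ (key y, cy) :: M) := by
        simp only [wordOf, e2, alt]
        simp [labelled]
      rw [key1]
      have par : Even (c :: cs).length ↔ ¬ Even cs.length := by
        rw [List.length_cons, Nat.even_add_one]
      have par' : Even (c :: cs).reverse.length ↔ ¬ Even cs.length := by
        rw [List.length_reverse, par]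
      simp only [decide_eq_true_eq]
      by_cases he : Even cs.length
      · rw [show (alt (key v) (key w) (c :: cs)).reverse = alt (key v) (key w) (c :: cs).reverse by
          rw [reverse_alt, if_neg (by rw [par]; exact not_not.2 he)]]
        obtain ⟨k1, k2⟩ := h3 he
        have run := mixed_run (pre := (T'.map (labelled key)).reverse) (post := M)
          (a := (key a, ca)) (y := (key y, cy)) (p := key v) (q := key w) (cs := (c :: cs).reverse)
          (hkey k1) (fun h => absurd he (par'.1 h)) (fun _ => hkey hwy)
        simp only [if_neg (fun h => absurd he (par'.1 h))] at run
        simp only [if_pos he]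
        split_ifs with hf
        · refine ⟨fun _ h => ?_, by simp⟩
          have := run.1 h
          omega
        · push Not at hf
          obtain ⟨i1, i2⟩ := ih ((a, ca, fa) :: T') v (runLetter ((c :: cs).reverse.map loSign).sum
            ((c :: cs).reverse.map hiSign).sum) (by simp at hn ⊢; omega) k2
          have e4 : ∀ l, wordOf key ((a, ca, fa) :: T') ((key v, l) :: (key y, cy) :: M) =
              (T'.map (labelled key)).reverse ++ (key a, ca) :: (key v, l) :: (key y, cy) :: M := by
            intro l
            simp [wordOf, labelled]
          rw [e4] at i1 i2
          refine ⟨fun h h' => i1 h (run.1 h').2.2, fun T'' h => ?_⟩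
          obtain ⟨j1, j2, j3, j4⟩ := i2 T'' h
          exact ⟨j1, j2, fun h => j3 (run.1 h).2.2, fun h => run.2 hf.1 hf.2 (j4 h)⟩
      · rw [show (alt (key v) (key w) (c :: cs)).reverse = alt (key w) (key v) (c :: cs).reverse by
          rw [reverse_alt, if_pos (by rw [par]; exact he)]]
        obtain ⟨k1, k2⟩ := h4 he
        have run := mixed_run (pre := (T'.map (labelled key)).reverse) (post := M)
          (a := (key a, ca)) (y := (key y, cy)) (p := key w) (q := key v) (cs := (c :: cs).reverse)
          (hkey k1) (fun _ => hkey hwy) (fun h => absurd (par'.2 he) h)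
        simp only [if_pos (par'.2 he)] at run
        simp only [if_neg he]
        split_ifs with hf
        · refine ⟨fun _ h => ?_, by simp⟩
          have := run.1 h
          omega
        · push Not at hf
          obtain ⟨i1, i2⟩ := ih T' a ca (by simp at hn ⊢; omega) k2.tail
          refine ⟨fun h h' => i1 h (run.1 h').2.2, fun T'' h => ?_⟩
          obtain ⟨j1, j2, j3, j4⟩ := i2 T'' h
          exact ⟨j1, j2, fun h => j3 (run.1 h).2.2, fun h => run.2 hf.1 hf.2 (j4 h)⟩

/-- When the segments become weakly shorter towards the right, the last one can be folded over its
predecessor, again and again. -/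
theorem Decreasing.mixedReducible (hkey : StrictMono key) {v : α} {c : Letter} :
    ∀ {T : List (α × Letter × Bool)}, Decreasing v T → T ≠ [] →
      MixedReducible (wordOf key T [(key v, c)]) := by
  intro T
  induction T generalizing v c with
  | nil => simp
  | cons e T ih =>
    intro h _
    obtain ⟨w, cw, f⟩ := e
    cases T with
    | nil => exact mixedReducible_pair _ _
    | cons e' T =>
      obtain ⟨w', c', f'⟩ := e'
      have hv : v ≤ w' := by
        have := h.1
        split_ifs at this with hf
        · exact this.1.le
        · exact this.le
      have := ih (v := w) (c := cw) h.2 (by simp)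
      simp only [wordOf, List.map_cons, List.reverse_cons, List.append_assoc, List.cons_append,
        List.nil_append, labelled] at this ⊢
      exact this.right (hkey.le_iff_le.2 hv)

/-- The algorithm is correct. -/
theorem scan_spec (hkey : StrictMono key) (ys : List (α × Letter)) :
    ∀ (T : List (α × Letter × Bool)) (v : α) (c : Letter), Decreasing v T → (T ≠ [] ∨ ys ≠ []) →
    let M := wordOf key T ((key v, c) :: ys.map fun e => (key e.1, e.2))
    (MixedFlat M → scan T v c ys = true) ∧ (scan T v c ys = true → MixedReducible M) := by
  induction ys with
  | nil =>
    intro T v c hT hne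
    exact ⟨fun _ => rfl, fun _ => hT.mixedReducible hkey (by simpa using hne)⟩
  | cons y ys ih =>
    obtain ⟨y, cy⟩ := y
    intro T v c hT hne
    obtain ⟨h1, h2⟩ := insertVertex_spec hkey (ys.map fun e => (key e.1, e.2)) y cy _ T v c le_rfl hT
    simp only [scan, List.map_cons]
    cases h : insertVertex T v c y with
    | none => exact ⟨fun hF => absurd hF (h1 h), by simp⟩
    | some T' =>
      obtain ⟨j1, j2, j3, j4⟩ := h2 T' h
      obtain ⟨i1, i2⟩ := ih T' y cy j1 (Or.inl j2)
      exact ⟨fun hF => i1 (j3 hF), fun hs => j4 (i2 hs)⟩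

end Algorithm

end SimpleFolding

namespace SimpleFolding

/-! ### Simple folds do not make the paper cross itself -/

namespace FoldedState

variable {n : ℕ}

/-- A segment together with the side of a point (`true` for the right one) from which the segment is
looked at. -/
abbrev Half (n : ℕ) := Fin (n + 1) × Bool

/-- The segment touches the point `x` from the given side. -/
def Touch (A : FoldedState n) (x : ℚ) (p : Half n) : Prop :=
  if p.2 then A.lo p.1 ≤ x ∧ x < A.hi p.1 else A.lo p.1 < x ∧ x ≤ A.hi p.1

/-- The order in which one meets the layers when going around a point, starting below it, by its left
side and back by its right side. -/
def Below (A : FoldedState n) (p q : Half n) : Prop :=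
  match p.2, q.2 with
  | false, false => A.height p.1 < A.height q.1
  | true, true => A.height q.1 < A.height p.1
  | false, true => True
  | true, false => False

/-- The two halves are connected at the point `x`. -/
def Joined (A : FoldedState n) (x : ℚ) (p q : Half n) : Prop :=
  (p.1 = q.1 ∧ p.2 ≠ q.2) ∨ ∃ j : Fin n, A.creasePos j = x ∧
    ((p.1 = j.castSucc ∧ q.1 = j.succ) ∨ (q.1 = j.castSucc ∧ p.1 = j.succ))

/-- The paper does not cross itself. -/
structure NonCrossing (A : FoldedState n) : Prop where
  nondegenerate : ∀ s : Fin (n + 1), A.pos s.castSucc ≠ A.pos s.succ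
  height_ne : ∀ s t, A.Overlap s t → s ≠ t → A.height s ≠ A.height t
  chords : ∀ x p q r t, A.Touch x p → A.Touch x q → A.Touch x r → A.Touch x t →
    A.Joined x p q → A.Joined x r t → p ≠ r → p ≠ t → q ≠ r → q ≠ t →
    ((A.Below p r ↔ A.Below q r) ↔ (A.Below p t ↔ A.Below q t))

theorem Touch.overlap {A : FoldedState n} {x : ℚ} {a b : Fin (n + 1)} {s : Bool}
    (ha : A.Touch x (a, s)) (hb : A.Touch x (b, s)) : A.Overlap a b := by
  cases s <;> simp only [Touch, Bool.false_eq_true, if_true, if_false] at ha hb <;>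
    exact ⟨by linarith, by linarith⟩

theorem NonCrossing.height_ne_of_touch {A : FoldedState n} (hA : A.NonCrossing) {x : ℚ} {p q : Half n}
    (hp : A.Touch x p) (hq : A.Touch x q) (hpq : p ≠ q) (hs : p.2 = q.2) :
    A.height p.1 ≠ A.height q.1 := by
  obtain ⟨a, s⟩ := p
  obtain ⟨b, t⟩ := q
  obtain rfl : s = t := hs
  exact hA.height_ne _ _ (hp.overlap hq) (by rintro rfl; exact hpq rfl)

/-- The state upside down, without a reflection in the horizontal direction. -/
def upsideDown (A : FoldedState n) : FoldedState n := ⟨A.pos, fun s => - A.height s⟩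

/-- Moving a block from the beginning to the end of a linear order does not change which chords cross. -/
theorem chords_iff_of_shift {P₁ P₂ P₃ P₄ Q₁ Q₂ Q₃ Q₄ p q r t : Prop} (h₁ : Q₁ ↔ (P₁ ↔ (p ↔ r)))
    (h₂ : Q₂ ↔ (P₂ ↔ (q ↔ r))) (h₃ : Q₃ ↔ (P₃ ↔ (p ↔ t))) (h₄ : Q₄ ↔ (P₄ ↔ (q ↔ t))) :
    ((Q₁ ↔ Q₂) ↔ (Q₃ ↔ Q₄)) ↔ ((P₁ ↔ P₂) ↔ (P₃ ↔ P₄)) := by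
  grind

theorem chords_iff_of_reverse {P₁ P₂ P₃ P₄ Q₁ Q₂ Q₃ Q₄ p q r t : Prop} (h₁ : Q₁ ↔ ¬ (P₁ ↔ (p ↔ r)))
    (h₂ : Q₂ ↔ ¬ (P₂ ↔ (q ↔ r))) (h₃ : Q₃ ↔ ¬ (P₃ ↔ (p ↔ t))) (h₄ : Q₄ ↔ ¬ (P₄ ↔ (q ↔ t))) :
    ((Q₁ ↔ Q₂) ↔ (Q₃ ↔ Q₄)) ↔ ((P₁ ↔ P₂) ↔ (P₃ ↔ P₄)) := by
  rw [h₁, h₂, h₃, h₄, not_iff_not, not_iff_not]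
  exact chords_iff_of_shift Iff.rfl Iff.rfl Iff.rfl Iff.rfl

/-- Turning the state upside down reverses the order on each side of the point, while the left side
still precedes the right one. -/
theorem below_upsideDown {A : FoldedState n} (hA : A.NonCrossing) {x : ℚ} {p q : Half n}
    (hp : A.Touch x p) (hq : A.Touch x q) (hpq : p ≠ q) :
    A.upsideDown.Below p q ↔ ¬ (A.Below p q ↔ (p.2 = true ↔ q.2 = true)) := by
  have h := hA.height_ne_of_touch hp hq hpq
  obtain ⟨a, s⟩ := p
  obtain ⟨b, t⟩ := q
  cases s <;> cases t <;> simp only [Below, upsideDown] at h ⊢ <;> simp at h ⊢ <;> omega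

theorem NonCrossing.upsideDown {A : FoldedState n} (hA : A.NonCrossing) :
    A.upsideDown.NonCrossing where
  nondegenerate := hA.nondegenerate
  height_ne s t ho hst := by
    have := hA.height_ne s t ho hst
    simpa [FoldedState.upsideDown] using this
  chords x p q r t hp hq hr ht j1 j2 n1 n2 n3 n4 :=
    (chords_iff_of_reverse (below_upsideDown hA hp hr n1) (below_upsideDown hA hq hr n3)
      (below_upsideDown hA hp ht n2) (below_upsideDown hA hq ht n4)).2
      (hA.chords x p q r t hp hq hr ht j1 j2 n1 n2 n3 n4)

theorem HalfTurn.height {A B : FoldedState n} {x : ℚ} {c : ℤ} {S : Set (Fin (n + 1))}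
    (h : HalfTurn A B x c S) (s : Fin (n + 1)) :
    (s ∈ S → B.height s = 2 * c - A.height s) ∧ (s ∉ S → B.height s = A.height s) :=
  ⟨fun hs => (h.1 s hs).2.2, fun hs => (h.2 s hs).2.2⟩

theorem HalfTurn.lo_hi {A B : FoldedState n} {x : ℚ} {c : ℤ} {S : Set (Fin (n + 1))}
    (h : HalfTurn A B x c S) (s : Fin (n + 1)) :
    (s ∈ S → B.lo s = 2 * x - A.hi s ∧ B.hi s = 2 * x - A.lo s) ∧
      (s ∉ S → B.lo s = A.lo s ∧ B.hi s = A.hi s) := by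
  constructor
  · intro hs
    obtain ⟨h1, h2, -⟩ := h.1 s hs
    simp only [lo, hi, h1, h2]
    exact ⟨min_sub_sub_left _ _ _, max_sub_sub_left _ _ _⟩
  · intro hs
    obtain ⟨h1, h2, -⟩ := h.2 s hs
    simp only [lo, hi, h1, h2, and_self]

theorem Touch.of_halfTurn {A B : FoldedState n} {x y : ℚ} {c : ℤ} {S : Set (Fin (n + 1))}
    (h : HalfTurn A B x c S) {p : Half n} (hp : B.Touch y p) :
    (p.1 ∈ S → A.Touch (2 * x - y) (p.1, !p.2)) ∧ (p.1 ∉ S → A.Touch y p) := by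
  obtain ⟨a, s⟩ := p
  have := h.lo_hi a
  constructor
  · intro ha
    obtain ⟨e1, e2⟩ := this.1 ha
    cases s <;> simp only [Touch, e1, e2, Bool.false_eq_true, if_true, if_false, Bool.not_true,
      Bool.not_false] at hp ⊢ <;> exact ⟨by linarith, by linarith⟩
  · intro ha
    obtain ⟨e1, e2⟩ := this.2 ha
    simpa only [Touch, e1, e2] using hp

/-- A connection after a fold comes from a connection before it. -/
theorem Joined.of_halfTurn {A B : FoldedState n} {x y : ℚ} {c : ℤ} {S : Set (Fin (n + 1))}
    (hS : A.Movable x S) (h : HalfTurn A B x c S) {p q : Half n} (hpq : B.Joined y p q) :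
    (p.1 ∈ S ∧ q.1 ∈ S ∧ A.Joined (2 * x - y) (p.1, !p.2) (q.1, !q.2)) ∨
    (p.1 ∉ S ∧ q.1 ∉ S ∧ A.Joined y p q) ∨
    ((p.1 ∈ S ↔ q.1 ∉ S) ∧ y = x ∧ ∀ s t, A.Joined x (p.1, s) (q.1, t)) := by
  obtain ⟨a, s⟩ := p
  obtain ⟨b, t⟩ := q
  rcases hpq with ⟨rfl, hst⟩ | ⟨j, hj, hab⟩
  · by_cases ha : a ∈ S
    · exact Or.inl ⟨ha, ha, Or.inl ⟨rfl, by simpa using hst⟩⟩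
    · exact Or.inr (Or.inl ⟨ha, ha, Or.inl ⟨rfl, hst⟩⟩)
  · have pos1 : j.castSucc ∈ S → B.creasePos j = 2 * x - A.creasePos j := fun hs => (h.1 _ hs).2.1
    have pos2 : j.castSucc ∉ S → B.creasePos j = A.creasePos j := fun hs => (h.2 _ hs).2.1
    have mem : (a ∈ S ↔ b ∈ S) ∨ A.creasePos j = x := by
      rcases hS.2.2.2 j with hj | ⟨-, hj⟩
      · left
        rcases hab with ⟨rfl, rfl⟩ | ⟨rfl, rfl⟩
        · exact hj
        · exact hj.symm
      · exact Or.inr hj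
    have memj : j.castSucc ∈ S → (a ∈ S ∨ b ∈ S) := by
      rcases hab with ⟨rfl, rfl⟩ | ⟨rfl, rfl⟩ <;> tauto
    have memj' : j.castSucc ∉ S → (a ∉ S ∨ b ∉ S) := by
      rcases hab with ⟨rfl, rfl⟩ | ⟨rfl, rfl⟩ <;> tauto
    by_cases ha : a ∈ S <;> by_cases hb : b ∈ S
    · refine Or.inl ⟨ha, hb, Or.inr ⟨j, ?_, hab⟩⟩
      have : j.castSucc ∈ S := by
        by_contra hj
        exact (memj' hj).elim (fun h => h ha) (fun h => h hb)
      rw [← hj, pos1 this]; ring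
    · right; right
      have hx : A.creasePos j = x := mem.resolve_left (fun h => hb (h.1 ha))
      refine ⟨by tauto, ?_, fun s t => Or.inr ⟨j, hx, hab⟩⟩
      by_cases hs : j.castSucc ∈ S
      · rw [← hj, pos1 hs, hx]; ring
      · rw [← hj, pos2 hs, hx]
    · right; right
      have hx : A.creasePos j = x := mem.resolve_left (fun h => ha (h.2 hb))
      refine ⟨by tauto, ?_, fun s t => Or.inr ⟨j, hx, hab⟩⟩
      by_cases hs : j.castSucc ∈ S
      · rw [← hj, pos1 hs, hx]; ring
      · rw [← hj, pos2 hs, hx]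
    · refine Or.inr (Or.inl ⟨ha, hb, Or.inr ⟨j, ?_, hab⟩⟩)
      have : j.castSucc ∉ S := fun hj => (memj hj).elim ha hb
      rw [← hj, pos2 this]

/-- The order around a point goes up its left side and down its right side, so the top layers of the
two sides are adjacent. Swinging the top layers of one side over to the other reverses them and
leaves the order at the fold point literally unchanged. At any other point no moved layer is joined
to a stationary one. There the moved layers form one block between the stationary left and right
halves, and among themselves they are ordered as before at the mirrored point, up to a different
starting place in the circular order. -/
theorem NonCrossing.foldUp {A B : FoldedState n} (hA : A.NonCrossing) (h : FoldUp A B) :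
    B.NonCrossing := by
  obtain ⟨x, c, S, hS, htop, hc, hT⟩ := h
  have up : ∀ a ∈ S, ∀ b ∉ S, B.height b < B.height a := by
    intro a ha b hb
    rw [(hT.height a).1 ha, (hT.height b).2 hb]
    have := hc a
    have := hc b
    omega
  have hne : ∀ s t, B.Overlap s t → s ≠ t → B.height s ≠ B.height t := by
    intro s t ho hst
    by_cases hs : s ∈ S <;> by_cases ht : t ∈ S
    · have := hA.height_ne s t ?_ hst
      · rw [(hT.height s).1 hs, (hT.height t).1 ht]; omega
      · have e1 := (hT.lo_hi s).1 hs
        have e2 := (hT.lo_hi t).1 ht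
        simp only [Overlap, e1, e2] at ho ⊢
        exact ⟨by linarith, by linarith⟩
    · exact (up s hs t ht).ne'
    · exact (up t ht s hs).ne
    · have := hA.height_ne s t ?_ hst
      · rwa [(hT.height s).2 hs, (hT.height t).2 ht]
      · have e1 := (hT.lo_hi s).2 hs
        have e2 := (hT.lo_hi t).2 ht
        simpa only [Overlap, e1, e2] using ho
  refine ⟨fun s => ?_, hne, ?_⟩
  · have := hA.nondegenerate s
    by_cases hs : s ∈ S
    · obtain ⟨h1, h2, -⟩ := hT.1 s hs
      rw [h1, h2]
      simpa using this
    · obtain ⟨h1, h2, -⟩ := hT.2 s hs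
      rwa [h1, h2]
  classical
  -- the order of the halves at the point `x` does not change
  have order : ∀ p q, B.Touch x p → B.Touch x q → p ≠ q →
      (B.Below p q ↔ A.Below (p.1, if p.1 ∈ S then !p.2 else p.2)
        (q.1, if q.1 ∈ S then !q.2 else q.2)) := by
    rintro ⟨a, s⟩ ⟨b, t⟩ hp hq hpq
    have ta := hp.of_halfTurn hT
    have tb := hq.of_halfTurn hT
    have ha' := hT.height a
    have hb' := hT.height b
    have hab := hA.height_ne a b
    have tab : ∀ u, A.Touch x (a, u) → A.Touch x (b, u) → A.Overlap a b := fun u h1 h2 => h1.overlap h2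
    have side : (∀ a ∈ S, ∀ u, A.Touch x (a, u) → u = true) ∨
        (∀ a ∈ S, ∀ u, A.Touch x (a, u) → u = false) := by
      rcases hS.2.2.1 with h | h
      · left
        intro a ha u hu
        have := h a ha
        cases u
        · simp only [Touch, Bool.false_eq_true, if_false] at hu
          linarith
        · rfl
      · right
        intro a ha u hu
        have := h a ha
        cases u
        · rfl
        · simp only [Touch, if_true] at hu
          linarith
    rw [show 2 * x - x = x by ring] at ta tb
    simp only at ta tb
    by_cases ha : a ∈ S <;> by_cases hb : b ∈ S <;> simp only [ha, hb, if_true, if_false]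
    · have ta := ta.1 ha
      have tb := tb.1 hb
      have hs : s = t := by
        rcases side with h | h
        · simpa using (h a ha _ ta).trans (h b hb _ tb).symm
        · simpa using (h a ha _ ta).trans (h b hb _ tb).symm
      subst hs
      have h1 := ha'.1 ha
      have h2 := hb'.1 hb
      cases s <;> simp only [Below, Bool.not_true, Bool.not_false] <;> omega
    · replace ta := ta.1 ha
      replace tb := tb.2 hb
      have h3 := up a ha b hb
      have h4 : ∀ u, A.Touch x (a, u) → A.Touch x (b, u) → A.height b < A.height a :=
        fun u h1 h2 => htop a ha b hb (tab u h1 h2)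
      cases s <;> cases t <;> simp only [Below, Bool.not_true, Bool.not_false] at * <;>
        simp only [iff_true, true_iff, iff_false, false_iff, not_lt]
      · exact h3.le
      · exact h4 _ ta tb
      · exact (h4 _ ta tb).le
      · exact h3
    · replace ta := ta.2 ha
      replace tb := tb.1 hb
      have h3 := up b hb a ha
      have h4 : ∀ u, A.Touch x (a, u) → A.Touch x (b, u) → A.height a < A.height b :=
        fun u h1 h2 => htop b hb a ha (h2.overlap h1)
      cases s <;> cases t <;> simp only [Below, Bool.not_true, Bool.not_false] at * <;>
        simp only [iff_true, true_iff, iff_false, false_iff, not_lt]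
      · exact h3
      · exact h4 _ ta tb
      · exact (h4 _ ta tb).le
      · exact h3.le
    · have h1 := ha'.2 ha
      have h2 := hb'.2 hb
      cases s <;> cases t <;> simp only [Below] <;> omega
  have pre : ∀ p, B.Touch x p → A.Touch x (p.1, if p.1 ∈ S then !p.2 else p.2) := by
    intro p hp
    have := hp.of_halfTurn hT
    rw [show 2 * x - x = x by ring] at this
    split_ifs with h
    · exact this.1 h
    · exact this.2 h
  have pre_ne : ∀ p q : Half n, p ≠ q → ((p.1, if p.1 ∈ S then !p.2 else p.2) : Half n) ≠
      (q.1, if q.1 ∈ S then !q.2 else q.2) := by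
    rintro ⟨a, s⟩ ⟨b, t⟩ h e
    simp only [Prod.mk.injEq] at e
    obtain ⟨rfl, e⟩ := e
    apply h
    split_ifs at e <;> simp_all
  have preJ : ∀ p q, B.Joined x p q → A.Joined x (p.1, if p.1 ∈ S then !p.2 else p.2)
      (q.1, if q.1 ∈ S then !q.2 else q.2) := by
    intro p q h
    have := h.of_halfTurn hS hT
    rw [show 2 * x - x = x by ring] at this
    rcases this with ⟨h1, h2, h3⟩ | ⟨h1, h2, h3⟩ | ⟨-, -, h3⟩
    · simpa [h1, h2] using h3
    · simpa [h1, h2] using h3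
    · exact h3 _ _
  intro y p q r t hp hq hr ht j1 j2 n1 n2 n3 n4
  by_cases hy : y = x
  · subst hy
    rw [order p r hp hr n1, order q r hq hr n3, order p t hp ht n2, order q t hq ht n4]
    exact hA.chords y _ _ _ _ (pre p hp) (pre q hq) (pre r hr) (pre t ht) (preJ p q j1)
      (preJ r t j2) (pre_ne _ _ n1) (pre_ne _ _ n2) (pre_ne _ _ n3) (pre_ne _ _ n4)
  · -- moved halves lie on the outside of stationary ones
    have above : ∀ a b : Half n, a.1 ∈ S → b.1 ∉ S →
        (B.Below a b ↔ b.2 = true) ∧ (B.Below b a ↔ b.2 = false) := by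
      rintro ⟨a, s⟩ ⟨b, t⟩ ha hb
      have := up a ha b hb
      cases s <;> cases t <;> simp only [Below] <;> simp <;> omega
    have moved : ∀ a b : Half n, a.1 ∈ S → b.1 ∈ S →
        (B.Below a b ↔ (A.Below (a.1, !a.2) (b.1, !b.2) ↔ (a.2 = true ↔ b.2 = true))) := by
      rintro ⟨a, s⟩ ⟨b, t⟩ ha hb
      have h1 := (hT.height a).1 ha
      have h2 := (hT.height b).1 hb
      cases s <;> cases t <;> simp only [Below, Bool.not_true, Bool.not_false] <;> simp <;> omega
    have fixed : ∀ a b : Half n, a.1 ∉ S → b.1 ∉ S → (B.Below a b ↔ A.Below a b) := by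
      rintro ⟨a, s⟩ ⟨b, t⟩ ha hb
      have h1 := (hT.height a).2 ha
      have h2 := (hT.height b).2 hb
      cases s <;> cases t <;> simp only [Below] <;> omega
    have flip_ne : ∀ a b : Half n, a ≠ b → ((a.1, !a.2) : Half n) ≠ (b.1, !b.2) := by
      rintro ⟨a, s⟩ ⟨b, t⟩ h e
      simp only [Prod.mk.injEq] at e
      exact h (by simp [e.1, by simpa using e.2])
    rcases j1.of_halfTurn hS hT with ⟨p1, q1, k1⟩ | ⟨p1, q1, k1⟩ | ⟨-, h, -⟩
    · rcases j2.of_halfTurn hS hT with ⟨r1, t1, k2⟩ | ⟨r1, t1, k2⟩ | ⟨-, h, -⟩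
      · refine (chords_iff_of_shift (moved p r p1 r1) (moved q r q1 r1) (moved p t p1 t1)
          (moved q t q1 t1)).2 ?_
        exact hA.chords _ _ _ _ _ ((hp.of_halfTurn hT).1 p1) ((hq.of_halfTurn hT).1 q1)
          ((hr.of_halfTurn hT).1 r1) ((ht.of_halfTurn hT).1 t1) k1 k2 (flip_ne _ _ n1)
          (flip_ne _ _ n2) (flip_ne _ _ n3) (flip_ne _ _ n4)
      · rw [(above p r p1 r1).1, (above q r q1 r1).1, (above p t p1 t1).1, (above q t q1 t1).1]
        simp only [iff_self]
      · exact absurd h hy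
    · rcases j2.of_halfTurn hS hT with ⟨r1, t1, k2⟩ | ⟨r1, t1, k2⟩ | ⟨-, h, -⟩
      · rw [(above r p r1 p1).2, (above r q r1 q1).2, (above t p t1 p1).2, (above t q t1 q1).2]
      · rw [fixed p r p1 r1, fixed q r q1 r1, fixed p t p1 t1, fixed q t q1 t1]
        exact hA.chords _ _ _ _ _ ((hp.of_halfTurn hT).2 p1) ((hq.of_halfTurn hT).2 q1)
          ((hr.of_halfTurn hT).2 r1) ((ht.of_halfTurn hT).2 t1) k1 k2 n1 n2 n3 n4
      · exact absurd h hy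
    · exact absurd h hy

theorem upsideDown_upsideDown (A : FoldedState n) : A.upsideDown.upsideDown = A := by
  ext <;> simp [upsideDown]

theorem FoldDown.upsideDown {A B : FoldedState n} (h : FoldDown A B) :
    FoldUp A.upsideDown B.upsideDown := by
  obtain ⟨x, c, S, hS, htop, hc, h1, h2⟩ := h
  refine ⟨x, -c, S, hS, fun s hs t ht ho => ?_, fun t => ?_, fun s hs => ?_, fun s hs => ?_⟩
  · exact neg_lt_neg (htop s hs t ht ho)
  · exact neg_lt_neg (hc t)
  · obtain ⟨e1, e2, e3⟩ := h1 s hs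
    refine ⟨e1, e2, ?_⟩
    simp only [FoldedState.upsideDown, e3]
    ring
  · obtain ⟨e1, e2, e3⟩ := h2 s hs
    refine ⟨e1, e2, ?_⟩
    simp only [FoldedState.upsideDown, e3]

theorem NonCrossing.someLayersFold {A B : FoldedState n} (hA : A.NonCrossing)
    (h : SomeLayersFold A B) : B.NonCrossing := by
  rcases h with h | h
  · exact hA.foldUp h
  · have := (hA.upsideDown.foldUp h.upsideDown).upsideDown
    rwa [upsideDown_upsideDown] at this

/-- Folding does not stretch the paper. -/
theorem SomeLayersFold.abs_sub {A B : FoldedState n} (h : SomeLayersFold A B) (s : Fin (n + 1)) :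
    |B.pos s.succ - B.pos s.castSucc| = |A.pos s.succ - A.pos s.castSucc| := by
  have : ∃ x c S, HalfTurn A B x c S := by
    rcases h with ⟨x, c, S, -, -, -, h⟩ | ⟨x, c, S, -, -, -, h⟩ <;> exact ⟨x, c, S, h⟩
  obtain ⟨x, c, S, h⟩ := this
  by_cases hs : s ∈ S
  · obtain ⟨e1, e2, -⟩ := h.1 s hs
    rw [e1, e2, abs_sub_comm]
    congr 1; ring
  · obtain ⟨e1, e2, -⟩ := h.2 s hs
    rw [e1, e2]

end FoldedState

namespace MixedPattern

open FoldedState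

/-- Different segments do not overlap, so each side of a point carries at most one half, and chords
have no occasion to cross. -/
theorem noncrossing_unfolded (P : MixedPattern) : P.unfolded.NonCrossing := by
  have hlt : ∀ s : Fin (P.numCreases + 1), P.vertex s.castSucc < P.vertex s.succ :=
    fun s => P.vertex_strictMono (Fin.castSucc_lt_succ (i := s))
  have overlap : ∀ s t, P.unfolded.Overlap s t → s = t := by
    intro s t h
    simp only [Overlap, FoldedState.lo, FoldedState.hi, unfolded, min_eq_left (hlt _).le, max_eq_right (hlt _).le] at h
    rw [P.vertex_strictMono.lt_iff_lt, P.vertex_strictMono.lt_iff_lt] at h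
    have h1 := h.1
    have h2 := h.2
    simp only [Fin.lt_def, Fin.val_castSucc, Fin.val_succ] at h1 h2
    ext; omega
  refine ⟨fun s => (hlt s).ne, fun s t h hst => absurd (overlap s t h) hst, ?_⟩
  rintro x ⟨p, s₁⟩ ⟨q, s₂⟩ ⟨r, s₃⟩ ⟨t, s₄⟩ hp hq hr ht j1 j2 n1 n2 n3 n4
  have e : ∀ {a b : Fin (P.numCreases + 1)} {s t}, P.unfolded.Touch x (a, s) →
      P.unfolded.Touch x (b, t) → (a, s) ≠ (b, t) → s ≠ t := by
    rintro a b s t ha hb hab rfl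
    exact hab (by rw [overlap a b (ha.overlap hb)])
  have m1 := e hp hr n1
  have m2 := e hp ht n2
  have m3 := e hq hr n3
  have m4 := e hq ht n4
  have : s₁ = s₂ := (Bool.eq_not.2 m1).trans (Bool.eq_not.2 m3).symm
  have : s₃ = s₄ := (Bool.eq_not.2 m1.symm).trans (Bool.eq_not.2 m2.symm).symm
  subst s₂ s₄
  cases s₁ <;> cases s₃ <;> first | exact absurd rfl m1 | simp [Below]

theorem folds_unfolded (P : MixedPattern) {B : FoldedState P.numCreases}
    (h : Relation.ReflTransGen SomeLayersFold P.unfolded B) : B.NonCrossing ∧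
    ∀ s : Fin (P.numCreases + 1),
      |B.pos s.succ - B.pos s.castSucc| = P.vertex s.succ - P.vertex s.castSucc := by
  induction h with
  | refl =>
    refine ⟨P.noncrossing_unfolded, fun s => abs_of_pos (sub_pos.2 (P.vertex_strictMono ?_))⟩
    exact Fin.castSucc_lt_succ (i := s)
  | tail _ h ih => exact ⟨ih.1.someLayersFold h, fun s => by rw [h.abs_sub, ih.2]⟩

end MixedPattern

end SimpleFolding

/-! ### From completely folded states to flat words -/

namespace SimpleFolding

namespace MixedPattern

open FoldedState

variable (P : MixedPattern)

/-- The coordinate of the `k`-th vertex. -/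
def coord (k : ℕ) : ℚ := if h : k < P.numCreases + 2 then P.vertex ⟨k, h⟩ else 0

/-- The position of the `k`-th vertex when the paper is folded at all creases, up to an alternating
sign and a translation. -/
def zigzag : ℕ → ℚ
  | 0 => P.coord 0
  | k + 1 => P.coord (k + 1) - P.coord k - zigzag k

/-- The letter that introduces the `k`-th vertex. -/
def letter (k : Fin (P.numCreases + 2)) : Letter :=
  if h : 1 ≤ (k : ℕ) ∧ (k : ℕ) ≤ P.numCreases then
    creaseLetter (P.assignment ⟨k - 1, by omega⟩) else .paperEnd

/-- The labelled word that describes the pattern. -/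
def word : List (ℚ × Letter) := List.ofFn fun k => (P.zigzag k, P.letter k)

theorem letter_succ (j : Fin P.numCreases) :
    P.letter j.succ.castSucc = creaseLetter (P.assignment j) := by
  unfold letter
  rw [dif_pos ⟨by simp, by simp⟩]
  rfl

theorem coord_castSucc (s : Fin (P.numCreases + 1)) : P.coord s = P.vertex s.castSucc := by
  unfold coord
  rw [dif_pos (by omega)]
  rfl

theorem coord_succ (s : Fin (P.numCreases + 1)) : P.coord (s + 1) = P.vertex s.succ := by
  unfold coord
  rw [dif_pos (by omega)]
  rfl

theorem zigzag_add (s : Fin (P.numCreases + 1)) :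
    P.zigzag s + P.zigzag (s + 1) = P.vertex s.succ - P.vertex s.castSucc := by
  rw [zigzag, coord_castSucc, coord_succ]
  ring

theorem zigzag_add_pos {i : ℕ} (hi : i < P.numCreases + 1) : 0 < P.zigzag i + P.zigzag (i + 1) := by
  rw [P.zigzag_add ⟨i, hi⟩, sub_pos]
  exact P.vertex_strictMono (Fin.castSucc_lt_succ (i := ⟨i, hi⟩))

/-- The vertex positions of a completely folded state. -/
theorem exists_pos_eq {B : FoldedState P.numCreases} (hf : ∀ j, B.Folded j)
    (hlen : ∀ s : Fin (P.numCreases + 1),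
      |B.pos s.succ - B.pos s.castSucc| = P.vertex s.succ - P.vertex s.castSucc) :
    ∃ ε t : ℚ, (ε = 1 ∨ ε = -1) ∧ ∀ k : Fin (P.numCreases + 2),
      B.pos k = t + ε * (-1) ^ (k : ℕ) * P.zigzag k := by
  obtain ⟨ε, hε, h0⟩ : ∃ ε : ℚ, (ε = 1 ∨ ε = -1) ∧ (B.FaceUp 0 ↔ ε = -1) := by
    by_cases h : B.FaceUp 0
    · exact ⟨-1, Or.inr rfl, by simpa using h⟩
    · exact ⟨1, Or.inl rfl, by simp [h]; norm_num⟩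
  have hup : ∀ k (hk : k < P.numCreases + 1), B.FaceUp ⟨k, hk⟩ ↔ ε * (-1) ^ k = -1 := by
    intro k
    induction k with
    | zero => intro hk; simpa using h0
    | succ k ih =>
      intro hk
      have h1 := hf ⟨k, by omega⟩
      have h2 := ih (by omega)
      have h3 : B.FaceUp (Fin.castSucc ⟨k, by omega⟩) ↔ B.FaceUp ⟨k, by omega⟩ := Iff.rfl
      have h4 : B.FaceUp (Fin.succ ⟨k, by omega⟩) ↔ B.FaceUp ⟨k + 1, hk⟩ := Iff.rfl
      unfold Folded at h1
      rw [h3, h4, h2] at h1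
      rw [pow_succ, ← mul_assoc]
      have hs : ε * (-1) ^ k = 1 ∨ ε * (-1) ^ k = -1 := by
        rcases hε with rfl | rfl <;> rcases neg_one_pow_eq_or ℚ k with e | e <;> simp [e]
      rcases hs with e | e <;> rw [e] at h1 ⊢ <;> norm_num at h1 ⊢ <;> exact h1
  refine ⟨ε, B.pos 0 - ε * P.zigzag 0, hε, ?_⟩
  rintro ⟨k, hk⟩
  induction k with
  | zero => simp
  | succ k ih =>
    have h1 := ih (by omega)
    have h2 := hlen ⟨k, by omega⟩
    have h3 := hup k (by omega)
    have h4 := P.zigzag_add ⟨k, by omega⟩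
    have h5 := P.zigzag_add_pos (i := k) (by omega)
    rw [← h4] at h2
    unfold FaceUp at h3
    simp only [Fin.succ_mk, Fin.castSucc_mk] at *
    have h6 : B.pos ⟨k + 1, hk⟩ - B.pos ⟨k, by omega⟩ =
        - (ε * (-1) ^ k) * (P.zigzag k + P.zigzag (k + 1)) := by
      have hs : ε * (-1) ^ k = 1 ∨ ε * (-1) ^ k = -1 := by
        rcases hε with rfl | rfl <;> rcases neg_one_pow_eq_or ℚ k with e | e <;> simp [e]
      rcases hs with e | e <;> rw [e] at h3 ⊢
      · norm_num at h3
        rw [abs_of_nonpos (by linarith)] at h2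
        linarith
      · norm_num at h3
        rw [abs_of_pos (by linarith)] at h2
        linarith
    rw [pow_succ]
    linarith

/-- The positions are those of the zigzag by `exists_pos_eq`, and the heights of the folded state
provide the layering. Both `through` and `cross` are instances of `NonCrossing.chords`: the chord of
a crease against that of a segment passing straight through the point, or against that of another
crease. -/
theorem mixedFlat_of_foldable (h : P.FlatFoldableSomeLayers) : MixedFlat P.word := by
  obtain ⟨B, hB, hd⟩ := h
  obtain ⟨hN, hlen⟩ := P.folds_unfolded hB
  have hf := fun j => (hd j).1
  obtain ⟨ε, t, hε, hpos⟩ := P.exists_pos_eq hf hlen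
  let dir : Fin (P.numCreases + 2) → Direction := fun k =>
    if h : 1 ≤ (k : ℕ) ∧ (k : ℕ) ≤ P.numCreases then B.direction ⟨k - 1, by omega⟩ else .mountain
  let L : Word := List.ofFn fun k : Fin (P.numCreases + 2) => (P.zigzag k, dir k)
  have hL : L.length = P.numCreases + 2 := List.length_ofFn
  have hz : ∀ i, i < P.numCreases + 2 → L.z i = P.zigzag i := by
    intro i hi
    simp only [Word.z]
    rw [List.getD_eq_getElem _ _ (by omega), List.getElem_ofFn]
  have hdir : ∀ i (hi : i < P.numCreases), L.dir (i + 1) = B.direction ⟨i, hi⟩ := by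
    intro i hi
    simp only [Word.dir]
    rw [List.getD_eq_getElem _ _ (by omega), List.getElem_ofFn]
    simp only [dir]
    rw [dif_pos ⟨by omega, by omega⟩]
    rfl
  have hx : ∀ i (hi : i < P.numCreases + 2), B.pos ⟨i, hi⟩ = t + L.pos ε i := by
    intro i hi
    rw [hpos, Word.pos, hz i hi]
  -- comparisons of positions
  have seg : ∀ i (hi : i < P.numCreases + 1), B.pos (Fin.castSucc ⟨i, hi⟩) = t + L.pos ε i ∧
      B.pos (Fin.succ ⟨i, hi⟩) = t + L.pos ε (i + 1) := fun i hi => ⟨hx i (by omega), hx (i + 1) (by omega)⟩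
  have face : ∀ i (hi : i < P.numCreases + 1), B.FaceUp ⟨i, hi⟩ ↔ L.pos ε i < L.pos ε (i + 1) := by
    intro i hi
    rw [FaceUp, (seg i hi).1, (seg i hi).2, add_lt_add_iff_left]
  have fold : ∀ i (hi : i < P.numCreases), ¬ (L.pos ε i < L.pos ε (i + 1) ↔ L.pos ε (i + 1) < L.pos ε (i + 2)) := by
    intro i hi
    rw [← face i (by omega), ← face (i + 1) (by omega)]
    exact hf ⟨i, hi⟩
  have ne : ∀ i, i < P.numCreases + 1 → L.pos ε i ≠ L.pos ε (i + 1) := by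
    intro i hi h
    apply hN.nondegenerate ⟨i, hi⟩
    rw [(seg i hi).1, (seg i hi).2, h]
  have touch : ∀ i (hi : i < P.numCreases + 1) x s, B.Touch (t + x) (⟨i, hi⟩, s) ↔
      if s then min (L.pos ε i) (L.pos ε (i + 1)) ≤ x ∧ x < max (L.pos ε i) (L.pos ε (i + 1)) else
        min (L.pos ε i) (L.pos ε (i + 1)) < x ∧ x ≤ max (L.pos ε i) (L.pos ε (i + 1)) := by
    intro i hi x s
    simp only [Touch, FoldedState.lo, FoldedState.hi, (seg i hi).1, (seg i hi).2, min_add_add_left, max_add_add_left,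
      add_le_add_iff_left, add_lt_add_iff_left]
  -- the two segments at a crease lie on the same side of it
  have crease : ∀ i (hi : i < P.numCreases), ∃ s, B.Touch (t + L.pos ε (i + 1)) (⟨i, by omega⟩, s) ∧
      B.Touch (t + L.pos ε (i + 1)) (⟨i + 1, by omega⟩, s) ∧
      (s = false ↔ L.pos ε i < L.pos ε (i + 1)) := by
    intro i hi
    have h1 := fold i hi
    have h2 := ne i (by omega)
    have h3 := ne (i + 1) (by omega)
    simp only [touch, show i + 1 + 1 = i + 2 from rfl] at h3 ⊢
    rcases lt_or_gt_of_ne h2 with h4 | h4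
    · have h5 : L.pos ε (i + 2) < L.pos ε (i + 1) :=
        lt_of_le_of_ne (not_lt.1 fun h => h1 (iff_of_true h4 h)) h3.symm
      exact ⟨false, by simp [h4], by simp [h5], by simp [h4]⟩
    · have h5 : L.pos ε (i + 1) < L.pos ε (i + 2) :=
        lt_of_le_of_ne (not_lt.1 fun h => h1 (iff_of_false h4.not_gt h.not_gt)) h3
      exact ⟨true, by simp [h4], by simp [h5], by simp [h4.le]⟩
  have joined : ∀ i (hi : i < P.numCreases) s u, B.Joined (t + L.pos ε (i + 1)) (⟨i, by omega⟩, s)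
      (⟨i + 1, by omega⟩, u) := fun i hi s u => Or.inr ⟨⟨i, hi⟩, hx (i + 1) (by omega), Or.inl ⟨rfl, rfl⟩⟩
  -- In a state, segments that do not overlap may have equal heights. Scaling by the number of
  -- segments and adding the index makes all heights distinct and keeps the strict comparisons.
  let h : ℕ → ℤ := fun i => if hi : i < P.numCreases + 1 then B.height ⟨i, hi⟩ * (P.numCreases + 1) + i else 0
  have hdef : ∀ i (hi : i < P.numCreases + 1), h i = B.height ⟨i, hi⟩ * (P.numCreases + 1) + i := fun i hi => dif_pos hi
  have hlt : ∀ i (hi : i < P.numCreases + 1) j (hj : j < P.numCreases + 1), B.height ⟨i, hi⟩ ≠ B.height ⟨j, hj⟩ →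
      (h i < h j ↔ B.height ⟨i, hi⟩ < B.height ⟨j, hj⟩) := by
    intro i hi j hj hne
    rw [hdef i hi, hdef j hj]
    constructor
    · intro hh
      by_contra hc
      have : B.height ⟨j, hj⟩ + 1 ≤ B.height ⟨i, hi⟩ := by omega
      nlinarith
    · intro hh
      have : B.height ⟨i, hi⟩ + 1 ≤ B.height ⟨j, hj⟩ := by omega
      nlinarith
  have hlt' : ∀ i (hi : i < P.numCreases + 1) j (hj : j < P.numCreases + 1) x s, B.Touch x (⟨i, hi⟩, s) →
      B.Touch x (⟨j, hj⟩, s) → i ≠ j → B.height ⟨i, hi⟩ ≠ B.height ⟨j, hj⟩ := by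
    intro i hi j hj x s h1 h2 hij
    exact hN.height_ne_of_touch h1 h2 (by simp only [ne_eq, Prod.mk.injEq, Fin.mk.injEq, and_true]; exact hij) rfl
  refine ⟨L, ?_, ?_, ε, hε, h, ?_, ?_⟩
  · rw [Agrees, List.forall₂_iff_get]
    refine ⟨by simp [L, word], ?_⟩
    intro i h1 h2
    have hi : i < P.numCreases + 2 := hL ▸ h1
    simp only [L, word, List.get_eq_getElem, List.getElem_ofFn, true_and]
    intro d hd'
    simp only [letter] at hd'
    split_ifs at hd' with hi'
    simp only [dir, dif_pos hi']
    refine (hd ⟨i - 1, by omega⟩).2 d ?_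
    cases ha : P.assignment ⟨i - 1, by omega⟩ with
    | none => rw [ha] at hd'; simp [creaseLetter] at hd'
    | some e => rw [ha] at hd'; simpa [creaseLetter] using hd'
  · intro i hi
    rw [hz _ (by omega), hz _ (by omega)]
    exact P.zigzag_add_pos (by omega)
  · rw [hL, show P.numCreases + 2 - 1 = P.numCreases + 1 by omega]
    refine ⟨?_, ne, ?_, ?_, ?_⟩
    · intro i hi
      have h1 := fold i (by omega)
      have h3 := ne (i + 1) hi
      simp only [show i + 1 + 1 = i + 2 from rfl] at h3
      constructor
      · intro h4
        exact lt_of_le_of_ne (not_lt.1 fun h => h1 (iff_of_true h4 h)) h3.symm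
      · intro h4
        by_contra h5
        exact h1 (iff_of_false h5 h4.not_gt)
    · intro i hi j hj hij
      rw [hdef i hi, hdef j hj] at hij
      have : ((i : ℤ) - j) = (B.height ⟨j, hj⟩ - B.height ⟨i, hi⟩) * (P.numCreases + 1) := by linarith
      have h1 : (B.height ⟨j, hj⟩ - B.height ⟨i, hi⟩) = 0 := by
        by_contra hc
        rcases lt_or_gt_of_ne hc with hc | hc
        · nlinarith
        · nlinarith
      rw [h1] at this
      omega
    · intro i hi w hw h1 h2
      obtain ⟨s, t1, t2, -⟩ := crease i (by omega)
      have wl : B.Touch (t + L.pos ε (i + 1)) (⟨w, hw⟩, false) := (touch w hw _ _).2 ⟨h1, h2.le⟩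
      have wr : B.Touch (t + L.pos ε (i + 1)) (⟨w, hw⟩, true) := (touch w hw _ _).2 ⟨h1.le, h2⟩
      have n1 : i ≠ w := by rintro rfl; exact absurd h2 (by simp at h1 ⊢; exact h1.le)
      have n2 : i + 1 ≠ w := by rintro rfl; exact absurd h2 (by simp at h1 ⊢; exact h1.le)
      have ws : ∀ s, B.Touch (t + L.pos ε (i + 1)) (⟨w, hw⟩, s) := by
        intro s; cases s <;> assumption
      rw [hlt i (by omega) w hw (hlt' _ _ _ _ _ _ t1 (ws s) n1),
        hlt (i + 1) (by omega) w hw (hlt' _ _ _ _ _ _ t2 (ws s) n2)]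
      have key := hN.chords _ _ _ _ _ t1 t2 wl wr (joined i (by omega) s s) (Or.inl ⟨rfl, by simp⟩)
        (by simp [n1]) (by simp [n1])
        (by simp [n2]) (by simp [n2])
      have e1 := hlt' _ _ _ _ _ _ t1 (ws s) n1
      have e2 := hlt' _ _ _ _ _ _ t2 (ws s) n2
      cases s <;> simp only [Below, iff_self, iff_true, true_iff] at key <;> omega
    · intro i j hi hj hij hpij hdirij
      obtain ⟨s, t1, t2, hs⟩ := crease i (by omega)
      obtain ⟨s', t3, t4, hs'⟩ := crease j (by omega)
      obtain rfl : s = s' := by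
        rw [hdirij, ← hs'] at hs
        cases s <;> cases s' <;> simp_all
      have n1 : i + 1 ≠ j := by
        rintro rfl; exact ne (i + 1) hi hpij
      have n2 : i ≠ j + 1 := by
        rintro rfl; exact ne (j + 1) hj hpij.symm
      rw [← hpij] at t3 t4
      have e1 := hlt' _ _ _ _ _ _ t1 t3 hij
      have e2 := hlt' _ _ _ _ _ _ t2 t3 n1
      have e3 := hlt' _ _ _ _ _ _ t1 t4 n2
      have e4 := hlt' _ _ _ _ _ _ t2 t4 (by omega)
      rw [hlt _ _ _ _ e1, hlt _ _ _ _ e2, hlt _ _ _ _ e3, hlt _ _ _ _ e4]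
      have key := hN.chords _ _ _ _ _ t1 t2 t3 t4 (joined i (by omega) s s)
        (hpij ▸ joined j (by omega) s s) (by simpa using hij) (by simpa using n2)
        (by simpa using n1) (by simpa using hij)
      cases s <;> simp only [Below] at key
      · exact key
      · omega
  · intro i hi
    have hi : i < P.numCreases := by omega
    obtain ⟨s, t1, t2, -⟩ := crease i hi
    rw [hdir i hi, ← face i (by omega), hlt _ _ _ _ (hlt' _ _ _ _ _ _ t1 t2 (by omega))]
    classical
    unfold direction
    have e : ((B.FaceUp (Fin.castSucc ⟨i, hi⟩) ↔
        B.height (Fin.castSucc ⟨i, hi⟩) < B.height (Fin.succ ⟨i, hi⟩))) ↔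
        (B.FaceUp ⟨i, by omega⟩ ↔ B.height ⟨i, by omega⟩ < B.height ⟨i + 1, by omega⟩) := Iff.rfl
    rw [← e]
    split_ifs with hh
    · exact iff_of_true rfl hh
    · exact iff_of_false (by simp) hh

end MixedPattern

end SimpleFolding

namespace SimpleFolding

/-! ### Executing reductions by simple folds -/

namespace FoldedState

/-- The state with the given positions and heights. -/
def ofFun (n : ℕ) (p : ℕ → ℚ) (h : ℕ → ℤ) : FoldedState n := ⟨fun k => p k, fun s => h s⟩

/-- Crease `j` is folded, in the direction prescribed by `dir`. -/
def Done (dir : ℕ → Direction) (p : ℕ → ℚ) (h : ℕ → ℤ) (j : ℕ) : Prop :=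
  ¬ (p j < p (j + 1) ↔ p (j + 1) < p (j + 2)) ∧ h j ≠ h (j + 1) ∧
    (dir (j + 1) = .valley ↔ (p j < p (j + 1) ↔ h j < h (j + 1)))

/-- The positions after reflecting the part to the right (or left) of vertex `b` of the paper. -/
def reflect (r : Bool) (b : ℕ) (p : ℕ → ℚ) (k : ℕ) : ℚ :=
  if (if r then b ≤ k else k ≤ b) then 2 * p b - p k else p k

/-- Every other crease has both segments moved or both fixed, and it keeps its direction, because a
half-turn reverses the facing as well as the order of the layers. An upward fold at a crease where
the paper faces up gives a valley, whichever part is moved; this accounts for `hdir`. -/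
theorem exists_fold {n : ℕ} {dir : ℕ → Direction} {p : ℕ → ℚ} {h : ℕ → ℤ} (nd : ∀ s ≤ n, p s ≠ p (s + 1))
    (r u : Bool) {i : ℕ} (hi : i < n) (side : (∀ k ≤ n + 1, (if r then i + 1 ≤ k else k ≤ i + 1) → p (i + 1) ≤ p k) ∨
      (∀ k ≤ n + 1, (if r then i + 1 ≤ k else k ≤ i + 1) → p k ≤ p (i + 1)))
    (unfolded : p i < p (i + 1) ↔ p (i + 1) < p (i + 2))
    (layers : ∀ s ≤ n, ∀ t ≤ n, (if r then i + 1 ≤ s else s ≤ i) → ¬ (if r then i + 1 ≤ t else t ≤ i) →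
      min (p s) (p (s + 1)) < max (p t) (p (t + 1)) → min (p t) (p (t + 1)) < max (p s) (p (s + 1)) →
      if u then h t < h s else h s < h t)
    (hdir : dir (i + 1) = .valley ↔ (p i < p (i + 1) ↔ u = true)) :
    ∃ h', SomeLayersFold (ofFun n p h) (ofFun n (reflect r (i + 1) p) h') ∧
      (∀ s ≤ n, ∀ t ≤ n, (if r then i + 1 ≤ s else s ≤ i) → ¬ (if r then i + 1 ≤ t else t ≤ i) →
        if u then h' t < h' s else h' s < h' t) ∧
      (∀ j < n, j ≠ i → Done dir p h j → Done dir (reflect r (i + 1) p) h' j) ∧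
      Done dir (reflect r (i + 1) p) h' i ∧
      ∀ s ≤ n, reflect r (i + 1) p s ≠ reflect r (i + 1) p (s + 1) := by
  -- The axis has to lie beyond all layers; the sum of the absolute heights bounds each of them.
  obtain ⟨c, hc⟩ : ∃ c : ℤ, ∀ t ≤ n, if u then h t < c else c < h t := by
    have h1 := fun t (ht : t ∈ Finset.range (n + 1)) =>
      Finset.single_le_sum (f := fun t => |h t|) (fun _ _ => abs_nonneg _) ht
    refine ⟨if u then (∑ t ∈ Finset.range (n + 1), |h t|) + 1 else
      -((∑ t ∈ Finset.range (n + 1), |h t|) + 1), fun t ht => ?_⟩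
    have h2 := h1 t (Finset.mem_range.2 (by omega))
    have h3 := le_abs_self (h t)
    have h4 := neg_abs_le (h t)
    cases u <;> simp only [if_true, Bool.false_eq_true, if_false] <;> omega
  let S : ℕ → Prop := fun s => if r then i + 1 ≤ s else s ≤ i
  have hSd : ∀ s, S s ↔ if r then i + 1 ≤ s else s ≤ i := fun s => Iff.rfl
  have dec : DecidablePred S := fun s => by simp only [S]; infer_instance
  let h' : ℕ → ℤ := fun s => if S s then 2 * c - h s else h s
  have pS : ∀ s, S s → reflect r (i + 1) p s = 2 * p (i + 1) - p s ∧
      reflect r (i + 1) p (s + 1) = 2 * p (i + 1) - p (s + 1) := by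
    intro s hs
    simp only [S] at hs
    simp only [reflect]
    cases r <;> simp only [Bool.false_eq_true, if_false, if_true] at hs ⊢ <;>
      exact ⟨if_pos (by omega), if_pos (by omega)⟩
  -- Vertex `i + 1` is subject to `reflect` too, but lies on the axis and stays in place, so the
  -- stationary segment that ends there does not move.
  have pS' : ∀ s, ¬ S s → reflect r (i + 1) p s = p s ∧
      reflect r (i + 1) p (s + 1) = p (s + 1) := by
    intro s hs
    simp only [S] at hs
    simp only [reflect]
    cases r <;> simp only [Bool.false_eq_true, if_false, if_true] at hs ⊢
    · constructor
      · split_ifs with h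
        · obtain rfl : s = i + 1 := by omega
          ring
        · rfl
      · rw [if_neg (by omega)]
    · constructor
      · rw [if_neg (by omega)]
      · split_ifs with h
        · obtain rfl : s = i := by omega
          ring
        · rfl
  have hS : ∀ s, S s → h' s = 2 * c - h s := fun s hs => if_pos hs
  have hS' : ∀ s, ¬ S s → h' s = h s := fun s hs => if_neg hs
  have faceS : ∀ s ≤ n, S s → (reflect r (i + 1) p s < reflect r (i + 1) p (s + 1) ↔ ¬ p s < p (s + 1)) := by
    intro s hs hSs
    rw [(pS s hSs).1, (pS s hSs).2, sub_lt_sub_iff_left, not_lt]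
    exact ⟨le_of_lt, fun h => lt_of_le_of_ne h (nd s hs).symm⟩
  have faceS' : ∀ s, ¬ S s → (reflect r (i + 1) p s < reflect r (i + 1) p (s + 1) ↔ p s < p (s + 1)) := by
    intro s hSs
    rw [(pS' s hSs).1, (pS' s hSs).2]
  have sep : ∀ s ≤ n, ∀ t ≤ n, S s → ¬ S t → if u then h' t < h' s else h' s < h' t := by
    intro s hs t ht h1 h2
    rw [hS s h1, hS' t h2]
    have e1 := hc s hs
    have e2 := hc t ht
    cases u <;> simp only [if_true, Bool.false_eq_true, if_false] at * <;> omega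
  have hmov : (ofFun n p h).Movable (p (i + 1)) {s | S s} := by
    refine ⟨?_, ?_, ?_, ?_⟩
    · refine ⟨if r then Fin.last n else 0, ?_⟩
      cases r <;> simp [S] <;> omega
    · refine ⟨if r then 0 else Fin.last n, ?_⟩
      cases r <;> simp [S] <;> omega
    · have key : ∀ s : Fin (n + 1), S s → (if r then i + 1 ≤ (s : ℕ) else (s : ℕ) ≤ i + 1) ∧
          (if r then i + 1 ≤ (s : ℕ) + 1 else (s : ℕ) + 1 ≤ i + 1) := by
        intro s hs
        simp only [S] at hs
        cases r <;> simp only [if_true, Bool.false_eq_true, if_false] at * <;> omega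
      refine side.imp (fun h s hs => ?_) (fun h s hs => ?_)
      · exact le_min (h s (by omega) (key s hs).1) (h (s + 1) (by omega) (key s hs).2)
      · exact max_le (h s (by omega) (key s hs).1) (h (s + 1) (by omega) (key s hs).2)
    · intro j
      by_cases hj : (j : ℕ) = i
      · right
        refine ⟨?_, ?_⟩
        · simp only [Folded, FaceUp, ofFun, not_not, Fin.val_castSucc, Fin.val_succ, hj]
          exact unfolded
        · simp [creasePos, ofFun, hj]
      · left
        simp only [S, Set.mem_ofPred_eq, Fin.val_castSucc, Fin.val_succ]
        cases r <;> simp only [if_true, Bool.false_eq_true, if_false] <;> omega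
  have hturn : HalfTurn (ofFun n p h) (ofFun n (reflect r (i + 1) p) h') (p (i + 1)) c {s | S s} :=
    ⟨fun s hs => ⟨(pS s hs).1, (pS s hs).2, hS s hs⟩, fun s hs => ⟨(pS' s hs).1, (pS' s hs).2, hS' s hs⟩⟩
  refine ⟨h', ?_, sep, ?_, ?_, fun s hs => ?_⟩
  · cases u with
    | true =>
      refine Or.inl ⟨p (i + 1), c, {s | S s}, hmov, fun s hs t ht ho => ?_, fun t => ?_, hturn⟩
      · exact layers s (by omega) t (by omega) hs ht ho.1 ho.2
      · exact hc t (by omega)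
    | false =>
      refine Or.inr ⟨p (i + 1), c, {s | S s}, hmov, fun s hs t ht ho => ?_, fun t => ?_, hturn⟩
      · exact layers s (by omega) t (by omega) hs ht ho.1 ho.2
      · exact hc t (by omega)
  · rintro j hj hji ⟨d1, d2, d3⟩
    have hSj : S j ↔ S (j + 1) := by
      simp only [S]
      cases r <;> simp only [if_true, Bool.false_eq_true, if_false] <;> omega
    unfold Done
    by_cases hs : S j
    · have hs' := hSj.1 hs
      have e : h' j < h' (j + 1) ↔ ¬ h j < h (j + 1) := by rw [hS j hs, hS _ hs']; omega
      rw [faceS j (by omega) hs, faceS (j + 1) (by omega) hs', e, not_iff_not, not_iff_not]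
      refine ⟨d1, ?_, d3⟩
      rw [hS j hs, hS _ hs']; omega
    · have hs' := fun h => hs (hSj.2 h)
      rw [faceS' j hs, faceS' (j + 1) hs', hS' j hs, hS' _ hs']
      exact ⟨d1, d2, d3⟩
  · unfold Done
    rw [hdir]
    cases r with
    | true =>
      have h1 : ¬ S i := by simp [S]
      have h2 : S (i + 1) := by simp [S]
      have h3 := sep (i + 1) (by omega) i (by omega) h2 h1
      rw [faceS' i h1, faceS (i + 1) (by omega) h2, unfolded]
      cases u <;> simp only [if_true, Bool.false_eq_true, if_false] at h3 <;>
        refine ⟨by tauto, by omega, iff_congr Iff.rfl ?_⟩ <;> simp <;> omega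
    | false =>
      have h1 : S i := by simp [S]
      have h2 : ¬ S (i + 1) := by simp [S]
      have h3 := sep i (by omega) (i + 1) (by omega) h1 h2
      rw [faceS i (by omega) h1, faceS' (i + 1) h2, unfolded]
      cases u <;> simp only [if_true, Bool.false_eq_true, if_false] at h3 <;>
        refine ⟨by tauto, by omega, ?_⟩
      · have : h' i < h' (i + 1) := h3
        simp only [this, iff_true, Bool.false_eq_true, iff_false]
      · have : ¬ h' i < h' (i + 1) := by omega
        simp only [this, iff_true, iff_false, not_not]

  · by_cases hSs : S s
    · rw [(pS s hSs).1, (pS s hSs).2]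
      simpa using nd s hs
    · rw [(pS' s hSs).1, (pS' s hSs).2]
      exact nd s hs

/-- The folds made so far have left a straight strip with the creases in `I`, its first and last
vertex being `F` and `Z`; the strip is flat with alternating vertex positions given by `z`. -/
structure Strip (n : ℕ) (z : ℕ → ℚ) (dir : ℕ → Direction) (p : ℕ → ℚ) (h : ℕ → ℤ) (F Z : ℕ)
    (I : List ℕ) : Prop where
  nd : ∀ s ≤ n, p s ≠ p (s + 1)
  sorted : I.Pairwise (· < ·)
  le : ∀ b ∈ I, b ≤ n + 1
  head : I.head? = some F
  last : I.getLast? = some Z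
  gaps : I.IsChain fun a b => p b - p a = z a + z b
  first_le : ∀ k ≤ n + 1, p F ≤ p k
  le_last : ∀ k ≤ n + 1, p k ≤ p Z
  before : ∀ b ∈ I, b ≠ F → ∀ k ≤ b, p k ≤ p b
  after : ∀ b ∈ I, b ≠ Z → ∀ k ≤ n + 1, b ≤ k → p b ≤ p k
  done : ∀ j < n, (j + 1 ∈ I → j + 1 = F ∨ j + 1 = Z) → Done dir p h j

theorem exists_eq_valley_iff (d : Direction) (q : Prop) :
    ∃ u : Bool, d = .valley ↔ (q ↔ u = true) := by
  classical
  by_cases hq : q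
  · exact ⟨decide (d = .valley), by simp [hq]⟩
  · exact ⟨decide (d ≠ .valley), by simp [hq]⟩

variable {n : ℕ} {z : ℕ → ℚ} {dir : ℕ → Direction} {p : ℕ → ℚ} {h : ℕ → ℤ} {F Z : ℕ}

/-- At an inner crease of the strip all earlier paper lies to the left and all later paper to the
right, so the crease is still unfolded. -/
theorem Strip.straight {I : List ℕ} (hI : Strip n z dir p h F Z I) {i : ℕ} (hi : i < n) (hb : i + 1 ∈ I)
    (hF : i + 1 ≠ F) (hZ : i + 1 ≠ Z) : p i < p (i + 1) ∧ p (i + 1) < p (i + 2) :=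
  ⟨lt_of_le_of_ne (hI.before _ hb hF i (by omega)) (hI.nd i (by omega)),
    lt_of_le_of_ne (hI.after _ hb hZ (i + 2) (by omega) (by omega)) (hI.nd (i + 1) (by omega))⟩

/-- By `before` and `after` the moved and the stationary segments lie on opposite sides of `b`, so
the condition on the layers is vacuous. As `z a ≤ z c`, the part folded over does not reach beyond
`c`, which preserves the invariants at all later creases of the strip. -/
theorem Strip.foldLeft {a b c : ℕ} {V : List ℕ} (hI : Strip n z dir p h F Z (a :: b :: c :: V))
    (hac : z a ≤ z c) : ∃ p' h', SomeLayersFold (ofFun n p h) (ofFun n p' h') ∧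
      Strip n z dir p' h' b Z (b :: c :: V) := by
  obtain rfl : a = F := by simpa using hI.head
  have hs := hI.sorted
  simp only [List.pairwise_cons] at hs
  obtain ⟨sa, sb, sc, -⟩ := hs
  have ab := sa b (by simp)
  have bc := sb c (by simp)
  have cn := hI.le c (by simp)
  have hZm : Z ∈ c :: V := List.mem_of_getLast? (by simpa using hI.last)
  have hbZ : b < Z := sb Z hZm
  obtain ⟨i, rfl⟩ : ∃ i, b = i + 1 := ⟨b - 1, by omega⟩
  have hg := hI.gaps
  simp only [List.isChain_cons_cons] at hg
  obtain ⟨g1, g2, g3⟩ := hg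
  have bef := hI.before (i + 1) (by simp) (by omega)
  have aft := hI.after (i + 1) (by simp) (by omega)
  obtain ⟨u, hu⟩ := exists_eq_valley_iff (dir (i + 1)) (p i < p (i + 1))
  have st := hI.straight (i := i) (by omega) (by simp) (by omega) (by omega)
  obtain ⟨h', hf, -, hd, hdi, hnd⟩ := exists_fold hI.nd false u (i := i) (by omega)
    (Or.inr fun k hk hk' => bef k (by simpa using hk')) (by simp only [st.1, st.2])
    (fun s hs t ht h1 h2 h3 h4 => by
      simp only [Bool.false_eq_true, if_false, not_le] at h1 h2
      exact absurd h4 (not_lt.2 ((max_le (bef _ (by omega)) (bef _ (by omega))).trans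
        (le_min (aft _ (by omega) (by omega)) (aft _ (by omega) (by omega)))))) hu
  have r1 : ∀ k ≤ i + 1, reflect false (i + 1) p k = 2 * p (i + 1) - p k := by
    intro k hk; simp [reflect, hk]
  have r2 : ∀ k, i + 1 ≤ k → reflect false (i + 1) p k = p k := by
    intro k hk
    rcases hk.eq_or_lt with rfl | hk
    · rw [r1 _ le_rfl]; ring
    · simp [reflect, hk]
  have lec : ∀ k ≤ i + 1, reflect false (i + 1) p k ≤ p c := by
    intro k hk
    rw [r1 k hk]
    have := hI.first_le k (by omega)
    linarith
  have memge : ∀ b' ∈ (i + 1) :: c :: V, b' = i + 1 ∨ (c ≤ b') := by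
    intro b' hb'
    simp only [List.mem_cons] at hb'
    rcases hb' with rfl | rfl | hb'
    · exact Or.inl rfl
    · exact Or.inr le_rfl
    · exact Or.inr (sc _ hb').le
  have memle : ∀ b' ∈ (i + 1) :: c :: V, i + 1 ≤ b' := by
    intro b' hb'
    rcases memge b' hb' with h | h <;> omega
  have memca : ∀ b' ∈ (i + 1) :: c :: V, b' ≠ a := by
    intro b' hb'
    have := memle b' hb'
    omega
  refine ⟨_, h', hf, hnd, hI.sorted.tail, fun b' hb' => hI.le b' (List.mem_cons_of_mem _ hb'), rfl,
    by simpa using hI.last, ?_, ?_, ?_, ?_, ?_, ?_⟩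
  · refine List.IsChain.imp_of_mem_imp ?_ hI.gaps.tail
    intro x y hx hy hxy
    rw [r2 x (memle x hx), r2 y (memle y hy), hxy]
  · intro k hk
    rw [r2 _ le_rfl]
    rcases le_total k (i + 1) with hk' | hk'
    · rw [r1 k hk']
      linarith [bef k hk']
    · rw [r2 k hk']
      exact aft k hk hk'
  · intro k hk
    rw [r2 Z hbZ.le]
    rcases le_total k (i + 1) with hk' | hk'
    · exact (lec k hk').trans (hI.le_last c cn)
    · rw [r2 k hk']
      exact hI.le_last k hk
  · intro b' hb' hne k hk
    have hcb := (memge b' hb').resolve_left hne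
    have bef' := hI.before b' (List.mem_cons_of_mem _ hb') (memca b' hb')
    rw [r2 b' (by omega)]
    rcases le_total k (i + 1) with hk' | hk'
    · exact (lec k hk').trans (bef' c hcb)
    · rw [r2 k hk']
      exact bef' k hk
  · intro b' hb' hne k hk hk'
    have hib := memle b' hb'
    rw [r2 b' hib, r2 k (by omega)]
    exact hI.after b' (List.mem_cons_of_mem _ hb') hne k hk hk'
  · intro j hj hmem
    by_cases hji : j = i
    · subst hji; exact hdi
    · refine hd j hj hji (hI.done j hj fun hm => ?_)
      rcases List.mem_cons.1 hm with hm | hm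
      · exact Or.inl hm
      · rcases hmem hm with h | h
        · omega
        · exact Or.inr h

/-- The mirror image of `Strip.foldLeft`. -/
theorem Strip.foldRight {a b c : ℕ} {U : List ℕ} (hI : Strip n z dir p h F Z (U ++ [a, b, c]))
    (hca : z c ≤ z a) : ∃ p' h', SomeLayersFold (ofFun n p h) (ofFun n p' h') ∧
      Strip n z dir p' h' F b (U ++ [a, b]) := by
  obtain rfl : c = Z := by simpa using hI.last
  have hs := hI.sorted
  simp only [List.pairwise_append, List.pairwise_cons] at hs
  obtain ⟨sU, ⟨sa, sb, -⟩, sUa⟩ := hs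
  have ab := sa b (by simp)
  have bc := sb c (by simp)
  have cn := hI.le c (by simp)
  have memle : ∀ b' ∈ U ++ [a, b], b' ≤ a ∨ b' = b := by
    intro b' hb'
    simp only [List.mem_append, List.mem_cons, List.not_mem_nil, or_false] at hb'
    rcases hb' with hb' | rfl | rfl
    · exact Or.inl (sUa b' hb' a (by simp)).le
    · exact Or.inl le_rfl
    · exact Or.inr rfl
  have memI : ∀ b' ∈ U ++ [a, b, c], b' ∈ U ++ [a, b] ∨ b' = c := by
    intro b' hb'
    simp only [List.mem_append, List.mem_cons, List.not_mem_nil, or_false] at hb' ⊢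
    tauto
  have Imem : ∀ b' ∈ U ++ [a, b], b' ∈ U ++ [a, b, c] := by
    intro b' hb'
    simp only [List.mem_append, List.mem_cons, List.not_mem_nil, or_false] at hb' ⊢
    tauto
  have hFa : F ≤ a := by
    cases U with
    | nil => have := hI.head; simp at this; omega
    | cons x U =>
      have := hI.head
      simp only [List.cons_append, List.head?_cons, Option.some.injEq] at this
      subst this
      exact (sUa x (by simp) a (by simp)).le
  obtain ⟨i, rfl⟩ : ∃ i, b = i + 1 := ⟨b - 1, by omega⟩
  have hg := hI.gaps
  rw [List.isChain_split] at hg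
  have hg' := hg.2
  simp only [List.isChain_cons_cons] at hg'
  obtain ⟨g1, g2, g3⟩ := hg'
  have bef := hI.before (i + 1) (by simp) (by omega)
  have aft := hI.after (i + 1) (by simp) (by omega)
  obtain ⟨u, hu⟩ := exists_eq_valley_iff (dir (i + 1)) (p i < p (i + 1))
  have st := hI.straight (i := i) (by omega) (by simp) (by omega) (by omega)
  obtain ⟨h', hf, -, hd, hdi, hnd⟩ := exists_fold hI.nd true u (i := i) (by omega)
    (Or.inl fun k hk hk' => aft k hk (by simpa using hk')) (by simp only [st.1, st.2])
    (fun s hs t ht h1 h2 h3 h4 => by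
      simp only [if_true, not_le] at h1 h2
      exact absurd h3 (not_lt.2 ((max_le (bef _ (by omega)) (bef _ (by omega))).trans
        (le_min (aft _ (by omega) (by omega)) (aft _ (by omega) (by omega)))))) hu
  have r1 : ∀ k, i + 1 ≤ k → reflect true (i + 1) p k = 2 * p (i + 1) - p k := by
    intro k hk; simp [reflect, hk]
  have r2 : ∀ k ≤ i + 1, reflect true (i + 1) p k = p k := by
    intro k hk
    rcases hk.eq_or_lt with rfl | hk
    · rw [r1 _ le_rfl]; ring
    · simp only [reflect, if_true]; rw [if_neg (by omega)]
  have gea : ∀ k ≤ n + 1, i + 1 ≤ k → p a ≤ reflect true (i + 1) p k := by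
    intro k hk hk'
    rw [r1 k hk']
    have := hI.le_last k hk
    linarith
  have memle' : ∀ b' ∈ U ++ [a, i + 1], b' ≤ i + 1 := by
    intro b' hb'
    rcases memle b' hb' with h | h <;> omega
  refine ⟨_, h', hf, hnd, ?_, fun b' hb' => hI.le b' (Imem b' hb'), ?_, by simp, ?_, ?_, ?_, ?_, ?_, ?_⟩
  · refine hI.sorted.sublist ?_
    exact List.Sublist.append_left (by simp) U
  · have := hI.head
    cases U <;> simpa using this
  · refine List.IsChain.imp_of_mem_imp (R := fun a b => p b - p a = z a + z b) ?_ ?_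
    · intro x y hx hy hxy
      rw [r2 x (memle' x hx), r2 y (memle' y hy), hxy]
    · rw [List.isChain_split]
      exact ⟨hg.1, by simpa using g1⟩
  · intro k hk
    rw [r2 F (by omega)]
    rcases le_total k (i + 1) with hk' | hk'
    · rw [r2 k hk']
      exact hI.first_le k hk
    · exact (hI.first_le a (by omega)).trans (gea k hk hk')
  · intro k hk
    rw [r2 _ le_rfl]
    rcases le_total k (i + 1) with hk' | hk'
    · rw [r2 k hk']
      exact bef k hk'
    · rw [r1 k hk']
      linarith [aft k hk hk']
  · intro b' hb' hne k hk
    have := memle' b' hb'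
    rw [r2 b' this, r2 k (by omega)]
    exact hI.before b' (Imem b' hb') hne k hk
  · intro b' hb' hne k hk hk'
    have hba := (memle b' hb').resolve_right hne
    have aft' := hI.after b' (Imem b' hb') (by omega)
    rw [r2 b' (by omega)]
    rcases le_total k (i + 1) with hk'' | hk''
    · rw [r2 k hk'']
      exact aft' k hk hk'
    · exact (aft' a (by omega) hba).trans (gea k hk hk'')
  · intro j hj hmem
    by_cases hji : j = i
    · subst hji; exact hdi
    · refine hd j hj hji (hI.done j hj fun hm => ?_)
      rcases memI _ hm with hm | hm
      · rcases hmem hm with h | h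
        · exact Or.inl h
        · omega
      · exact Or.inr hm

end FoldedState

end SimpleFolding

/-! ### Crimps as pairs of folds, and correctness of the scan for patterns -/

namespace SimpleFolding

namespace FoldedState

variable {n : ℕ} {z : ℕ → ℚ} {dir : ℕ → Direction} {p : ℕ → ℚ} {h : ℕ → ℤ} {F Z : ℕ}

/-- The first fold turns over everything after `b`, the second turns everything after `c` back, both
upwards or both downwards. In between the strip faces down at `c`, so the same sense of folding
produces the opposite direction. In effect the paper after `c` is translated to the left by twice
the length of the middle segment, and the two inequalities confine the folded part to the interval
from `a` to `d`. -/
theorem Strip.foldCrimp {a b c d : ℕ} {U V : List ℕ}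
    (hI : Strip n z dir p h F Z (U ++ a :: b :: c :: d :: V)) (hca : z c ≤ z a) (hbd : z b ≤ z d)
    (hdir : dir b ≠ dir c) :
    ∃ p' h', Relation.ReflTransGen SomeLayersFold (ofFun n p h) (ofFun n p' h') ∧
      Strip n z dir p' h' F Z (U ++ a :: d :: V) := by
  have hs := hI.sorted
  simp only [List.pairwise_append, List.pairwise_cons] at hs
  obtain ⟨sU, ⟨sa, sb, sc, sd, -⟩, sUa⟩ := hs
  have ab := sa b (by simp)
  have bc := sb c (by simp)
  have cd := sc d (by simp)
  have dn := hI.le d (by simp)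
  have memUa : ∀ b' ∈ U ++ [a], b' ≤ a := by
    intro b' hb'
    simp only [List.mem_append, List.mem_singleton] at hb'
    rcases hb' with hb' | rfl
    · exact (sUa b' hb' a (by simp)).le
    · exact le_rfl
  have memdV : ∀ b' ∈ d :: V, d ≤ b' := by
    intro b' hb'
    rcases List.mem_cons.1 hb' with rfl | hb'
    · exact le_rfl
    · exact (sd b' hb').le
  have mem' : ∀ b' ∈ U ++ a :: d :: V, b' ≤ a ∨ d ≤ b' := by
    intro b' hb'
    rw [List.append_cons, List.mem_append] at hb'
    exact hb'.imp (memUa b') (memdV b')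
  have memI : ∀ b', b' ∈ U ++ a :: b :: c :: d :: V ↔ b' ∈ U ++ a :: d :: V ∨ b' = b ∨ b' = c := by
    intro b'
    simp only [List.mem_append, List.mem_cons]
    tauto
  have hFa : F ≤ a := by
    refine memUa F (List.mem_of_head? ?_)
    have := hI.head
    cases U <;> simpa using this
  have hdZ : d ≤ Z := by
    refine memdV Z (List.mem_of_getLast? ?_)
    have := hI.last
    simpa using this
  obtain ⟨i, rfl⟩ : ∃ i, b = i + 1 := ⟨b - 1, by omega⟩
  obtain ⟨j, rfl⟩ : ∃ j, c = j + 1 := ⟨c - 1, by omega⟩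
  have hg := hI.gaps
  rw [List.isChain_split] at hg
  have hg' := hg.2
  simp only [List.isChain_cons_cons] at hg'
  obtain ⟨g1, g2, g3, g4⟩ := hg'
  have befb := hI.before (i + 1) (by simp) (by omega)
  have aftb := hI.after (i + 1) (by simp) (by omega)
  have befc := hI.before (j + 1) (by simp) (by omega)
  have aftc := hI.after (j + 1) (by simp) (by omega)
  have afta := fun h => hI.after a (by simp) h
  have aftd := fun h => hI.after d (by simp) h
  have befd := hI.before d (by simp) (by omega)
  obtain ⟨u, hu⟩ := exists_eq_valley_iff (dir (i + 1)) (p i < p (i + 1))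
  have st := hI.straight (i := i) (by omega) (by simp) (by omega) (by omega)
  have st' := hI.straight (i := j) (by omega) (by simp) (by omega) (by omega)
  obtain ⟨h₁, hf₁, sep₁, hd₁, hdi₁, hnd₁⟩ := exists_fold hI.nd true u (i := i) (by omega)
    (Or.inl fun k hk hk' => aftb k hk (by simpa using hk')) (by simp only [st.1, st.2])
    (fun s hs t ht h1 h2 h3 h4 => by
      simp only [if_true, not_le] at h1 h2
      exact absurd h3 (not_lt.2 ((max_le (befb _ (by omega)) (befb _ (by omega))).trans
        (le_min (aftb _ (by omega) (by omega)) (aftb _ (by omega) (by omega)))))) hu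
  set p₁ := reflect true (i + 1) p with hp₁
  have r1 : ∀ k, i + 1 ≤ k → p₁ k = 2 * p (i + 1) - p k := by
    intro k hk; simp [hp₁, reflect, hk]
  have r2 : ∀ k ≤ i + 1, p₁ k = p k := by
    intro k hk
    rcases hk.eq_or_lt with rfl | hk
    · rw [r1 _ le_rfl]; ring
    · simp only [hp₁, reflect, if_true]; rw [if_neg (by omega)]
  obtain ⟨h₂, hf₂, -, hd₂, hdj₂, hnd₂⟩ := exists_fold (dir := dir) hnd₁ true u (i := j) (by omega)
    (Or.inr fun k hk hk' => by
      simp only [if_true] at hk'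
      rw [r1 k (by omega), r1 (j + 1) (by omega)]
      linarith [aftc k hk hk'])
    (by
      rw [r1 (j + 1) (by omega), r1 (j + 2) (by omega), r1 j (by omega)]
      exact iff_of_false (not_lt.2 (by linarith [st'.1])) (not_lt.2 (by linarith [st'.2])))
    (fun s hs t ht h1 h2 h3 h4 => by
      simp only [if_true, not_le] at h1 h2
      -- Segments between `b` and `c` do not overlap the moved ones; segments before `b` are on the
      -- right side of them vertically since the first fold.
      by_cases htb : i + 1 ≤ t
      · refine absurd h4 (not_lt.2 ?_)
        rw [r1 s (by omega), r1 (s + 1) (by omega), r1 t (by omega), r1 (t + 1) (by omega)]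
        refine (max_le ?_ ?_).trans (le_min ?_ ?_ : 2 * p (i + 1) - p (j + 1) ≤ _)
        · linarith [aftc s (by omega) (by omega)]
        · linarith [aftc (s + 1) (by omega) (by omega)]
        · linarith [befc t (by omega)]
        · linarith [befc (t + 1) (by omega)]
      · refine sep₁ s hs t ht ?_ ?_
        · simp only [if_true]; omega
        · simpa using htb)
    (by
      rw [r1 (j + 1) (by omega), r1 j (by omega)]
      have e1 : ¬ (2 * p (i + 1) - p j < 2 * p (i + 1) - p (j + 1)) :=
        not_lt.2 (by linarith [st'.1])
      simp only [st.1, true_iff] at hu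
      simp only [e1, false_iff, ← hu]
      cases e2 : dir (i + 1) <;> cases e3 : dir (j + 1) <;> simp_all)
  set p₂ := reflect true (j + 1) p₁ with hp₂
  have e1 : ∀ k ≤ i + 1, p₂ k = p k := by
    intro k hk
    simp only [hp₂, reflect, if_true]
    rw [if_neg (by omega), r2 k hk]
  have e3 : ∀ k, j + 1 ≤ k → p₂ k = p k - 2 * (p (j + 1) - p (i + 1)) := by
    intro k hk
    simp only [hp₂, reflect, if_true, hk]
    rw [r1 k (by omega), r1 (j + 1) (by omega)]
    ring
  have e2 : ∀ k, i + 1 ≤ k → k ≤ j + 1 → p₂ k = 2 * p (i + 1) - p k := by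
    intro k hk hk'
    rcases hk'.eq_or_lt with rfl | hk'
    · rw [e3 _ le_rfl]; ring
    · simp only [hp₂, reflect, if_true]
      rw [if_neg (by omega), r1 k hk]
  have lb : ∀ k ≤ n + 1, i + 1 ≤ k → p a ≤ p₂ k := by
    intro k hk hk'
    rcases le_total k (j + 1) with h | h
    · rw [e2 k hk' h]
      linarith [befc k h]
    · rw [e3 k h]
      linarith [aftc k hk h]
  have ub : ∀ k ≤ j + 1, p₂ k ≤ p₂ d := by
    intro k hk
    rw [e3 d (by omega)]
    rcases le_total k (i + 1) with h | h
    · rw [e1 k h]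
      linarith [befb k h]
    · rw [e2 k h hk]
      linarith [aftb k (by omega) h]
  refine ⟨p₂, h₂, (Relation.ReflTransGen.single hf₁).tail hf₂, hnd₂, ?_,
    fun b' hb' => hI.le b' ((memI b').2 (Or.inl hb')), ?_, ?_, ?_, ?_, ?_, ?_, ?_, ?_⟩
  · refine hI.sorted.sublist (List.Sublist.append_left ?_ U)
    exact ((List.sublist_cons_self _ _).trans (List.sublist_cons_self _ _)).cons_cons a
  · have := hI.head
    cases U <;> simpa using this
  · have := hI.last
    simpa using this
  · rw [List.isChain_split, List.isChain_cons_cons]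
    refine ⟨?_, ?_, ?_⟩
    · refine List.IsChain.imp_of_mem_imp ?_ hg.1
      intro x y hx hy hxy
      have := memUa x hx
      have := memUa y hy
      rw [e1 x (by omega), e1 y (by omega), hxy]
    · rw [e3 d (by omega), e1 a (by omega)]
      linarith
    · refine List.IsChain.imp_of_mem_imp ?_ g4
      intro x y hx hy hxy
      have := memdV x hx
      have := memdV y hy
      rw [e3 x (by omega), e3 y (by omega), ← hxy]
      ring
  · intro k hk
    rw [e1 F (by omega)]
    rcases le_total k (i + 1) with h | h
    · rw [e1 k h]
      exact hI.first_le k hk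
    · exact (hI.first_le a (by omega)).trans (lb k hk h)
  · intro k hk
    rcases le_total k (j + 1) with h | h
    · refine (ub k h).trans ?_
      rw [e3 d (by omega), e3 Z (by omega)]
      linarith [hI.le_last d (by omega)]
    · rw [e3 k h, e3 Z (by omega)]
      linarith [hI.le_last k hk]
  · intro b' hb' hne k hk
    have bef' := hI.before b' ((memI b').2 (Or.inl hb')) hne
    rcases mem' b' hb' with hb | hb
    · rw [e1 b' (by omega), e1 k (by omega)]
      exact bef' k hk
    · rcases le_total k (j + 1) with h | h
      · refine (ub k h).trans ?_
        rw [e3 d (by omega), e3 b' (by omega)]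
        linarith [bef' d hb]
      · rw [e3 k h, e3 b' (by omega)]
        linarith [bef' k hk]
  · intro b' hb' hne k hk hk'
    have aft' := hI.after b' ((memI b').2 (Or.inl hb')) hne
    rcases mem' b' hb' with hb | hb
    · rw [e1 b' (by omega)]
      rcases le_total k (i + 1) with h | h
      · rw [e1 k h]
        exact aft' k hk hk'
      · exact (aft' a (by omega) hb).trans (lb k hk h)
    · rw [e3 b' (by omega), e3 k (by omega)]
      linarith [aft' k hk hk']
  · intro m hm hmem
    by_cases hmj : m = j
    · subst hmj; exact hdj₂
    refine hd₂ m hm hmj ?_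
    by_cases hmi : m = i
    · subst hmi; exact hdi₁
    refine hd₁ m hm hmi (hI.done m hm fun h => ?_)
    rcases (memI _).1 h with h | h | h
    · exact hmem h
    · omega
    · omega

/-- A reducible strip can be folded completely. -/
theorem Strip.foldAll {L : Word} (hL : Reducible L) : ∀ (I : List ℕ) (p : ℕ → ℚ) (h : ℕ → ℤ) (F Z : ℕ),
    I.map (fun k => (z k, dir k)) = L → Strip n z dir p h F Z I →
    ∃ p' h', Relation.ReflTransGen SomeLayersFold (ofFun n p h) (ofFun n p' h') ∧
      ∀ j < n, Done dir p' h' j := by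
  induction hL with
  | pair a b =>
    intro I p h F Z hL hI
    simp only [List.map_eq_cons_iff, List.map_eq_nil_iff] at hL
    obtain ⟨a, _, rfl, rfl, b, _, rfl, rfl, rfl⟩ := hL
    -- A strip of two vertices has no inner crease left to fold.
    refine ⟨p, h, .refl, fun j hj => hI.done j hj fun hm => ?_⟩
    have h1 := hI.head
    have h2 := hI.last
    simp only [List.head?_cons, Option.some.injEq, List.getLast?_cons_cons, List.getLast?_singleton,
      List.mem_cons, List.not_mem_nil, or_false] at h1 h2 hm
    omega
  | left hac _ ih =>
    intro I p h F Z hL hI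
    simp only [List.map_eq_cons_iff] at hL
    obtain ⟨a, _, rfl, rfl, b, _, rfl, rfl, c, V, rfl, rfl, rfl⟩ := hL
    obtain ⟨p₁, h₁, hf, hI'⟩ := hI.foldLeft hac
    obtain ⟨p₂, h₂, hf', hd⟩ := ih _ _ _ _ _ rfl hI'
    exact ⟨p₂, h₂, hf'.head hf, hd⟩
  | right hca _ ih =>
    intro I p h F Z hL hI
    simp only [List.map_eq_append_iff, List.map_eq_cons_iff, List.map_eq_nil_iff] at hL
    obtain ⟨U, _, rfl, rfl, a, _, rfl, rfl, b, _, rfl, rfl, c, _, rfl, rfl, rfl⟩ := hL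
    obtain ⟨p₁, h₁, hf, hI'⟩ := hI.foldRight hca
    obtain ⟨p₂, h₂, hf', hd⟩ := ih _ _ _ _ _ (by simp) hI'
    exact ⟨p₂, h₂, hf'.head hf, hd⟩
  | crimp hc _ ih =>
    intro I p h F Z hL hI
    obtain ⟨pre, a, b, c, d, post, hca, hbd, hbc⟩ := hc
    simp only [List.map_eq_append_iff, List.map_eq_cons_iff] at hL
    obtain ⟨U, _, rfl, rfl, a, _, rfl, rfl, b, _, rfl, rfl, c, _, rfl, rfl, d, V, rfl, rfl, rfl⟩ := hL
    obtain ⟨p₁, h₁, hf, hI'⟩ := hI.foldCrimp hca hbd hbc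
    obtain ⟨p₂, h₂, hf', hd⟩ := ih _ _ _ _ _ (by simp) hI'
    exact ⟨p₂, h₂, hf.trans hf', hd⟩

end FoldedState

namespace MixedPattern

open FoldedState

/-- The unfolded paper is a strip that contains all vertices, so `Strip.foldAll` applies from the
start. -/
theorem foldable_of_mixedReducible (P : MixedPattern) (hP : MixedReducible P.word) :
    P.FlatFoldableSomeLayers := by
  obtain ⟨L, hA, hR⟩ := hP
  rw [Agrees, List.forall₂_iff_get] at hA
  obtain ⟨hlen, hA⟩ := hA
  have hlen' : P.word.length = P.numCreases + 2 := by simp [word]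
  have hmap : (List.range (P.numCreases + 2)).map (fun k => (P.zigzag k, L.dir k)) = L := by
    refine List.ext_getElem (by simp [hlen, hlen']) fun k h1 h2 => ?_
    have := (hA k h2 (by omega)).1
    simp only [List.get_eq_getElem, word, List.getElem_ofFn] at this
    simp only [List.getElem_map, List.getElem_range, Word.dir]
    rw [← this, List.getD_eq_getElem _ _ h2]
  have mono : ∀ k ≤ P.numCreases + 1, ∀ l ≤ k, P.coord l ≤ P.coord k := by
    intro k hk l hl
    unfold coord
    rw [dif_pos (by omega), dif_pos (by omega)]
    exact P.vertex_strictMono.monotone hl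
  have hunf : P.unfolded = ofFun P.numCreases P.coord (fun _ => 0) := by
    ext k
    · simp [unfolded, ofFun, coord]
    · rfl
  have strip : Strip P.numCreases P.zigzag L.dir P.coord (fun _ => 0) 0 (P.numCreases + 1)
      (List.range (P.numCreases + 2)) := by
    refine ⟨?_, List.pairwise_lt_range, ?_, ?_, ?_, ?_, fun k hk => mono k hk 0 (by omega),
      fun k hk => mono _ le_rfl k hk, fun b hb _ k hk => mono b ?_ k hk, fun b _ _ k hk hb => mono k hk b hb, ?_⟩
    · intro s hs
      have := P.vertex_strictMono (Fin.castSucc_lt_succ (i := ⟨s, by omega⟩))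
      rw [← coord_castSucc, ← coord_succ] at this
      exact this.ne
    · intro b hb
      have := List.mem_range.1 hb
      omega
    · rw [List.range_succ_eq_map]; rfl
    · rw [List.range_succ]; simp
    · rw [List.isChain_iff_getElem]
      intro i hi
      simp only [List.getElem_range, zigzag]
      ring
    · have := List.mem_range.1 hb
      omega
    · intro j hj hm
      have := hm (List.mem_range.2 (by omega))
      omega
  obtain ⟨p, h, hf, hd⟩ := Strip.foldAll hR _ _ _ _ _ hmap strip
  rw [← hunf] at hf
  refine ⟨_, hf, fun j => ?_⟩
  obtain ⟨d1, d2, d3⟩ := hd j j.2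
  refine ⟨d1, fun d hd => ?_⟩
  have hal : L.dir (j + 1) = d := by
    have h1 : (j : ℕ) + 1 < L.length := by omega
    have := (hA (j + 1) h1 (by omega)).2
    simp only [List.get_eq_getElem, word, List.getElem_ofFn] at this
    rw [Word.dir, List.getD_eq_getElem _ _ h1]
    refine this d ?_
    have e := P.letter_succ j
    rw [hd] at e
    exact e
  rw [← hal]
  classical
  unfold direction
  have e : ((ofFun P.numCreases p h).FaceUp j.castSucc ↔
      (ofFun P.numCreases p h).height j.castSucc < (ofFun P.numCreases p h).height j.succ) ↔
      (p j < p (j + 1) ↔ h j < h (j + 1)) := Iff.rfl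
  rw [← e] at d3
  split_ifs with hc
  · exact (d3.2 hc).symm
  · cases hx : L.dir (j + 1) with
    | mountain => rfl
    | valley => exact absurd (d3.1 hx) hc

/-- The algorithm decides foldability, for any order-preserving representation of the numbers. -/
theorem scan_iff (P : MixedPattern) {α : Type*} [LinearOrder α] {key : α → ℚ} (hkey : StrictMono key)
    {v y : α} {c cy : Letter} {ys : List (α × Letter)}
    (h : ((v, c) :: (y, cy) :: ys).map (fun e => (key e.1, e.2)) = P.word) :
    scan [] v c ((y, cy) :: ys) = true ↔ P.FlatFoldableSomeLayers := by
  obtain ⟨h1, h2⟩ := scan_spec hkey ((y, cy) :: ys) [] v c trivial (Or.inr (by simp))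
  have e : wordOf key [] ((key v, c) :: ((y, cy) :: ys).map fun e => (key e.1, e.2)) = P.word := by
    rw [← h]; rfl
  rw [e] at h1 h2
  -- Accepted words are reducible, reducible words come from foldable patterns, foldable patterns
  -- have flat words, and flat words are accepted.
  exact ⟨fun h => P.foldable_of_mixedReducible (h2 h), fun h => h1 (P.mixedFlat_of_foldable h)⟩

end MixedPattern

end SimpleFolding

namespace SimpleFolding

/-! ### Subroutines on stacks -/

/-- The stacks of the machine. -/
inductive Reg
  | inp | scale | base | num | table | digits | digits' | acc | copy | tmp | tmp' | flag | letter
  | input | stack | val | lab | newVal | newLab | low | high | parity | out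
  deriving DecidableEq

instance : Fintype Reg where
  elems := {.inp, .scale, .base, .num, .table, .digits, .digits', .acc, .copy, .tmp, .tmp', .flag, .letter,
    .input, .stack, .val, .lab, .newVal, .newLab, .low, .high, .parity, .out}
  complete x := by cases x <;> decide

instance : Fintype Letter where
  elems := {.paperEnd, .unassigned, .assigned .mountain, .assigned .valley, .minus, .slash, .bit false, .bit true}
  complete x := by
    cases x with
    | assigned d => cases d <;> decide
    | bit b => cases b <;> decide
    | _ => decide

namespace Prog

theorem Run.of_eq {K Γ : Type} [DecidableEq K] {p : Prog K Γ} {s s' s'' : K → List Γ} {t : ℕ}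
    (h : Run p s s' t) (e : s' = s'') : Run p s s'' t := e ▸ h

/-- Whether the symbol is a bit. -/
def isBit : Option Letter → Bool
  | some (.bit _) => true
  | _ => false

/-- Pop a symbol and use it, if there is one. -/
def popSome {K Γ : Type} (k : K) (f : Γ → Prog K Γ) : Prog K Γ := .pop k fun o => o.elim .skip f

section

variable {K : Type} [DecidableEq K] {Γ : Type}

theorem run_popSome {k : K} {f : Γ → Prog K Γ} {s s' : K → List Γ} {t : ℕ} {a : Γ} {l : List Γ}
    (hs : s k = a :: l) (h : Run (f a) (Function.update s k l) s' t) : Run (popSome k f) s s' t := by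
  refine run_pop ?_
  rw [hs]
  exact h

/-- Move symbols from one stack to another one while they satisfy a condition. -/
def move (c : Option Γ → Bool) (a b : K) : Prog K Γ := .loop a c (popSome a fun x => .push b x)

theorem run_move {c : Option Γ → Bool} {a b : K} (hab : a ≠ b) (l : List Γ) :
    ∀ (s : K → List Γ) (r : List Γ), s a = l ++ r → (∀ x ∈ l, c (some x) = true) →
    c r.head? = false →
    Run (move c a b) s (Function.update (Function.update s a r) b (l.reverse ++ s b)) (l.length + 1) := by
  induction l with
  | nil =>
    intro s r hs _ hr
    refine (run_loop_done (by rw [hs]; exact hr) (by simp)).of_eq ?_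
    rw [← List.nil_append r, ← hs]
    simp
  | cons x l ih =>
    intro s r hs hl hr
    refine run_loop_step (t₁ := 0) (by rw [hs]; exact hl x (by simp))
      (run_popSome hs (run_push _ _ _ _)) ((ih _ r ?_ (fun y hy => hl y (by simp [hy])) hr).of_eq ?_)
      (by simp)
    · simp [Function.update_of_ne hab]
    · funext k
      simp only [Function.update_apply]
      split_ifs <;> simp_all

/-- Move symbols from one stack to two other ones. -/
def moveBoth (a b b' : K) : Prog K Γ :=
  .loop a Option.isSome (popSome a fun x => .push b x ;; .push b' x)

theorem run_moveBoth {a b b' : K} (hab : a ≠ b) (hab' : a ≠ b') (hbb : b ≠ b') (l : List Γ) :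
    ∀ (s : K → List Γ), s a = l →
    Run (moveBoth a b b') s (Function.update (Function.update (Function.update s a []) b
      (l.reverse ++ s b)) b' (l.reverse ++ s b')) (l.length + 1) := by
  induction l with
  | nil =>
    intro s hs
    refine (run_loop_done (by rw [hs]; rfl) (by simp)).of_eq ?_
    funext k
    simp only [Function.update_apply]
    split_ifs <;> simp_all
  | cons x l ih =>
    intro s hs
    refine run_loop_step (t₁ := 0) (by rw [hs]; rfl)
      (run_popSome hs ((run_push _ _ _ 0).seq (run_push _ _ _ 0))) ((ih _ ?_).of_eq ?_) (by simp)
    · simp [Function.update_of_ne hab, Function.update_of_ne hab']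
    · funext k
      simp only [Function.update_apply]
      split_ifs <;> simp_all

/-- Remove symbols while they satisfy a condition. -/
def drop (c : Option Γ → Bool) (a : K) : Prog K Γ := .loop a c (.pop a fun _ => .skip)

theorem run_drop {c : Option Γ → Bool} {a : K} (l : List Γ) :
    ∀ (s : K → List Γ) (r : List Γ), s a = l ++ r → (∀ x ∈ l, c (some x) = true) →
    c r.head? = false → Run (drop c a) s (Function.update s a r) (l.length + 1) := by
  induction l with
  | nil =>
    intro s r hs _ hr
    refine (run_loop_done (by rw [hs]; exact hr) (by simp)).of_eq ?_
    rw [← List.nil_append r, ← hs]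
    simp
  | cons x l ih =>
    intro s r hs hl hr
    refine run_loop_step (t₁ := 0) (by rw [hs]; exact hl x (by simp))
      (run_pop (run_skip _ _)) ((ih _ r ?_ (fun y hy => hl y (by simp [hy])) hr).of_eq ?_) (by simp)
    · simp [hs]
    · simp

/-- Empty a stack. -/
def clear (a : K) : Prog K Γ := drop Option.isSome a

theorem run_clear (a : K) (s : K → List Γ) :
    Run (clear a) s (Function.update s a []) ((s a).length + 1) :=
  run_drop (s a) s [] (by simp) (by simp) rfl

/-- Empty several stacks. -/
def clearAll : List K → Prog K Γ
  | [] => .skip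
  | a :: l => clear a ;; clearAll l

theorem run_clearAll (l : List K) : ∀ (s : K → List Γ) (M : ℕ), (∀ a ∈ l, (s a).length ≤ M) →
    Run (clearAll l) s (fun a => if a ∈ l then [] else s a) (l.length * (M + 1)) := by
  induction l with
  | nil => exact fun s M _ => (run_skip _ _).of_eq (by simp)
  | cons a l ih =>
    intro s M hM
    refine ((run_clear a s).seq_le ((ih _ M ?_).of_eq ?_) (t := _) ?_)
    · intro b hb
      rw [Function.update_apply]
      split_ifs
      · simp
      · exact hM b (by simp [hb])
    · funext b
      simp only [Function.update_apply, List.mem_cons]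
      split_ifs <;> simp_all
    · have := hM a (by simp)
      simp only [List.length_cons]
      nlinarith

end

/-- Copy a stack to the top of another one. -/
def copyTo (a b : Reg) : Prog Reg Letter := move Option.isSome a .tmp ;; moveBoth .tmp a b

/-- Moving to `tmp` reverses the order, and moving back to both stacks restores it. -/
theorem run_copyTo {a b : Reg} (ha : a ≠ .tmp) (hb : b ≠ .tmp) (hab : a ≠ b) (s : Reg → List Letter)
    (ht : s .tmp = []) :
    Run (copyTo a b) s (Function.update s b (s a ++ s b)) (2 * (s a).length + 2) := by
  refine (run_move ha (s a) s [] (by simp) (by simp) rfl).seq_le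
    ((run_moveBoth ha.symm hb.symm hab _ _ rfl).of_eq ?_) (by simp [ht]; omega)
  funext k
  simp only [Function.update_apply]
  split_ifs <;> simp_all

/-! ### Addition -/

/-- Add (or subtract) two sequences of blocks of bits, with the given carry in the first block. -/
def addBits (neg : Bool) : Bool → List Letter → List Letter → List Letter
  | c, .bit x :: d, .bit y :: l =>
    .bit (x ^^ (y ^^ neg) ^^ c) :: addBits neg ((x && (y ^^ neg)) || (c && (x ^^ (y ^^ neg)))) d l
  | _, _ :: d, a :: l => a :: addBits neg neg d l
  | _, [], _ => []
  | _, _, [] => []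

/-- The reaction of the adder to its two inputs and the carry. -/
def addStep (neg : Bool) : Letter → Letter → Letter → Prog Reg Letter
  | .bit x, .bit y, .bit c =>
    .push .tmp (.bit (x ^^ (y ^^ neg) ^^ c)) ;; .push .tmp' (.bit y) ;;
      .push .flag (.bit ((x && (y ^^ neg)) || (c && (x ^^ (y ^^ neg)))))
  | _, a, _ => .push .tmp a ;; .push .tmp' a ;; .push .flag (.bit neg)

/-- Add the stack `l` to the stack `d` (or subtract it). -/
def addTo (neg : Bool) (d l : Reg) : Prog Reg Letter :=
  .push .flag (.bit neg) ;;
  .loop l Option.isSome (popSome l fun y => popSome d fun x => popSome .flag fun c =>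
    addStep neg x y c) ;;
  move Option.isSome .tmp d ;; move Option.isSome .tmp' l ;; clear .flag

/-- Both operands are consumed from their low ends. The sum and the second operand pile up in
reverse on `tmp` and `tmp'`, and `flag` holds the carry. -/
theorem run_addLoop (neg : Bool) {d l : Reg} (hdl : d ≠ l) (hd1 : d ≠ .tmp) (hd2 : d ≠ .tmp')
    (hd3 : d ≠ .flag) (hl1 : l ≠ .tmp) (hl2 : l ≠ .tmp') (hl3 : l ≠ .flag) (L : List Letter) :
    ∀ (D : List Letter) (c : Bool) (s : Reg → List Letter), D.length = L.length → s d = D → s l = L →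
    s .flag = [.bit c] → ∃ c' : Bool,
    Run (.loop l Option.isSome (popSome l fun y => popSome d fun x => popSome .flag fun c =>
      addStep neg x y c)) s
      (Function.update (Function.update (Function.update (Function.update (Function.update s d []) l [])
        .tmp ((addBits neg c D L).reverse ++ s .tmp)) .tmp' (L.reverse ++ s .tmp')) .flag [.bit c'])
      (L.length + 1) := by
  induction L with
  | nil =>
    intro D c s hD hd hl hf
    obtain rfl : D = [] := List.length_eq_zero_iff.1 hD
    refine ⟨c, (run_loop_done (by rw [hl]; rfl) (by simp)).of_eq ?_⟩
    funext k
    simp only [Function.update_apply]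
    split_ifs <;> simp_all [addBits]
  | cons y L ih =>
    intro D c s hD hd hl hf
    obtain ⟨x, D, rfl⟩ : ∃ x D', D = x :: D' := by
      cases D with
      | nil => simp at hD
      | cons x D => exact ⟨x, D, rfl⟩
    have hD' : D.length = L.length := by simpa using hD
    obtain ⟨o, e, h1, h2⟩ : ∃ (o : Letter) (e : Bool), addBits neg c (x :: D) (y :: L) = o :: addBits neg e D L ∧
        addStep neg x y (.bit c) = .push .tmp o ;; .push .tmp' y ;; .push .flag (.bit e) := by
      cases x <;> cases y <;> exact ⟨_, _, rfl, rfl⟩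
    have step : Run (popSome l fun y => popSome d fun x => popSome .flag fun c => addStep neg x y c) s
        (Function.update (Function.update (Function.update (Function.update (Function.update s d D) l L)
        .tmp (o :: s .tmp)) .tmp' (y :: s .tmp')) .flag [.bit e]) 0 := by
      refine run_popSome hl (run_popSome (a := x) (l := D) ?_ (run_popSome (a := .bit c) (l := []) ?_ ?_))
      · rw [Function.update_of_ne hdl, hd]
      · rw [Function.update_of_ne hd3.symm, Function.update_of_ne hl3.symm, hf]
      · rw [h2]
        refine ((run_push _ _ _ 0).seq ((run_push _ _ _ 0).seq (run_push _ _ _ 0))).of_eq ?_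
        funext k
        simp only [Function.update_apply]
        split_ifs <;> simp_all
    generalize hs₁ : Function.update (Function.update (Function.update (Function.update (Function.update
      s d D) l L) .tmp (o :: s .tmp)) .tmp' (y :: s .tmp')) .flag [.bit e] = s₁ at step
    obtain ⟨c', hr⟩ := ih D e s₁ hD' (by simp [← hs₁, Function.update_apply, hd1, hd2, hd3, hdl])
      (by simp [← hs₁, Function.update_apply, hl1, hl2, hl3]) (by simp [← hs₁])
    refine ⟨c', run_loop_step (by rw [hl]; rfl) step (hr.of_eq ?_) (by simp)⟩
    funext k
    simp only [← hs₁, Function.update_apply]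
    split_ifs <;> simp_all

theorem length_addBits (neg : Bool) (L : List Letter) : ∀ (c : Bool) (D : List Letter), D.length = L.length →
    (addBits neg c D L).length = L.length := by
  induction L with
  | nil =>
    intro c D h
    obtain rfl : D = [] := List.length_eq_zero_iff.1 h
    rfl
  | cons y L ih =>
    intro c D h
    cases D with
    | nil => simp at h
    | cons x D =>
      have h' : D.length = L.length := by simpa using h
      cases x <;> cases y <;> simp [addBits, ih _ D h']

theorem run_addTo (neg : Bool) {d l : Reg} (hdl : d ≠ l) (hd1 : d ≠ .tmp) (hd2 : d ≠ .tmp')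
    (hd3 : d ≠ .flag) (hl1 : l ≠ .tmp) (hl2 : l ≠ .tmp') (hl3 : l ≠ .flag) (s : Reg → List Letter)
    (ht : s .tmp = []) (ht' : s .tmp' = []) (hf : s .flag = []) (hlen : (s d).length = (s l).length) :
    Run (addTo neg d l) s (Function.update s d (addBits neg neg (s d) (s l))) (3 * (s l).length + 5) := by
  obtain ⟨c', hr⟩ := run_addLoop neg hdl hd1 hd2 hd3 hl1 hl2 hl3 (s l) (s d) neg
    (Function.update s .flag [.bit neg]) hlen (by rw [Function.update_of_ne hd3])
    (by rw [Function.update_of_ne hl3]) (by simp)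
  have h0 := run_push Reg.flag (Letter.bit neg) s 0
  rw [hf] at h0
  refine h0.seq_le (hr.seq ((run_move hd1.symm (addBits neg neg (s d) (s l)).reverse _ [] ?_
    (fun _ _ => rfl) rfl).seq ((run_move hl2.symm (s l).reverse _ [] ?_ (fun _ _ => rfl) rfl).seq
    ((run_drop [.bit c'] _ [] ?_ (fun _ _ => rfl) rfl).of_eq ?_)))) ?_
  · simp [ht]
  · simp [Function.update_apply, ht', hd2.symm]
  · simp [Function.update_apply, hd3.symm, hl3.symm]
  · funext k
    simp only [Function.update_apply]
    split_ifs <;> simp_all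
  · simp [length_addBits neg _ _ _ hlen]
    omega

end Prog

end SimpleFolding

namespace SimpleFolding

/-! ### Binary numbers -/

/-- The `W` lowest bits of `n`, starting with the lowest one. -/
def bits : ℕ → ℤ → List Letter
  | 0, _ => []
  | W + 1, n => .bit (decide (n % 2 = 1)) :: bits W (n / 2)

@[simp] theorem length_bits (W : ℕ) (n : ℤ) : (bits W n).length = W := by
  induction W generalizing n with
  | zero => rfl
  | succ W ih => simp [bits, ih]

theorem isBit_of_mem_bits {W : ℕ} {n : ℤ} : ∀ x ∈ bits W n, Prog.isBit (some x) = true := by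
  induction W generalizing n with
  | zero => simp [bits]
  | succ W ih =>
    intro x hx
    rcases List.mem_cons.1 hx with rfl | hx
    · rfl
    · exact ih x hx

namespace Prog

/-- Subtraction is addition of the complement with initial carry one, so `neg` both inverts the
second operand and serves as the first carry. Only `W` bits are kept, so the sum is correct modulo
`2 ^ W`; the last carry `c'` is left over for what follows the block. -/
theorem addBits_bits (neg : Bool) (W : ℕ) : ∀ (m n : ℤ) (c : Bool), ∃ c', ∀ r r',
    addBits neg c (bits W m ++ r) (bits W n ++ r') =
      bits W (m + (if neg then - n - 1 else n) + c.toNat) ++ addBits neg c' r r' := by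
  induction W with
  | zero => exact fun m n c => ⟨c, fun r r' => rfl⟩
  | succ W ih =>
    intro m n c
    obtain ⟨c', h⟩ := ih (m / 2) (n / 2) ((decide (m % 2 = 1) && (decide (n % 2 = 1) ^^ neg)) ||
      (c && (decide (m % 2 = 1) ^^ (decide (n % 2 = 1) ^^ neg))))
    refine ⟨c', fun r r' => ?_⟩
    simp only [bits, List.cons_append, addBits, h]
    rcases Int.emod_two_eq_zero_or_one m with hm | hm <;>
    rcases Int.emod_two_eq_zero_or_one n with hn | hn <;>
    cases c <;> cases neg <;>
    (simp only [hm, hn]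
     congr 1
     · congr 1
       simp
       omega
     · congr 2
       simp
       omega)

/-- The sequence of the given blocks, each one followed by its letter. -/
def blocks (W : ℕ) (V : List (ℤ × Letter)) : List Letter := V.flatMap fun e => bits W e.1 ++ [e.2]

/-- Encodings of the multiples of some object, on which the adder works correctly. -/
structure Additive (F : ℤ → List Letter) : Prop where
  add : ∀ neg i j, addBits neg neg (F i) (F j) = F (i + if neg then - j else j)
  length : ∀ i j, (F i).length = (F j).length

theorem additive_bits (W : ℕ) (n : ℤ) : Additive fun k => bits W (k * n) where
  add neg i j := by
    obtain ⟨c', h⟩ := addBits_bits neg W (i * n) (j * n) neg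
    have := h [] []
    simp only [List.append_nil] at this
    have e : addBits neg c' [] [] = [] := by simp [addBits]
    rw [this, e, List.append_nil]
    congr 1
    cases neg <;> simp <;> ring
  length i j := by simp

/-- The letter after a block resets the carry to `neg`, so a single pass of the adder handles all
numbers of a table. -/
theorem additive_blocks (W : ℕ) (V : List (ℤ × Letter)) (hV : ∀ e ∈ V, isBit (some e.2) = false) :
    Additive fun k => blocks W (V.map fun e => (k * e.1, e.2)) where
  add neg i j := by
    induction V with
    | nil => simp [blocks, addBits]
    | cons e V ih =>
      obtain ⟨n, l⟩ := e
      obtain ⟨c', h⟩ := addBits_bits neg W (i * n) (j * n) neg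
      have hl : isBit (some l) = false := hV (n, l) (by simp)
      have ih := ih fun e he => hV e (by simp [he])
      simp only [blocks, List.map_cons, List.flatMap_cons, List.append_assoc, List.singleton_append] at ih ⊢
      rw [h]
      have e : ∀ r r', addBits neg c' (l :: r) (l :: r') = l :: addBits neg neg r r' := by
        intro r r'
        cases l <;> first | rfl | simp [isBit] at hl
      rw [e, ih]
      congr 2
      cases neg <;> simp <;> ring
  length i j := by simp [blocks, List.length_flatMap, Function.comp_def]

/-! ### Multiplication -/

/-- The number with the given binary digits, the highest one first, appended to those of `k`. -/
def ofDigits (k : ℤ) (ds : List Bool) : ℤ := ds.foldl (fun a b => 2 * a + b.toNat) k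

theorem ofDigits_append_nat (ds ds' : List Bool) (k : ℤ) : ofDigits k (ds ++ ds') = ofDigits (ofDigits k ds) ds' :=
  List.foldl_append

theorem ofDigits_encodePosNum (m : PosNum) : ofDigits 0 (Computability.encodePosNum m).reverse = m := by
  induction m with
  | one => rfl
  | bit1 m ih =>
    rw [Computability.encodePosNum, List.reverse_cons, ofDigits_append_nat, ih]
    simp [ofDigits, PosNum.cast_bit1]
    ring
  | bit0 m ih =>
    rw [Computability.encodePosNum, List.reverse_cons, ofDigits_append_nat, ih]
    simp [ofDigits, PosNum.cast_bit0]
    ring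

theorem ofDigits_encodeNat (n : ℕ) : ofDigits 0 (Computability.encodeNat n).reverse = n := by
  unfold Computability.encodeNat
  have : ((n : Num) : ℕ) = n := Num.to_of_nat n
  generalize (n : Num) = m at this
  subst this
  cases m with
  | zero => rfl
  | pos m =>
    rw [Computability.encodeNum, ofDigits_encodePosNum]
    simp

/-- One step of the multiplication: double, and add the original number if the digit is `1`. -/
def scaleStep (neg : Bool) (a : Reg) (d : Letter) : Prog Reg Letter :=
  .push .digits' d ;; copyTo a .acc ;; addTo false a .acc ;; clear .acc ;;
    if d = .bit true then addTo neg a .copy else .skip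

/-- Multiply the stack by the number with the given digits, the highest one on top. -/
def scaleBy (neg : Bool) (a : Reg) : Prog Reg Letter :=
  copyTo a .copy ;; addTo true a .copy ;;
  .loop .digits Option.isSome (popSome .digits (scaleStep neg a)) ;;
  clear .copy ;; move Option.isSome .digits' .digits

/-- The auxiliary stacks of the arithmetic are empty. -/
structure Idle (s : Reg → List Letter) : Prop where
  tmp : s .tmp = []
  tmp' : s .tmp' = []
  flag : s .flag = []
  acc : s .acc = []
  copy : s .copy = []
  digits' : s .digits' = []

/-- The stacks that hold numbers. -/
def IsNumber (a : Reg) : Prop := a = .scale ∨ a = .base ∨ a = .num ∨ a = .table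

theorem run_scaleStep {F : ℤ → List Letter} (hF : Additive F) (neg : Bool) {a : Reg} (ha : IsNumber a)
    (b : Bool) (k : ℤ) (s : Reg → List Letter) (hs : s a = F k)
    (hc : s .copy = F 1) (h1 : s .tmp = []) (h2 : s .tmp' = []) (h3 : s .flag = []) (h4 : s .acc = []) :
    Run (scaleStep neg a (.bit b)) s (Function.update (Function.update s a
      (F (2 * k + if neg then - (b.toNat : ℤ) else (b.toNat : ℤ)))) .digits' (.bit b :: s .digits'))
      (9 * (F 0).length + 13) := by
  have l : ∀ i, (F i).length = (F 0).length := fun i => hF.length i 0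
  have ne : a ≠ .tmp ∧ a ≠ .tmp' ∧ a ≠ .flag ∧ a ≠ .acc ∧ a ≠ .copy ∧ a ≠ .digits' := by
    rcases ha with rfl | rfl | rfl | rfl <;> decide
  obtain ⟨n1, n2, n3, n4, n5, n6⟩ := ne
  have r1 := run_push Reg.digits' (Letter.bit b) s 0
  generalize hs1 : Function.update s Reg.digits' (.bit b :: s .digits') = s1 at r1
  have r2 := run_copyTo n1 (by decide : Reg.acc ≠ .tmp) n4 s1 (by simp [← hs1, h1])
  generalize hs2 : Function.update s1 Reg.acc _ = s2 at r2
  have r3 := run_addTo false n4 n1 n2 n3 (by decide : Reg.acc ≠ .tmp) (by decide : Reg.acc ≠ .tmp')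
    (by decide : Reg.acc ≠ .flag) s2 (by simp [← hs2, ← hs1, h1]) (by simp [← hs2, ← hs1, h2])
    (by simp [← hs2, ← hs1, h3]) (by simp [← hs2, ← hs1, h4, n4, n6])
  generalize hs3 : Function.update s2 a _ = s3 at r3
  have r4 := run_clear Reg.acc s3
  generalize hs4 : Function.update s3 Reg.acc _ = s4 at r4
  have e1 : s1 a = F k := by simp [← hs1, n6, hs]
  have e2 : s2 .acc = F k := by simp [← hs2, e1]; simp [← hs1, h4]
  have e2' : s2 a = F k := by simp [← hs2, n4, e1]
  have e3 : s3 a = F (2 * k) := by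
    rw [← hs3, Function.update_self, e2, e2', hF.add]
    simp [two_mul]
  have e3' : s3 .acc = F k := by simp [← hs3, n4.symm, e2]
  have e4 : s4 a = F (2 * k) := by simp [← hs4, n4, e3]
  have e4' : s4 .copy = F 1 := by simp [← hs4, ← hs3, ← hs2, ← hs1, n5.symm, hc]
  have fin : ∀ v, Function.update s4 a v = Function.update (Function.update s a v) .digits'
      (.bit b :: s .digits') := by
    intro v
    funext r
    simp only [← hs4, ← hs3, ← hs2, ← hs1, Function.update_apply]
    split_ifs <;> simp_all
  refine r1.seq_le (r2.seq (r3.seq (r4.seq (t₂ := 3 * (F 0).length + 5) ?_))) ?_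
  · cases b with
    | false =>
      rw [if_neg (by simp)]
      refine (run_skip _ _).of_eq ?_
      rw [← fin, show F (2 * k + if neg then -((false.toNat : ℕ) : ℤ) else ((false.toNat : ℕ) : ℤ)) = s4 a by
        rw [e4]; simp, Function.update_eq_self]
    | true =>
      rw [if_pos rfl]
      have r5 := run_addTo neg n5 n1 n2 n3 (by decide : Reg.copy ≠ .tmp) (by decide : Reg.copy ≠ .tmp')
        (by decide : Reg.copy ≠ .flag) s4 (by simp [← hs4, ← hs3, ← hs2, ← hs1, h1, n1.symm])
        (by simp [← hs4, ← hs3, ← hs2, ← hs1, h2, n2.symm])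
        (by simp [← hs4, ← hs3, ← hs2, ← hs1, h3, n3.symm]) (by rw [e4, e4', l, l 1])
      rw [e4, e4', hF.add, fin, l] at r5
      exact r5.of_eq (by simp)
  · rw [e1, e2, e3', l]
    omega

theorem run_scaleLoop {F : ℤ → List Letter} (hF : Additive F) (neg : Bool) {a : Reg} (ha : IsNumber a)
    (ds : List Bool) : ∀ (k : ℤ) (s : Reg → List Letter), s a = F (if neg then - k else k) →
    s .copy = F 1 → s .tmp = [] → s .tmp' = [] → s .flag = [] → s .acc = [] →
    s .digits = ds.map Letter.bit →
    Run (.loop .digits Option.isSome (popSome .digits (scaleStep neg a))) s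
      (Function.update (Function.update (Function.update s .digits []) a
        (F (if neg then - ofDigits k ds else ofDigits k ds))) .digits' ((ds.map Letter.bit).reverse ++ s .digits'))
      ((9 * (F 0).length + 14) * ds.length + 1) := by
  have ne : a ≠ .tmp ∧ a ≠ .tmp' ∧ a ≠ .flag ∧ a ≠ .acc ∧ a ≠ .copy ∧ a ≠ .digits' ∧ a ≠ .digits := by
    rcases ha with rfl | rfl | rfl | rfl <;> decide
  obtain ⟨n1, n2, n3, n4, n5, n6, n7⟩ := ne
  induction ds with
  | nil =>
    intro k s hs hc h1 h2 h3 h4 hd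
    refine (run_loop_done (by rw [hd]; rfl) (by simp)).of_eq ?_
    funext r
    simp only [Function.update_apply, ofDigits, List.foldl_nil]
    split_ifs <;> simp_all
  | cons b ds ih =>
    intro k s hs hc h1 h2 h3 h4 hd
    have r1 := run_scaleStep hF neg ha b (if neg then - k else k) (Function.update s .digits (ds.map .bit))
      (by simp [n7, hs]) (by simp [hc]) (by simp [h1]) (by simp [h2]) (by simp [h3]) (by simp [h4])
    generalize hs1 : Function.update (Function.update (Function.update s .digits (ds.map .bit)) a _) .digits' _ = s1 at r1
    have e : 2 * (if neg then - k else k) + (if neg then - (b.toNat : ℤ) else (b.toNat : ℤ)) =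
        if neg then - (2 * k + b.toNat) else (2 * k + b.toNat) := by
      cases neg <;> simp <;> ring
    rw [e] at hs1
    have r2 := ih (2 * k + b.toNat) s1 (by simp [← hs1, n6]) (by simp [← hs1, hc, n5.symm])
      (by simp [← hs1, h1, n1.symm]) (by simp [← hs1, h2, n2.symm]) (by simp [← hs1, h3, n3.symm])
      (by simp [← hs1, h4, n4.symm]) (by simp [← hs1, n7.symm])
    refine run_loop_step (by rw [hd]; rfl) (run_popSome (by rw [hd]; rfl) r1) (r2.of_eq ?_) ?_
    · funext r
      simp only [← hs1, Function.update_apply, ofDigits, List.foldl_cons]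
      split_ifs <;> simp_all
    · simp only [List.length_cons, mul_add]
      omega

/-- Horner's scheme. The stack minus its copy is zero times the original; each digit then doubles
the stack and possibly adds the copy once more (or subtracts it). The digits are collected and put
back at the end, since `readDen` uses them three times. -/
theorem run_scaleBy {F : ℤ → List Letter} (hF : Additive F) (neg : Bool) {a : Reg} (ha : IsNumber a)
    (ds : List Bool) (s : Reg → List Letter) (hs : s a = F 1) (hI : Idle s)
    (hd : s .digits = ds.map Letter.bit) :
    Run (scaleBy neg a) s (Function.update s a (F (if neg then - ofDigits 0 ds else ofDigits 0 ds)))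
      ((9 * (F 0).length + 15) * (ds.length + 1)) := by
  have l : ∀ i, (F i).length = (F 0).length := fun i => hF.length i 0
  have ne : a ≠ .tmp ∧ a ≠ .tmp' ∧ a ≠ .flag ∧ a ≠ .acc ∧ a ≠ .copy ∧ a ≠ .digits' ∧ a ≠ .digits := by
    rcases ha with rfl | rfl | rfl | rfl <;> decide
  obtain ⟨n1, n2, n3, n4, n5, n6, n7⟩ := ne
  obtain ⟨h1, h2, h3, h4, h5, h6⟩ := hI
  have r1 := run_copyTo n1 (by decide : Reg.copy ≠ .tmp) n5 s h1
  rw [h5, hs, List.append_nil] at r1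
  generalize hs1 : Function.update s Reg.copy _ = s1 at r1
  have r2 := run_addTo true n5 n1 n2 n3 (by decide : Reg.copy ≠ .tmp) (by decide : Reg.copy ≠ .tmp')
    (by decide : Reg.copy ≠ .flag) s1 (by simp [← hs1, h1]) (by simp [← hs1, h2])
    (by simp [← hs1, h3]) (by simp [← hs1, n5, hs])
  rw [show s1 a = F 1 by simp [← hs1, n5, hs], show s1 .copy = F 1 by simp [← hs1], hF.add] at r2
  generalize hs2 : Function.update s1 a _ = s2 at r2
  have r3 := run_scaleLoop hF neg ha ds 0 s2 (by simp [← hs2]) (by simp [← hs2, ← hs1, n5.symm])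
    (by simp [← hs2, ← hs1, n1.symm, h1]) (by simp [← hs2, ← hs1, n2.symm, h2])
    (by simp [← hs2, ← hs1, n3.symm, h3]) (by simp [← hs2, ← hs1, n4.symm, h4])
    (by simp [← hs2, ← hs1, n7.symm, hd])
  generalize hs3 : Function.update (Function.update (Function.update s2 .digits []) a _) .digits' _ = s3 at r3
  have r4 := run_clear Reg.copy s3
  generalize hs4 : Function.update s3 Reg.copy _ = s4 at r4
  have r5 := run_move (c := Option.isSome) (a := Reg.digits') (b := .digits) (by decide) (ds.map Letter.bit).reverse s4 []
    (by simp [← hs4, ← hs3, ← hs2, ← hs1, h6, n6.symm]) (fun _ _ => rfl) rfl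
  refine r1.seq_le (r2.seq (r3.seq (r4.seq (r5.of_eq ?_)))) ?_
  · funext r
    simp only [← hs4, ← hs3, ← hs2, ← hs1, Function.update_apply]
    split_ifs <;> simp_all
  · rw [show s3 .copy = F 1 by simp [← hs3, ← hs2, ← hs1, n5.symm], l]
    simp only [List.length_reverse, List.length_map]
    nlinarith

end Prog

end SimpleFolding

namespace SimpleFolding

namespace Prog

/-! ### Reading the pattern -/

/-- The contents of the stacks while the pattern is read. -/
def readState (I E B N T Q L : List Letter) : Reg → List Letter
  | .inp => I
  | .scale => E
  | .base => B
  | .num => N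
  | .table => T
  | .digits => Q
  | .letter => L
  | _ => []

section

variable (I E B N T Q L l : List Letter)

theorem idle_readState : Idle (readState I E B N T Q L) := ⟨rfl, rfl, rfl, rfl, rfl, rfl⟩

theorem update_readState_inp : Function.update (readState I E B N T Q L) .inp l = readState l E B N T Q L := by
  funext k; cases k <;> rfl

theorem update_readState_scale : Function.update (readState I E B N T Q L) .scale l = readState I l B N T Q L := by
  funext k; cases k <;> rfl

theorem update_readState_base : Function.update (readState I E B N T Q L) .base l = readState I E l N T Q L := by
  funext k; cases k <;> rfl

theorem update_readState_num : Function.update (readState I E B N T Q L) .num l = readState I E B l T Q L := by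
  funext k; cases k <;> rfl

theorem update_readState_table : Function.update (readState I E B N T Q L) .table l = readState I E B N l Q L := by
  funext k; cases k <;> rfl

theorem update_readState_digits : Function.update (readState I E B N T Q L) .digits l = readState I E B N T l L := by
  funext k; cases k <;> rfl

theorem update_readState_letter : Function.update (readState I E B N T Q L) .letter l = readState I E B N T Q l := by
  funext k; cases k <;> rfl

end

/-- Read a numerator and multiply it with the common denominator. -/
def readNum (neg : Bool) : Prog Reg Letter :=
  move isBit .inp .digits ;; popSome .inp (fun _ => .skip) ;; copyTo .scale .num ;;
    scaleBy neg .num ;; clear .digits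

/-- Read a numerator with its sign. -/
def readSigned : Prog Reg Letter :=
  popSome .inp fun a => if a = .minus then readNum true else .push .inp a ;; readNum false

/-- Read a denominator and multiply everything by it. -/
def readDen : Prog Reg Letter :=
  move isBit .inp .digits ;; scaleBy false .scale ;; scaleBy false .base ;; scaleBy false .table ;;
    clear .digits

/-- Read a vertex and put its position in the folded state on the table. -/
def readVertex : Prog Reg Letter :=
  popSome .inp (fun l => .push .letter l) ;; readSigned ;; readDen ;; addTo true .num .base ;;
    move Option.isSome .letter .table ;; copyTo .num .table ;; addTo false .base .num ;;
    addTo false .base .num ;; clear .num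

theorem isBit_of_mem_map {ds : List Bool} : ∀ x ∈ ds.map Letter.bit, isBit (some x) = true := by
  intro x hx
  obtain ⟨b, -, rfl⟩ := List.mem_map.1 hx
  rfl

theorem run_readNum {W M : ℕ} (hW : W ≤ M) (neg : Bool) (ds : List Bool) (hds : ds.length ≤ M) (D : ℤ)
    (rest B T L : List Letter) :
    Run (readNum neg) (readState (ds.map .bit ++ .slash :: rest) (bits W D) B [] T [] L)
      (readState rest (bits W D) B (bits W ((if neg then - ofDigits 0 ds.reverse else ofDigits 0 ds.reverse) * D)) T [] L)
      ((9 * M + 15) * (M + 1) + 4 * (M + 1)) := by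
  have r1 := run_move (c := isBit) (a := Reg.inp) (b := .digits) (by decide) (ds.map .bit)
    (readState (ds.map .bit ++ .slash :: rest) (bits W D) B [] T [] L) (.slash :: rest) rfl
    isBit_of_mem_map rfl
  rw [update_readState_inp, update_readState_digits] at r1
  have r2 : Run (popSome Reg.inp fun _ => .skip) (readState (.slash :: rest) (bits W D) B [] T
      ((ds.map .bit).reverse ++ []) L) (readState rest (bits W D) B [] T ((ds.map .bit).reverse ++ []) L) 0 := by
    refine run_popSome (a := .slash) (l := rest) rfl ((run_skip _ _).of_eq ?_)
    rw [update_readState_inp]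
  have r3 := run_copyTo (a := Reg.scale) (b := .num) (by decide) (by decide) (by decide)
    (readState rest (bits W D) B [] T ((ds.map .bit).reverse ++ []) L) rfl
  rw [update_readState_num] at r3
  have r4 := run_scaleBy (additive_bits W D) neg (a := .num) (by simp [IsNumber]) ds.reverse
    (readState rest (bits W D) B (bits W D ++ []) T ((ds.map .bit).reverse ++ []) L) (by simp [readState])
    (idle_readState ..) (by simp [readState])
  rw [update_readState_num] at r4
  have r5 := run_clear Reg.digits (readState rest (bits W D) B (bits W ((if neg then - ofDigits 0 ds.reverse
    else ofDigits 0 ds.reverse) * D)) T ((ds.map .bit).reverse ++ []) L)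
  rw [update_readState_digits] at r5
  refine r1.seq_le (r2.seq (r3.seq (r4.seq r5))) ?_
  simp only [readState, List.length_append, List.length_reverse, List.length_map, List.length_nil, length_bits]
  have : (9 * W + 15) * (ds.length + 1) ≤ (9 * M + 15) * (M + 1) := by gcongr
  omega

theorem run_readSigned {W M : ℕ} (hW : W ≤ M) (v : ℚ) (hv : (Computability.encodeNat v.num.natAbs).length ≤ M) (D : ℤ)
    (rest B T L : List Letter) :
    Run readSigned (readState ((if v < 0 then [Letter.minus] else []) ++
        (Computability.encodeNat v.num.natAbs).map .bit ++ .slash :: rest) (bits W D) B [] T [] L)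
      (readState rest (bits W D) B (bits W (v.num * D)) T [] L) ((9 * M + 15) * (M + 1) + 4 * (M + 1)) := by
  by_cases h : v < 0
  · rw [if_pos h]
    have r := run_readNum hW true _ hv D rest B T L
    rw [ofDigits_encodeNat] at r
    refine run_popSome (a := .minus) (l := (Computability.encodeNat v.num.natAbs).map .bit ++ .slash :: rest) rfl ?_
    rw [update_readState_inp]
    refine r.of_eq ?_
    have := Rat.num_neg.2 h
    congr 2
    simp only [if_true]
    congr 1
    omega
  · rw [if_neg h]
    have r := run_readNum hW false _ hv D rest B T L
    rw [ofDigits_encodeNat] at r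
    have hn := Rat.num_nonneg.2 (not_lt.1 h)
    -- Without a sign, the symbol popped for the test is the first digit or the slash, and is put
    -- back.
    obtain ⟨a, l, e⟩ : ∃ a l, (Computability.encodeNat v.num.natAbs).map Letter.bit ++ .slash :: rest = a :: l := by
      cases (Computability.encodeNat v.num.natAbs) <;> exact ⟨_, _, rfl⟩
    have ha : a ≠ .minus := by
      rintro rfl
      cases h : (Computability.encodeNat v.num.natAbs) <;> simp [h] at e
    refine run_popSome (a := a) (l := l) (by simp only [readState, List.nil_append, e]) ?_
    rw [update_readState_inp, if_neg ha]
    rw [e] at r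
    have r0 := run_push Reg.inp a (readState l (bits W D) B [] T [] L) 0
    rw [update_readState_inp] at r0
    refine (r0.seq_le r (by omega)).of_eq ?_
    congr 2
    simp only [Bool.false_eq_true, if_false]
    congr 1
    omega

theorem run_readDen {W M : ℕ} (hW : W ≤ M) (ds : List Bool) (hds : ds.length ≤ M) (D B : ℤ) (V : List (ℤ × Letter))
    (hV : ∀ e ∈ V, isBit (some e.2) = false) (hM : (blocks W V).length ≤ M) (rest N L : List Letter)
    (hr : isBit rest.head? = false) :
    Run readDen (readState (ds.map .bit ++ rest) (bits W D) (bits W B) N (blocks W V) [] L)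
      (readState rest (bits W (ofDigits 0 ds.reverse * D)) (bits W (ofDigits 0 ds.reverse * B)) N
        (blocks W (V.map fun e => (ofDigits 0 ds.reverse * e.1, e.2))) [] L)
      (3 * ((9 * M + 15) * (M + 1)) + 2 * (M + 1)) := by
  have r1 := run_move (c := isBit) (a := Reg.inp) (b := .digits) (by decide) (ds.map .bit)
    (readState (ds.map .bit ++ rest) (bits W D) (bits W B) N (blocks W V) [] L) rest rfl isBit_of_mem_map hr
  rw [update_readState_inp, update_readState_digits] at r1
  have r2 := run_scaleBy (additive_bits W D) false (a := .scale) (by simp [IsNumber]) ds.reverse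
    (readState rest (bits W D) (bits W B) N (blocks W V) ((ds.map .bit).reverse ++ []) L) (by simp [readState])
    (idle_readState ..) (by simp [readState])
  rw [update_readState_scale] at r2
  have r3 := run_scaleBy (additive_bits W B) false (a := .base) (by simp [IsNumber]) ds.reverse
    (readState rest (bits W (ofDigits 0 ds.reverse * D)) (bits W B) N (blocks W V) ((ds.map .bit).reverse ++ []) L)
    (by simp [readState]) (idle_readState ..) (by simp [readState])
  rw [update_readState_base] at r3
  have r4 := run_scaleBy (additive_blocks W V hV) false (a := .table) (by simp [IsNumber]) ds.reverse
    (readState rest (bits W (ofDigits 0 ds.reverse * D)) (bits W (ofDigits 0 ds.reverse * B)) N (blocks W V)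
      ((ds.map .bit).reverse ++ []) L)
    (by simp [readState]) (idle_readState ..) (by simp [readState])
  rw [update_readState_table] at r4
  have r5 := run_clear Reg.digits (readState rest (bits W (ofDigits 0 ds.reverse * D))
    (bits W (ofDigits 0 ds.reverse * B)) N (blocks W (V.map fun e => (ofDigits 0 ds.reverse * e.1, e.2)))
      ((ds.map .bit).reverse ++ []) L)
  rw [update_readState_digits] at r5
  refine r1.seq_le (r2.seq (r3.seq (r4.seq r5))) ?_
  have hlen := (additive_blocks W V hV).length 0 1
  simp only [one_mul, Prod.mk.eta, List.map_id'] at hlen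
  have e1 : (9 * W + 15) * (ds.length + 1) ≤ (9 * M + 15) * (M + 1) := by gcongr
  have e2 : (9 * (blocks W V).length + 15) * (ds.length + 1) ≤ (9 * M + 15) * (M + 1) := by gcongr
  simp only [readState, List.length_append, List.length_reverse, List.length_map, List.length_nil, length_bits, hlen]
  omega

/-- The numbers after reading a vertex. -/
def readResult (D B : ℤ) (V : List (ℤ × Letter)) (e : ℚ × Letter) : ℤ × ℤ × List (ℤ × Letter) :=
  (e.1.den * D, e.1.den * B + 2 * (e.1.num * D - e.1.den * B),
    (e.1.num * D - e.1.den * B, e.2) :: V.map fun f => (e.1.den * f.1, f.2))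

/-- In use, `D` is the product of the denominators read so far, `B / D` is the sum of the coordinate
and the folded position of the previous vertex, and `V` holds the folded positions multiplied by
`D`, the latest first. Over the new denominator `v.den * D` the coordinate `v` has numerator `v.num
* D`, so the new folded position has numerator `v.num * D - v.den * B`. Adding it twice to the base
realises `2 * v - b = b + 2 * (v - b)`. -/
theorem run_readVertex {W M : ℕ} (hW : W ≤ M) (e : ℚ × Letter) (he : (e.2 :: encodeRat e.1).length ≤ M) (D B : ℤ)
    (V : List (ℤ × Letter)) (hV : ∀ e ∈ V, isBit (some e.2) = false) (hM : (blocks W V).length ≤ M)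
    (rest : List Letter) (hr : isBit rest.head? = false) :
    Run readVertex (readState (e.2 :: encodeRat e.1 ++ rest) (bits W D) (bits W B) [] (blocks W V) [] [])
      (readState rest (bits W (readResult D B V e).1) (bits W (readResult D B V e).2.1) []
        (blocks W (readResult D B V e).2.2) [] [])
      (100 * (M + 1) ^ 2) := by
  obtain ⟨v, l⟩ := e
  simp only [encodeRat, List.length_cons, List.length_append, List.length_map, List.length_nil] at he
  set I := ((if v < 0 then [Letter.minus] else []) ++
    (Computability.encodeNat v.num.natAbs).map .bit ++ [Letter.slash] ++ (Computability.encodeNat v.den).map .bit) ++ rest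
    with hI
  have hI' : I = (if v < 0 then [Letter.minus] else []) ++ (Computability.encodeNat v.num.natAbs).map .bit ++
      .slash :: ((Computability.encodeNat v.den).map .bit ++ rest) := by
    simp [hI]
  have r1 : Run (popSome .inp (fun l => .push .letter l))
      (readState (l :: I) (bits W D) (bits W B) [] (blocks W V) [] [])
      (readState I (bits W D) (bits W B) [] (blocks W V) [] [l]) 0 := by
    refine run_popSome (a := l) (l := I) rfl ?_
    rw [update_readState_inp]
    refine (run_push _ _ _ _).of_eq ?_
    rw [update_readState_letter]
    rfl
  have r2 := run_readSigned hW v (by omega) D ((Computability.encodeNat v.den).map .bit ++ rest) (bits W B)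
    (blocks W V) [l]
  rw [← hI'] at r2
  have r3 := run_readDen hW (Computability.encodeNat v.den) (by omega) D B V hV hM rest (bits W (v.num * D)) [l] hr
  rw [ofDigits_encodeNat] at r3
  have add1 : ∀ m n : ℤ, addBits true true (bits W m) (bits W n) = bits W (m - n) := by
    intro m n
    obtain ⟨c', h⟩ := addBits_bits true W m n true
    have := h [] []
    simp only [List.append_nil, if_true] at this
    rw [this, show addBits true c' [] [] = [] by simp [addBits], List.append_nil]
    congr 1
    simp
    ring
  have add2 : ∀ m n : ℤ, addBits false false (bits W m) (bits W n) = bits W (m + n) := by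
    intro m n
    obtain ⟨c', h⟩ := addBits_bits false W m n false
    have := h [] []
    simp only [List.append_nil, Bool.false_eq_true, if_false] at this
    rw [this, show addBits false c' [] [] = [] by simp [addBits], List.append_nil]
    congr 1
    simp
  generalize hE : bits W (v.den * D) = E at r3
  generalize hT : blocks W (V.map fun e => (v.den * e.1, e.2)) = T at r3
  have r4 := run_addTo true (d := .num) (l := .base) (by decide) (by decide) (by decide) (by decide) (by decide)
    (by decide) (by decide) (readState rest E (bits W (v.den * B)) (bits W (v.num * D)) T [] [l]) rfl rfl rfl
    (by simp [readState])
  rw [update_readState_num] at r4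
  simp only [readState, add1] at r4
  have r5 := run_move (c := Option.isSome) (a := Reg.letter) (b := .table) (by decide) [l]
    (readState rest E (bits W (v.den * B)) (bits W (v.num * D - v.den * B)) T [] [l]) [] rfl (fun _ _ => rfl) rfl
  rw [update_readState_letter, update_readState_table] at r5
  have r6 := run_copyTo (a := Reg.num) (b := .table) (by decide) (by decide) (by decide)
    (readState rest E (bits W (v.den * B)) (bits W (v.num * D - v.den * B)) ([l].reverse ++ T) [] []) rfl
  rw [update_readState_table] at r6
  have r7 := fun b T => run_addTo false (d := .base) (l := .num) (by decide) (by decide) (by decide) (by decide) (by decide)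
    (by decide) (by decide) (readState rest E (bits W b) (bits W (v.num * D - v.den * B)) T [] []) rfl rfl rfl
    (by simp [readState])
  simp only [update_readState_base] at r7
  simp only [readState, add2] at r7
  have r8 := fun b T => run_clear Reg.num (readState rest E (bits W b) (bits W (v.num * D - v.den * B)) T [] [])
  simp only [update_readState_num] at r8
  refine (r1.seq_le (r2.seq (r3.seq (r4.seq (r5.seq (r6.seq ((r7 _ _).seq ((r7 _ _).seq (r8 _ _)))))))) ?_).of_eq ?_
  · simp only [readState, length_bits, List.length_cons, List.length_nil]
    nlinarith
  · simp only [readResult, hE, ← hT]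
    congr 1
    · congr 1
      ring
    · simp [readState, blocks]

end Prog

end SimpleFolding

/-! ### Reading all vertices, and the size of the numbers -/

namespace SimpleFolding

namespace Prog

/-- The string that describes labelled vertices. -/
def encodeVertices (es : List (ℚ × Letter)) : List Letter := es.flatMap fun e => e.2 :: encodeRat e.1

/-- The numbers after reading vertices. -/
def readResults (s : ℤ × ℤ × List (ℤ × Letter)) (es : List (ℚ × Letter)) : ℤ × ℤ × List (ℤ × Letter) :=
  es.foldl (fun s e => readResult s.1 s.2.1 s.2.2 e) s

theorem length_blocks (W : ℕ) (V : List (ℤ × Letter)) : (blocks W V).length = V.length * (W + 1) := by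
  simp [blocks, List.length_flatMap]

theorem run_readVertices {W M : ℕ} (hW : W ≤ M) (es : List (ℚ × Letter)) :
    ∀ (D B : ℤ) (V : List (ℤ × Letter)), (∀ e ∈ V, isBit (some e.2) = false) →
    (∀ e ∈ es, isBit (some e.2) = false ∧ (e.2 :: encodeRat e.1).length ≤ M) →
    (V.length + es.length) * (W + 1) ≤ M →
    Run (.loop .inp Option.isSome readVertex)
      (readState (encodeVertices es) (bits W D) (bits W B) [] (blocks W V) [] [])
      (readState [] (bits W (readResults (D, B, V) es).1) (bits W (readResults (D, B, V) es).2.1) []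
        (blocks W (readResults (D, B, V) es).2.2) [] []) (es.length * (100 * (M + 1) ^ 2 + 1) + 1) := by
  induction es with
  | nil => exact fun D B V _ _ _ => run_loop_done rfl (by simp)
  | cons e es ih =>
    intro D B V hV hes hM
    simp only [List.length_cons] at hM
    have h1 := run_readVertex hW e (hes e (by simp)).2 D B V hV (by rw [length_blocks]; nlinarith)
      (encodeVertices es) (by
        cases es with
        | nil => rfl
        | cons e' es => exact (hes e' (by simp)).1)
    have h2 := ih (readResult D B V e).1 (readResult D B V e).2.1 (readResult D B V e).2.2 ?_
      (fun e he => hes e (by simp [he])) ?_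
    · refine run_loop_step rfl h1 h2 ?_
      simp only [List.length_cons]
      nlinarith
    · intro f hf
      simp only [readResult, List.mem_cons, List.mem_map] at hf
      rcases hf with rfl | ⟨f, hf, rfl⟩
      · exact (hes e (by simp)).1
      · exact hV f hf
    · simp only [readResult, List.length_cons, List.length_map]
      rw [← add_assoc] at hM
      rwa [add_right_comm]

/-- Prepare the numbers `1` and `0` with two digits more than the input has symbols. -/
def prepare : Prog Reg Letter :=
  .push .scale (.bit false) ;; .push .scale (.bit false) ;; .push .base (.bit false) ;;
    .push .base (.bit false) ;;
    .loop .inp Option.isSome (popSome .inp fun a => .push .tmp a ;; .push .scale (.bit false) ;;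
      .push .base (.bit false)) ;;
    move Option.isSome .tmp .inp ;; popSome .scale fun _ => .push .scale (.bit true)

theorem bits_zero (W : ℕ) : bits W 0 = List.replicate W (.bit false) := by
  induction W with
  | zero => rfl
  | succ W ih => simp [bits, ih, List.replicate_succ]

theorem run_prepareLoop (l : List Letter) : ∀ E B t : List Letter,
    Run (.loop .inp Option.isSome (popSome .inp fun a => .push .tmp a ;; .push .scale (.bit false) ;;
      .push .base (.bit false))) (Function.update (readState l E B [] [] [] []) .tmp t)
      (Function.update (readState [] (List.replicate l.length (.bit false) ++ E)
        (List.replicate l.length (.bit false) ++ B) [] [] [] []) .tmp (l.reverse ++ t)) (l.length + 1) := by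
  induction l with
  | nil => exact fun E B t => run_loop_done rfl (by simp)
  | cons a l ih =>
    intro E B t
    have h : Run (popSome Reg.inp fun a => .push .tmp a ;; .push .scale (.bit false) ;; .push .base (.bit false))
        (Function.update (readState (a :: l) E B [] [] [] []) .tmp t)
        (Function.update (readState l (.bit false :: E) (.bit false :: B) [] [] [] []) .tmp (a :: t)) 0 := by
      refine run_popSome (a := a) (l := l) rfl
        (((run_push _ _ _ 0).seq ((run_push _ _ _ 0).seq (run_push _ _ _ 0))).of_eq ?_)
      funext k
      cases k <;> rfl
    refine run_loop_step rfl h ((ih (.bit false :: E) (.bit false :: B) (a :: t)).of_eq ?_) (by simp)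
    have e : ∀ X : List Letter, List.replicate l.length (Letter.bit false) ++ .bit false :: X =
        List.replicate (a :: l).length (.bit false) ++ X := by
      intro X
      rw [List.length_cons, List.replicate_succ', List.append_assoc, List.singleton_append]
    rw [e, e, List.reverse_cons, List.append_assoc, List.singleton_append]

/-- Intermediate results matter only modulo a power of two. The final positions are at most `2 ^
I.length` in absolute value by `readResults_bound`, so `I.length + 2` bits represent them with their
signs. -/
theorem run_prepare (I : List Letter) :
    Run prepare (readState I [] [] [] [] [] []) (readState I (bits (I.length + 2) 1) (bits (I.length + 2) 0) [] [] [] [])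
      (2 * I.length + 2) := by
  let z : Letter := .bit false
  have r2 := run_prepareLoop I [z, z] [z, z] []
  have e : List.replicate I.length z ++ [z, z] = bits (I.length + 2) 0 := by
    rw [bits_zero, List.replicate_add]
    rfl
  rw [e] at r2
  have r3 := run_move (c := Option.isSome) (a := Reg.tmp) (b := .inp) (by decide) I.reverse
    (Function.update (readState [] (bits (I.length + 2) 0) (bits (I.length + 2) 0) [] [] [] []) .tmp (I.reverse ++ []))
    [] (by simp) (fun _ _ => rfl) rfl
  have r4 : Run (popSome .scale fun _ => .push .scale (.bit true))
      (readState I (bits (I.length + 2) 0) (bits (I.length + 2) 0) [] [] [] [])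
      (readState I (bits (I.length + 2) 1) (bits (I.length + 2) 0) [] [] [] []) 0 := by
    refine run_popSome (a := z) (l := bits (I.length + 1) 0) rfl ((run_push _ _ _ _).of_eq ?_)
    funext k
    cases k <;> rfl
  have r3 := r3.of_eq (s'' := readState I (bits (I.length + 2) 0) (bits (I.length + 2) 0) [] [] [] []) (by
    rw [List.reverse_reverse]
    funext k
    cases k <;> simp [readState])
  refine (run_push _ _ _ 0).seq_le ((run_push _ _ _ 0).seq ((run_push _ _ _ 0).seq ((run_push _ _ _ 0).seq
    (t₂ := 2 * I.length + 2) ?_))) (by omega)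
  convert r2.seq_le (r3.seq r4) _ using 1
  · funext k
    cases k <;> rfl
  · simp
    omega

/-- The folded positions of the vertices, starting from `b`. -/
def zig : ℚ → List (ℚ × Letter) → List (ℚ × Letter)
  | _, [] => []
  | b, (v, l) :: es => (v - b, l) :: zig (2 * v - b) es

/-- Divided by the current common denominator, the integers follow the rational recursion `zig`;
multiplying everything by one more denominator cancels out. -/
theorem readResults_spec (es : List (ℚ × Letter)) : ∀ (D B : ℤ) (V : List (ℤ × Letter)), 0 < D →
    0 < (readResults (D, B, V) es).1 ∧
    (readResults (D, B, V) es).2.2.map (fun e => ((e.1 : ℚ) / (readResults (D, B, V) es).1, e.2)) =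
      (zig (B / D) es).reverse ++ V.map fun e => ((e.1 : ℚ) / D, e.2) := by
  induction es with
  | nil => exact fun D B V hD => ⟨hD, by simp [readResults, zig]⟩
  | cons e es ih =>
    obtain ⟨v, l⟩ := e
    intro D B V hD
    have hden : (0 : ℤ) < v.den := by exact_mod_cast v.pos
    have hq : (v.den : ℚ) ≠ 0 := by exact_mod_cast hden.ne'
    have hD' : (D : ℚ) ≠ 0 := by exact_mod_cast hD.ne'
    have hv : (v.num : ℚ) = v * v.den := (Rat.mul_den_eq_num v).symm
    obtain ⟨h1, h2⟩ := ih (v.den * D) (v.den * B + 2 * (v.num * D - v.den * B))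
      ((v.num * D - v.den * B, l) :: V.map fun f => (v.den * f.1, f.2)) (mul_pos hden hD)
    refine ⟨h1, h2.trans ?_⟩
    rw [zig, List.reverse_cons, List.append_assoc, List.map_cons, List.map_map]
    congr 1
    · congr 2
      push_cast
      rw [hv]
      field_simp
      ring
    · rw [List.singleton_append]
      congr 1
      · congr 1
        push_cast
        rw [hv]
        field_simp
      · refine List.map_congr_left fun f _ => ?_
        simp only [Function.comp]
        congr 1
        push_cast
        field_simp

theorem ofDigits_lt (ds : List Bool) : ∀ k : ℤ, ofDigits k ds < (k + 1) * 2 ^ ds.length := by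
  induction ds with
  | nil => intro k; simp [ofDigits]
  | cons b ds ih =>
    intro k
    have := ih (2 * k + b.toNat)
    refine this.trans_le ?_
    rw [List.length_cons, pow_succ']
    have h : (b.toNat : ℤ) ≤ 1 := by cases b <;> simp
    have h2 : (0 : ℤ) < 2 ^ ds.length := by positivity
    nlinarith

theorem lt_two_pow_encodeNat (n : ℕ) : (n : ℤ) < 2 ^ (Computability.encodeNat n).length := by
  have := ofDigits_lt (Computability.encodeNat n).reverse 0
  rw [ofDigits_encodeNat] at this
  simpa using this

/-- A vertex with `a` digits in the numerator and `b` in the denominator increases the bound by a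
factor of at most `2 ^ (a + b + 2)`, and its description has at least `a + b + 2` symbols, namely
the digits, the slash and the introducing letter. -/
theorem readResults_bound (es : List (ℚ × Letter)) : ∀ (D B : ℤ) (V : List (ℤ × Letter)) (U : ℤ), 0 < D → D ≤ U →
    |B| ≤ U → (∀ e ∈ V, |e.1| ≤ U) →
    ∀ e ∈ (readResults (D, B, V) es).2.2, |e.1| ≤ U * 2 ^ (encodeVertices es).length := by
  induction es with
  | nil => exact fun D B V U _ _ _ hV => by simpa [readResults, encodeVertices] using hV
  | cons e es ih =>
    obtain ⟨v, l⟩ := e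
    intro D B V U hD hDU hB hV
    have hden : (0 : ℤ) < v.den := by exact_mod_cast v.pos
    have hp := lt_two_pow_encodeNat v.num.natAbs
    have hq := lt_two_pow_encodeNat v.den
    rw [Int.natCast_natAbs] at hp
    have hlen : (Computability.encodeNat v.num.natAbs).length + (Computability.encodeNat v.den).length + 2 ≤
        (l :: encodeRat v).length := by
      simp [encodeRat]; omega
    generalize (Computability.encodeNat v.num.natAbs).length = a at hp hlen
    generalize (Computability.encodeNat v.den).length = b at hq hlen
    have hU : 0 < U := hD.trans_le hDU
    have ha : (1 : ℤ) ≤ 2 ^ a := one_le_pow₀ (by norm_num)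
    have hb : (1 : ℤ) ≤ 2 ^ b := one_le_pow₀ (by norm_num)
    have hU' : U * (4 * 2 ^ a * 2 ^ b) ≤ U * 2 ^ (l :: encodeRat v).length := by
      refine mul_le_mul_of_nonneg_left ?_ hU.le
      calc (4 : ℤ) * 2 ^ a * 2 ^ b = 2 ^ (a + b + 2) := by ring
        _ ≤ _ := pow_le_pow_right₀ (by norm_num) hlen
    have m1 : |v.num| * D ≤ 2 ^ a * U := mul_le_mul hp.le hDU hD.le (by positivity)
    have m2 : ∀ x : ℤ, |x| ≤ U → v.den * |x| ≤ 2 ^ b * U := fun x hx =>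
      mul_le_mul hq.le hx (abs_nonneg x) (by positivity)
    have n1 : |(v.num * D : ℤ)| = |v.num| * D := by rw [abs_mul, abs_of_pos hD]
    have n2 : ∀ x : ℤ, |(v.den * x : ℤ)| = v.den * |x| := fun x => by rw [abs_mul, abs_of_pos hden]
    have t1 : 2 ^ a * U + 2 ^ b * U ≤ U * (4 * 2 ^ a * 2 ^ b) := by
      nlinarith [mul_le_mul_of_nonneg_left (mul_le_mul ha hb (by norm_num) (by positivity)) hU.le,
        mul_nonneg hU.le (mul_nonneg (sub_nonneg.2 ha) (sub_nonneg.2 hb)), mul_nonneg hU.le (sub_nonneg.2 ha),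
        mul_nonneg hU.le (sub_nonneg.2 hb)]
    have t2 : 2 * (2 ^ a * U) + 2 ^ b * U ≤ U * (4 * 2 ^ a * 2 ^ b) := by
      nlinarith [mul_le_mul_of_nonneg_left (mul_le_mul ha hb (by norm_num) (by positivity)) hU.le,
        mul_nonneg hU.le (mul_nonneg (sub_nonneg.2 ha) (sub_nonneg.2 hb)), mul_nonneg hU.le (sub_nonneg.2 ha),
        mul_nonneg hU.le (sub_nonneg.2 hb)]
    have t3 : 2 ^ b * U ≤ U * (4 * 2 ^ a * 2 ^ b) := by
      have : 0 ≤ 2 ^ a * U := by positivity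
      linarith
    have key := ih (v.den * D) (v.den * B + 2 * (v.num * D - v.den * B))
      ((v.num * D - v.den * B, l) :: V.map fun f => (v.den * f.1, f.2)) (U * 2 ^ (l :: encodeRat v).length)
      (mul_pos hden hD) ?_ ?_ ?_
    · intro e he
      refine (key e he).trans (le_of_eq ?_)
      simp only [encodeVertices, List.flatMap_cons, List.length_append, pow_add]
      ring
    · have := m2 D (by rwa [abs_of_pos hD])
      rw [abs_of_pos hD] at this
      linarith
    · have := m2 B hB
      rw [show v.den * B + 2 * (v.num * D - v.den * B) = 2 * (v.num * D) - v.den * B by ring]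
      refine (abs_sub _ _).trans ?_
      rw [abs_mul, n1, n2]
      simp only [Nat.abs_ofNat]
      linarith
    · intro f hf
      rcases List.mem_cons.1 hf with rfl | hf
      · have := m2 B hB
        refine (abs_sub _ _).trans ?_
        rw [n1, n2]
        linarith
      · obtain ⟨g, hg, rfl⟩ := List.mem_map.1 hf
        have := m2 g.1 (hV g hg)
        simp only
        rw [n2]
        linarith

end Prog

end SimpleFolding

namespace SimpleFolding

namespace Prog

/-! ### The machine for the stack algorithm -/

/-- The contents of the stacks used by the stack algorithm. -/
structure Mem where
  input : List Letter := []
  stack : List Letter := []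
  val : List Letter := []
  lab : List Letter := []
  newVal : List Letter := []
  newLab : List Letter := []
  flag : List Letter := []
  tmp : List Letter := []
  aux : List Letter := []
  acc : List Letter := []
  low : List Letter := []
  high : List Letter := []
  parity : List Letter := []
  out : List Letter := []

/-- The contents of all stacks. -/
def Mem.get (m : Mem) : Reg → List Letter
  | .input => m.input
  | .stack => m.stack
  | .val => m.val
  | .lab => m.lab
  | .newVal => m.newVal
  | .newLab => m.newLab
  | .flag => m.flag
  | .tmp => m.tmp
  | .tmp' => m.aux
  | .acc => m.acc
  | .low => m.low
  | .high => m.high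
  | .parity => m.parity
  | .out => m.out
  | _ => []

namespace Mem

variable (m : Mem) (l : List Letter)

@[simp] theorem update_input : Function.update m.get .input l = Mem.get { m with input := l } := by
  funext k; cases k <;> rfl
@[simp] theorem update_stack : Function.update m.get .stack l = Mem.get { m with stack := l } := by
  funext k; cases k <;> rfl
@[simp] theorem update_val : Function.update m.get .val l = Mem.get { m with val := l } := by
  funext k; cases k <;> rfl
@[simp] theorem update_lab : Function.update m.get .lab l = Mem.get { m with lab := l } := by
  funext k; cases k <;> rfl
@[simp] theorem update_newVal : Function.update m.get .newVal l = Mem.get { m with newVal := l } := by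
  funext k; cases k <;> rfl
@[simp] theorem update_newLab : Function.update m.get .newLab l = Mem.get { m with newLab := l } := by
  funext k; cases k <;> rfl
@[simp] theorem update_flag : Function.update m.get .flag l = Mem.get { m with flag := l } := by
  funext k; cases k <;> rfl
@[simp] theorem update_tmp : Function.update m.get .tmp l = Mem.get { m with tmp := l } := by
  funext k; cases k <;> rfl
@[simp] theorem update_aux : Function.update m.get .tmp' l = Mem.get { m with aux := l } := by
  funext k; cases k <;> rfl
@[simp] theorem update_acc : Function.update m.get .acc l = Mem.get { m with acc := l } := by
  funext k; cases k <;> rfl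
@[simp] theorem update_low : Function.update m.get .low l = Mem.get { m with low := l } := by
  funext k; cases k <;> rfl
@[simp] theorem update_high : Function.update m.get .high l = Mem.get { m with high := l } := by
  funext k; cases k <;> rfl
@[simp] theorem update_parity : Function.update m.get .parity l = Mem.get { m with parity := l } := by
  funext k; cases k <;> rfl
@[simp] theorem update_out : Function.update m.get .out l = Mem.get { m with out := l } := by
  funext k; cases k <;> rfl

@[simp] theorem get_input : m.get .input = m.input := rfl
@[simp] theorem get_stack : m.get .stack = m.stack := rfl
@[simp] theorem get_val : m.get .val = m.val := rfl
@[simp] theorem get_lab : m.get .lab = m.lab := rfl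
@[simp] theorem get_newVal : m.get .newVal = m.newVal := rfl
@[simp] theorem get_newLab : m.get .newLab = m.newLab := rfl
@[simp] theorem get_flag : m.get .flag = m.flag := rfl
@[simp] theorem get_tmp : m.get .tmp = m.tmp := rfl
@[simp] theorem get_aux : m.get .tmp' = m.aux := rfl
@[simp] theorem get_acc : m.get .acc = m.acc := rfl
@[simp] theorem get_low : m.get .low = m.low := rfl
@[simp] theorem get_high : m.get .high = m.high := rfl
@[simp] theorem get_parity : m.get .parity = m.parity := rfl
@[simp] theorem get_out : m.get .out = m.out := rfl

end Mem

/-! #### Signed counters -/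

/-- A signed unary counter. -/
def signed : ℤ → List Letter
  | .ofNat k => List.replicate k .slash
  | .negSucc k => List.replicate (k + 1) .minus

theorem length_signed (n : ℤ) : (signed n).length = n.natAbs := by
  cases n <;> simp [signed]

/-- Increase or decrease a signed counter. -/
def bump (k : Reg) (up : Bool) : Prog Reg Letter :=
  .pop k fun o => match up, o with
    | true, some .minus => .skip
    | false, some .slash => .skip
    | true, some a => .push k a ;; .push k .slash
    | false, some a => .push k a ;; .push k .minus
    | true, none => .push k .slash
    | false, none => .push k .minus

theorem run_bump {k : Reg} {up : Bool} {s : Reg → List Letter} {n : ℤ} (h : s k = signed n) :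
    Run (bump k up) s (Function.update s k (signed (n + if up then 1 else -1))) 0 := by
  refine run_pop ?_
  rw [h]
  rcases n with (_ | n) | n <;> cases up
  · refine (run_push _ _ _ _).of_eq ?_
    simp [signed]; rfl
  · refine (run_push _ _ _ _).of_eq ?_
    simp [signed]
  · refine (run_skip _ _).of_eq ?_
    congr 1
    simp [signed, List.replicate_succ]
  · refine ((run_push _ _ _ 0).seq (run_push _ _ _ 0)).of_eq ?_
    simp only [Function.update_self, Function.update_idem]
    congr 1
  · refine ((run_push _ _ _ 0).seq (run_push _ _ _ 0)).of_eq ?_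
    simp only [Function.update_self, Function.update_idem]
    congr 1
  · refine (run_skip _ _).of_eq ?_
    congr 1
    rcases n with _ | n
    · rfl
    · rw [show Int.negSucc (n + 1) + (if true = true then 1 else -1) = Int.negSucc n by simp; omega]
      rfl

/-- Count a crease. -/
def countCrease (c : Letter) : Prog Reg Letter :=
  bump .low (decide (c = .assigned .mountain)) ;; bump .high (decide (c ≠ .assigned .valley)) ;;
    .pop .parity fun o => if o.isSome then .skip else .push .parity .slash

theorem loSign_eq (c : Letter) :
    loSign c = if decide (c = .assigned .mountain) = true then 1 else -1 := by
  cases c with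
  | assigned d => cases d <;> rfl
  | _ => rfl

theorem hiSign_eq (c : Letter) :
    hiSign c = if decide (c ≠ .assigned .valley) = true then 1 else -1 := by
  cases c with
  | assigned d => cases d <;> rfl
  | _ => rfl

/-- Memory that holds the given counters. -/
def Mem.counting (m : Mem) (s : ℤ × ℤ × Bool) : Mem :=
  { m with low := signed s.1, high := signed s.2.1, parity := if s.2.2 then [.slash] else [] }

theorem run_countCrease (c : Letter) (m : Mem) (s : ℤ × ℤ × Bool) :
    Run (countCrease c) (m.counting s).get (m.counting (count c s)).get 0 := by
  have h1 : Run (bump .low (decide (c = .assigned .mountain))) (m.counting s).get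
      (m.counting (s.1 + loSign c, s.2.1, s.2.2)).get 0 := by
    have := run_bump (k := .low) (up := decide (c = .assigned .mountain)) (s := (m.counting s).get) (n := s.1) rfl
    rw [← loSign_eq] at this
    refine this.of_eq ?_
    simp [Mem.counting]
  have h2 : Run (bump .high (decide (c ≠ .assigned .valley))) (m.counting (s.1 + loSign c, s.2.1, s.2.2)).get
      (m.counting (s.1 + loSign c, s.2.1 + hiSign c, s.2.2)).get 0 := by
    have := run_bump (k := .high) (up := decide (c ≠ .assigned .valley))
      (s := (m.counting (s.1 + loSign c, s.2.1, s.2.2)).get) (n := s.2.1) rfl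
    rw [← hiSign_eq] at this
    refine this.of_eq ?_
    simp [Mem.counting]
  refine h1.seq_le (h2.seq (run_pop (t := 0) ?_)) (by omega)
  obtain ⟨lo, hi, b⟩ := s
  cases b
  · refine (run_push _ _ _ _).of_eq ?_
    simp [Mem.counting, count]
  · refine (run_skip _ _).of_eq ?_
    simp [Mem.counting, count]

/-! #### Entries -/

/-- The symbol for the flag of an entry; the lowest entry has a symbol of its own. -/
def flagLetter (bottom f : Bool) : Letter := if bottom then .minus else if f then .unassigned else .slash

/-- The stack of the algorithm as a string. -/
def encodeStack (W : ℕ) : List (ℤ × Letter × Bool) → List Letter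
  | [] => []
  | e :: T => bits W e.1 ++ flagLetter T.isEmpty e.2.2 :: e.2.1 :: encodeStack W T

theorem length_encodeStack (W : ℕ) (T : List (ℤ × Letter × Bool)) :
    (encodeStack W T).length = T.length * (W + 2) := by
  induction T with
  | nil => simp [encodeStack]
  | cons e T ih => simp [encodeStack, ih]; ring

theorem bits_succ_eq (W : ℕ) : ∀ n : ℤ, bits (W + 1) n = bits W n ++ [.bit (decide (n / 2 ^ W % 2 = 1))] := by
  induction W with
  | zero => intro n; simp [bits]
  | succ W ih =>
    intro n
    rw [bits, ih (n / 2)]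
    simp only [bits, List.cons_append]
    congr 4
    rw [Int.ediv_ediv_of_nonneg (by norm_num), pow_succ']

theorem bits_add_two_pow (W : ℕ) : ∀ n : ℤ, bits W (n + 2 ^ W) = bits W n := by
  induction W with
  | zero => intro n; rfl
  | succ W ih =>
    intro n
    have h1 : (n + 2 ^ (W + 1)) % 2 = n % 2 := by rw [pow_succ]; omega
    have h2 : (n + 2 ^ (W + 1)) / 2 = n / 2 + 2 ^ W := by rw [pow_succ]; omega
    simp only [bits, h1, h2, ih]

/-- Read an entry, the highest bit of the number first, and reverse its highest bit. -/
def readEntry (v l : Reg) : Prog Reg Letter :=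
  popSome .input (fun c => .push l c) ;;
    popSome .input (fun b => .push v (.bit (decide (b = .bit false)))) ;; move isBit .input v

/-- Reversing the highest bit adds `2 ^ W` modulo `2 ^ (W + 1)`. This turns two's complement into an
offset representation, in which numbers are ordered like unsigned bit strings. -/
theorem run_readEntry {v l : Reg} (hv : v ≠ .input) (hl : l ≠ .input) (hvl : v ≠ l) (W : ℕ) (n : ℤ) (c : Letter)
    (r : List Letter) (hr : isBit r.head? = false) (s : Reg → List Letter)
    (hs : s .input = c :: (bits (W + 1) n).reverse ++ r) (h1 : s v = []) (h2 : s l = []) :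
    Run (readEntry v l) s (Function.update (Function.update (Function.update s .input r) l [c]) v
      (bits (W + 1) (n + 2 ^ W))) (W + 1) := by
  set b : Bool := decide (n / 2 ^ W % 2 = 1) with hb
  have e : (n + 2 ^ W) / 2 ^ W = n / 2 ^ W + 1 := Int.add_ediv_of_dvd_right (dvd_refl _) |>.trans (by
    rw [Int.ediv_self (by positivity)])
  have e1 : bits (W + 1) (n + 2 ^ W) = bits W n ++ [.bit !b] := by
    rw [bits_succ_eq, bits_add_two_pow, e, hb]
    congr 3
    rcases Int.emod_two_eq_zero_or_one (n / 2 ^ W) with h | h <;> simp [h] <;> omega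
  have hs' : s .input = c :: .bit b :: ((bits W n).reverse ++ r) := by
    rw [hs, bits_succ_eq]; simp [hb]
  have r1 : Run (popSome .input (fun c => .push l c)) s
      (Function.update (Function.update s .input (.bit b :: ((bits W n).reverse ++ r))) l [c]) 0 := by
    refine run_popSome hs' ((run_push _ _ _ _).of_eq ?_)
    rw [Function.update_of_ne hl, h2]
  have r2 : Run (popSome .input (fun b => .push v (.bit (decide (b = .bit false)))))
      (Function.update (Function.update s .input (.bit b :: ((bits W n).reverse ++ r))) l [c])
      (Function.update (Function.update (Function.update s .input ((bits W n).reverse ++ r)) l [c]) v [.bit !b]) 0 := by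
    refine run_popSome (a := .bit b) (l := (bits W n).reverse ++ r) (by simp [hl.symm])
      ((run_push _ _ _ _).of_eq ?_)
    have : decide (Letter.bit b = .bit false) = !b := by cases b <;> rfl
    rw [this]
    funext k
    simp only [Function.update_apply]
    split_ifs <;> simp_all
  have r3 := run_move (c := isBit) hv.symm (bits W n).reverse
    (Function.update (Function.update (Function.update s .input ((bits W n).reverse ++ r)) l [c]) v [.bit !b]) r
    (by simp [hv.symm, hl.symm]) (fun x hx => isBit_of_mem_bits x (by simpa using hx)) hr
  refine r1.seq_le (r2.seq (r3.of_eq ?_)) (by simp)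
  rw [e1]
  funext k
  simp only [Function.update_apply]
  split_ifs <;> simp_all

/-- Move the current vertex to the stack. -/
def pushEntry (a : Letter) : Prog Reg Letter :=
  popSome .lab (fun c => .push .stack c) ;; .push .stack a ;; move Option.isSome .val .tmp ;;
    move Option.isSome .tmp .stack

theorem run_pushEntry (a c : Letter) (m : Mem) (hl : m.lab = [c]) (ht : m.tmp = []) :
    Run (pushEntry a) m.get (Mem.get { m with stack := m.val ++ a :: c :: m.stack, val := [], lab := [] })
      (2 * m.val.length + 2) := by
  have r1 : Run (popSome .lab (fun c => .push .stack c)) m.get (Mem.get { m with stack := c :: m.stack, lab := [] }) 0 := by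
    refine run_popSome (a := c) (l := []) hl ((run_push _ _ _ _).of_eq ?_)
    simp
  have r2 := run_push Reg.stack a (Mem.get { m with stack := c :: m.stack, lab := [] }) 0
  have r3 := run_move (c := Option.isSome) (a := Reg.val) (b := .tmp) (by decide) m.val
    (Mem.get { m with stack := a :: c :: m.stack, lab := [] }) [] (by simp) (fun _ _ => rfl) rfl
  have r4 := run_move (c := Option.isSome) (a := Reg.tmp) (b := .stack) (by decide) m.val.reverse
    (Mem.get { m with stack := a :: c :: m.stack, lab := [], val := [], tmp := m.val.reverse }) [] (by simp)
    (fun _ _ => rfl) rfl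
  simp only [ht] at r1
  simp [ht] at r2 r3 r4
  have r := r1.seq (r2.seq (r3.seq r4))
  exact (r.mono (by simp; omega)).of_eq (by rw [ht])

/-! #### Comparison -/

/-- The result of a comparison as a stack. -/
def orderingLetters : Ordering → List Letter
  | .lt => [.minus]
  | .eq => []
  | .gt => [.paperEnd]

/-- Compare the new number with the one on top of the stack. -/
def compareLoop : Prog Reg Letter :=
  .loop .newVal isBit (popSome .newVal fun a => popSome .stack fun b => .push .tmp a ;; .push .tmp' b ;;
    if a = b then .skip else .pop .acc fun _ => .push .acc (if a = .bit true then .paperEnd else .minus))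

/-- The bits come lowest first, so every later difference overrides the verdict in `acc`, and the
initial verdict `o` survives only between equal numbers. Both numbers are saved, in reverse, on
`tmp` and `tmp'`. -/
theorem run_compareLoop (W : ℕ) : ∀ (y w : ℤ) (o : Ordering) (r : List Letter) (m : Mem), 0 ≤ y → y < 2 ^ W →
    0 ≤ w → w < 2 ^ W → m.newVal = bits W y → m.stack = bits W w ++ r → m.acc = orderingLetters o →
    Run compareLoop m.get (Mem.get { m with
      newVal := []
      stack := r
      tmp := (bits W y).reverse ++ m.tmp
      aux := (bits W w).reverse ++ m.aux
      acc := orderingLetters ((compare y w).then o) }) (W + 1) := by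
  induction W with
  | zero =>
    intro y w o r m h1 h2 h3 h4 hy hw ho
    obtain rfl : y = 0 := by simp at h2; omega
    obtain rfl : w = 0 := by simp at h4; omega
    refine (run_loop_done (by simp [hy, bits, isBit]) (by simp)).of_eq ?_
    obtain ⟨⟩ := m
    simp_all [bits]
  | succ W ih =>
    intro y w o r m h1 h2 h3 h4 hy hw ho
    rw [pow_succ] at h2 h4
    let o' : Ordering := (compare (y % 2) (w % 2)).then o
    have step : Run (popSome .newVal fun a => popSome .stack fun b => .push .tmp a ;; .push .tmp' b ;;
        if a = b then .skip else .pop .acc fun _ => .push .acc (if a = .bit true then .paperEnd else .minus)) m.get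
        (Mem.get { m with
          newVal := bits W (y / 2)
          stack := bits W (w / 2) ++ r
          tmp := .bit (decide (y % 2 = 1)) :: m.tmp
          aux := .bit (decide (w % 2 = 1)) :: m.aux
          acc := orderingLetters o' }) 0 := by
      refine run_popSome (a := .bit (decide (y % 2 = 1))) (l := bits W (y / 2)) hy ?_
      rw [Mem.update_newVal]
      refine run_popSome (a := .bit (decide (w % 2 = 1))) (l := bits W (w / 2) ++ r) (by simp [hw, bits]) ?_
      rw [Mem.update_stack]
      refine (run_push _ _ _ 0).seq ((run_push _ _ _ 0).seq (t₂ := 0) ?_)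
      simp only [Mem.get_tmp, Mem.update_tmp, Mem.get_aux, Mem.update_aux]
      rcases Int.emod_two_eq_zero_or_one y with hy' | hy' <;> rcases Int.emod_two_eq_zero_or_one w with hw' | hw' <;>
        simp only [hy', hw', o']
      · exact (run_skip _ _).of_eq (by obtain ⟨⟩ := m; simp_all)
      · refine run_pop ?_
        exact (run_push _ _ _ _).of_eq (by obtain ⟨⟩ := m; cases o <;> simp_all [orderingLetters] <;> rfl)
      · refine run_pop ?_
        exact (run_push _ _ _ _).of_eq (by obtain ⟨⟩ := m; cases o <;> simp_all [orderingLetters] <;> rfl)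
      · exact (run_skip _ _).of_eq (by obtain ⟨⟩ := m; simp_all)
    refine run_loop_step (by simp [hy, bits, isBit]) step ((ih (y / 2) (w / 2) o' r _ (by omega) (by omega) (by omega)
      (by omega) rfl rfl rfl).of_eq ?_) (by simp)
    have hcmp : (compare (y / 2) (w / 2)).then o' = (compare y w).then o := by
      simp only [o', ← Ordering.then_assoc]
      congr 1
      rcases lt_trichotomy (y / 2) (w / 2) with h | h | h
      · rw [compare_lt_iff_lt.2 h, compare_lt_iff_lt.2 (show y < w by omega)]; rfl
      · rw [compare_eq_iff_eq.2 h]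
        rcases lt_trichotomy (y % 2) (w % 2) with h' | h' | h'
        · rw [compare_lt_iff_lt.2 h', compare_lt_iff_lt.2 (show y < w by omega)]; rfl
        · rw [compare_eq_iff_eq.2 h', compare_eq_iff_eq.2 (show y = w by omega)]; rfl
        · rw [compare_gt_iff_gt.2 h', compare_gt_iff_gt.2 (show y > w by omega)]; rfl
      · rw [compare_gt_iff_gt.2 h, compare_gt_iff_gt.2 (show y > w by omega)]; rfl
    rw [hcmp]
    simp [bits]

end Prog

end SimpleFolding

namespace SimpleFolding

namespace Prog

/-! #### Reductions -/

theorem counting_zero (m : Mem) (h : m.low = []) (h' : m.high = []) (h'' : m.parity = []) :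
    m.counting (0, 0, false) = m := by
  obtain ⟨⟩ := m
  simp_all [Mem.counting, signed]

theorem isBit_flagLetter (b f : Bool) : isBit (some (flagLetter b f)) = false := by
  cases b <;> cases f <;> rfl

/-- Remove the entry on top of the stack and count its crease. -/
def popEntry : Prog Reg Letter :=
  drop isBit .stack ;; .pop .acc fun _ => popSome .stack fun a => popSome .stack fun c =>
    countCrease c ;; if a = .unassigned then .push .acc .slash else .skip

theorem run_popEntry (W : ℕ) (w : ℤ) (b f : Bool) (c : Letter) (r : List Letter) (m : Mem) (s : ℤ × ℤ × Bool)
    (hs : m.stack = bits W w ++ flagLetter b f :: c :: r) (ha : m.acc = [.slash]) :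
    Run popEntry (m.counting s).get
      (Mem.get (Mem.counting { m with stack := r, acc := if b then [] else if f then [.slash] else [] }
        (count c s))) (W + 1) := by
  have r1 := run_drop (c := isBit) (a := Reg.stack) (bits W w) (m.counting s).get (flagLetter b f :: c :: r)
    hs isBit_of_mem_bits (isBit_flagLetter b f)
  rw [length_bits] at r1
  refine r1.seq (t₂ := 0) (run_pop (run_popSome (a := flagLetter b f) (l := c :: r) (by simp)
    (run_popSome (a := c) (l := r) (by simp) ?_)))
  have r2 := run_countCrease c { m with stack := r, acc := [] } s
  refine (?_ : Run _ (Mem.get (Mem.counting { m with stack := r, acc := [] } s)) _ (0 + 0)) |> fun h => by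
    simpa [Mem.counting, ha] using h
  refine r2.seq ?_
  cases b <;> cases f
  · exact run_skip _ _
  · refine (run_push _ _ _ _).of_eq ?_
    simp [Mem.counting]
  · exact run_skip _ _
  · exact run_skip _ _

/-- After each round `acc` is nonempty exactly if the removed entry was flagged and not the bottom
one. By `Decreasing` a flagged entry is never at the bottom, so the loop stops where `popRun` does.
-/
theorem run_popRun (W : ℕ) (T : List (ℤ × Letter × Bool)) : ∀ (v : ℤ) (m : Mem) (s : ℤ × ℤ × Bool), T ≠ [] →
    Decreasing v T → m.stack = encodeStack W T → m.acc = [.slash] →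
    Run (.loop .acc Option.isSome popEntry) (m.counting s).get
      (Mem.get (Mem.counting { m with stack := encodeStack W (popRun T s).2, acc := [] } (popRun T s).1))
      (T.length * (W + 2) + 1) := by
  induction T with
  | nil => simp
  | cons e T ih =>
    obtain ⟨w, c, f⟩ := e
    intro v m s _ hT hs ha
    have r1 := run_popEntry W w T.isEmpty f c (encodeStack W T) m s hs ha
    cases f with
    | false =>
      refine run_loop_step (by simp [Mem.counting, ha]) r1 (run_loop_done (t := 1) (by simp [Mem.counting]) le_rfl)
        (by simp) |>.of_eq ?_
      simp [popRun]
    | true =>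
      have hne : T ≠ [] := by
        rintro rfl
        simp [Decreasing] at hT
      obtain ⟨t, T', rfl⟩ := List.exists_cons_of_ne_nil hne
      have r2 := ih w { m with stack := encodeStack W (t :: T'), acc := [.slash] } (count c s) hne hT.tail rfl rfl
      refine run_loop_step (by simp [Mem.counting, ha]) r1 r2 ?_
      simp only [List.length_cons]
      nlinarith

/-- Bounds the time needed to empty the unary counters. -/
theorem natAbs_popRun_le (T : List (ℤ × Letter × Bool)) : ∀ s : ℤ × ℤ × Bool,
    (popRun T s).1.1.natAbs ≤ s.1.natAbs + T.length ∧ (popRun T s).1.2.1.natAbs ≤ s.2.1.natAbs + T.length := by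
  have h1 : ∀ c, (loSign c).natAbs = 1 := fun c => by rw [loSign_eq]; split_ifs <;> rfl
  have h2 : ∀ c, (hiSign c).natAbs = 1 := fun c => by rw [hiSign_eq]; split_ifs <;> rfl
  induction T with
  | nil => simp [popRun]
  | cons e T ih =>
    obtain ⟨w, c, f⟩ := e
    intro s
    have a1 := h1 c
    have a2 := h2 c
    cases f
    · simp only [popRun, count, List.length_cons]
      omega
    · have := ih (count c s)
      simp only [popRun, count, List.length_cons] at this ⊢
      omega

theorem popRun_suffix (T : List (ℤ × Letter × Bool)) : ∀ s : ℤ × ℤ × Bool, (popRun T s).2 <:+ T := by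
  induction T with
  | nil => simp [popRun]
  | cons e T ih =>
    obtain ⟨w, c, f⟩ := e
    intro s
    cases f
    · exact List.suffix_cons _ _
    · exact (ih _).trans (List.suffix_cons _ _)

theorem signed_slash (n : ℤ) : (signed n).head? = some .slash ↔ 0 < n := by
  rcases n with (_ | n) | n <;> simp [signed, List.replicate_succ]

theorem signed_minus (n : ℤ) : (signed n).head? = some .minus ↔ n < 0 := by
  rcases n with (_ | n) | n <;> simp [signed, List.replicate_succ]
  positivity

theorem signed_slash_slash (n : ℤ) :
    (signed n).head? = some .slash ∧ (signed n).tail.head? = some .slash ↔ 1 < n := by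
  rcases n with (_ | _ | n) | n <;> simp [signed, List.replicate_succ]
  omega

theorem signed_minus_minus (n : ℤ) :
    (signed n).head? = some .minus ∧ (signed n).tail.head? = some .minus ↔ n < -1 := by
  rcases n with (_ | n) | _ | n <;> simp [signed, List.replicate_succ] <;> omega

/-- Report that the pattern cannot be folded. -/
def fail : Prog Reg Letter := clear .input ;; .push .out .minus ;; clear .flag

/-- Replace the crease at the current vertex. -/
def relabel (c : Letter) : Prog Reg Letter := popSome .lab fun _ => .push .lab c

/-- Move the entry on top of the stack to the current vertex. -/
def retreat : Prog Reg Letter :=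
  clear .lab ;; clear .val ;; move isBit .stack .tmp ;; move Option.isSome .tmp .val ;;
    popSome .stack fun _ => popSome .stack fun c => .push .lab c

/-- Draw the conclusions from the counters. -/
def examine : Prog Reg Letter :=
  .pop .low fun a => .pop .low fun b => .pop .high fun d => .pop .high fun e => .pop .parity fun p =>
    clear .low ;; clear .high ;;
    if (a = some .slash ∧ b = some .slash) ∨ (d = some .minus ∧ e = some .minus) then fail
    else if p.isSome then relabel (if a = some .slash then .assigned .mountain
      else if d = some .minus then .assigned .valley else .unassigned)
    else retreat

/-- Only comparisons with `1` and `-1` matter, and the two top symbols of a unary counter decide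
them. Once failure is excluded, a positive lower bound is `1` and a negative upper bound is `-1`, as
`runLetter` asks. -/
theorem run_examine {m : Mem} {s : ℤ × ℤ × Bool} {s' : Reg → List Letter} {t : ℕ}
    (h : Run (if 1 < s.1 ∨ s.2.1 < -1 then fail else if s.2.2 then relabel (runLetter s.1 s.2.1) else retreat)
      (Mem.get { m with low := [], high := [], parity := [] }) s' t) :
    Run examine (m.counting s).get s' (s.1.natAbs + s.2.1.natAbs + 2 + t) := by
  obtain ⟨lo, hi, b⟩ := s
  refine run_pop (run_pop (run_pop (run_pop (run_pop ?_))))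
  have e1 := signed_slash lo
  have e2 := signed_slash_slash lo
  have e3 := signed_minus hi
  have e4 := signed_minus_minus hi
  simp only [Mem.get_low, Mem.update_low, Mem.get_high, Mem.update_high, Mem.get_parity, Mem.update_parity,
    Mem.counting, e2, e4] at h ⊢
  have r1 := run_clear Reg.low (Mem.get { m with
    low := (signed lo).tail.tail, high := (signed hi).tail.tail, parity := (if b then [Letter.slash] else []).tail })
  have r2 := run_clear Reg.high (Mem.get { m with
    low := [], high := (signed hi).tail.tail, parity := (if b then [Letter.slash] else []).tail })
  simp only [Mem.get_low, Mem.update_low, Mem.get_high, Mem.update_high] at r1 r2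
  refine r1.seq_le (r2.seq ?_) (t₂ := (signed hi).tail.tail.length + 1 + t) ?_
  · convert h using 1
    · have hb : (if b then [Letter.slash] else []).head?.isSome = b := by cases b <;> rfl
      simp only [e1, e3, hb]
      by_cases h1 : 1 < lo ∨ hi < -1
      · rw [if_pos h1, if_pos h1]
      · have h3 : lo = 1 ↔ 0 < lo := by omega
        have h4 : hi = -1 ↔ hi < 0 := by omega
        simp only [runLetter, h3, h4]
    · cases b <;> rfl
  · simp only [List.length_tail, length_signed]
    omega

end Prog

end SimpleFolding

/-! ### The insertion of a vertex and the whole scan on the machine -/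

namespace SimpleFolding

namespace Prog

/-- Undo a comparison. -/
def restore (a : Letter) : Prog Reg Letter :=
  .push .stack a ;; move Option.isSome .tmp' .stack ;; move Option.isSome .tmp .newVal

theorem run_restore (a : Letter) (m : Mem) :
    Run (restore a) m.get (Mem.get { m with
      stack := m.aux.reverse ++ a :: m.stack
      aux := []
      newVal := m.tmp.reverse ++ m.newVal
      tmp := [] }) (m.aux.length + m.tmp.length + 2) := by
  have r1 := run_push Reg.stack a m.get 0
  have r2 := run_move (c := Option.isSome) (a := Reg.tmp') (b := .stack) (by decide) m.aux
    (Mem.get { m with stack := a :: m.stack }) [] (by simp) (fun _ _ => rfl) rfl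
  have r3 := run_move (c := Option.isSome) (a := Reg.tmp) (b := .newVal) (by decide) m.tmp
    (Mem.get { m with stack := m.aux.reverse ++ a :: m.stack, aux := [] }) [] (by simp) (fun _ _ => rfl) rfl
  simp at r1 r2 r3
  exact (r1.seq (r2.seq r3)).mono (by omega)

/-- Execute the reductions with the segments on top of the stack. -/
def reduceTop : Prog Reg Letter :=
  popSome .lab (fun c => .push .lab c ;; countCrease c) ;; .push .acc .slash ;;
    .loop .acc Option.isSome popEntry ;; examine

/-- Put the current vertex on the stack and stop. -/
def deposit (a : Letter) : Prog Reg Letter := pushEntry a ;; clear .flag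

/-- The reaction to a comparison with the entry whose flag has the symbol `a`. -/
def react (a : Letter) (r : Option Letter) : Prog Reg Letter :=
  if r = some .minus then restore a ;; deposit .slash
  else if a = .minus then
    popSome .stack (fun _ => .skip) ;; clear .tmp' ;; move Option.isSome .tmp .newVal ;; deposit .minus
  else if r = none then restore a ;; deposit .unassigned
  else restore a ;; reduceTop

/-- One round of the insertion of the current vertex. -/
def insertStep : Prog Reg Letter :=
  .pop .stack fun o => match o with
    | none => deposit .minus
    | some a => .push .stack a ;; compareLoop ;; popSome .stack fun a => .pop .acc fun r => react a r

theorem run_deposit (a c : Letter) (m : Mem) (hl : m.lab = [c]) (ht : m.tmp = []) (hf : m.flag = [.slash]) :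
    Run (deposit a) m.get (Mem.get { m with stack := m.val ++ a :: c :: m.stack, val := [], lab := [], flag := [] })
      (2 * m.val.length + 4) := by
  have r1 := run_pushEntry a c m hl ht
  have r2 := run_clear Reg.flag (Mem.get { m with stack := m.val ++ a :: c :: m.stack, val := [], lab := [] })
  simp [hf] at r1 r2
  exact (r1.seq r2).mono (by omega)

theorem run_relabel (a c : Letter) (m : Mem) (hl : m.lab = [c]) :
    Run (relabel a) m.get (Mem.get { m with lab := [a] }) 0 := by
  refine run_popSome (a := c) (l := []) hl ((run_push _ _ _ _).of_eq ?_)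
  simp

theorem run_fail (m : Mem) :
    Run fail m.get (Mem.get { m with input := [], flag := [], out := .minus :: m.out })
      (m.input.length + m.flag.length + 2) := by
  have r1 := run_clear Reg.input m.get
  have r2 := run_push Reg.out .minus (Mem.get { m with input := [] }) 0
  have r3 := run_clear Reg.flag (Mem.get { m with input := [], out := .minus :: m.out })
  simp at r1 r2 r3
  exact (r1.seq (r2.seq r3)).mono (by omega)

theorem run_retreat {W : ℕ} (n : ℤ) (a c : Letter) (r : List Letter) (m : Mem)
    (hs : m.stack = bits W n ++ a :: c :: r) (ha : isBit (some a) = false) (ht : m.tmp = []) :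
    Run retreat m.get (Mem.get { m with stack := r, val := bits W n, lab := [c] })
      (m.lab.length + m.val.length + 2 * W + 4) := by
  have r1 := run_clear Reg.lab m.get
  have r2 := run_clear Reg.val (Mem.get { m with lab := [] })
  have r3 := run_move (c := isBit) (a := Reg.stack) (b := .tmp) (by decide) (bits W n)
    (Mem.get { m with lab := [], val := [] }) (a :: c :: r) hs isBit_of_mem_bits ha
  have r4 := run_move (c := Option.isSome) (a := Reg.tmp) (b := .val) (by decide) (bits W n).reverse
    (Mem.get { m with lab := [], val := [], stack := a :: c :: r, tmp := (bits W n).reverse }) []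
    (by simp) (fun _ _ => rfl) rfl
  have r5 : Run (popSome .stack fun _ => popSome .stack fun c => .push .lab c)
      (Mem.get { m with lab := [], val := bits W n, stack := a :: c :: r })
      (Mem.get { m with lab := [c], val := bits W n, stack := r }) 0 := by
    refine run_popSome (a := a) (l := c :: r) rfl (run_popSome (a := c) (l := r) (by simp)
      ((run_push _ _ _ _).of_eq ?_))
    simp
  simp [ht] at r1 r2 r3 r4 r5
  refine ((r1.seq (r2.seq (r3.seq (r4.seq r5)))).mono (by omega)).of_eq ?_
  simp [ht]

/-- The memory before the vertex `y` is treated, with current vertex `v`. -/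
def scanMem (W : ℕ) (I : List Letter) (L : List Letter) (y : ℤ) (T : List (ℤ × Letter × Bool)) (v : ℤ) (c : Letter) :
    Mem where
  input := I
  stack := encodeStack W T
  val := bits W v
  lab := [c]
  newVal := bits W y
  newLab := L
  flag := [.slash]

theorem run_reduceTop {W : ℕ} {I L : List Letter} {y v : ℤ} {c : Letter} {T : List (ℤ × Letter × Bool)} (hT : T ≠ [])
    (hv : Decreasing v T) {s' : Reg → List Letter} {t : ℕ} {r : (ℤ × ℤ × Bool) × List (ℤ × Letter × Bool)}
    (hr : popRun T (count c (0, 0, false)) = r)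
    (h : Run (if 1 < r.1.1 ∨ r.1.2.1 < -1 then fail
      else if r.1.2.2 then relabel (runLetter r.1.1 r.1.2.1) else retreat) (scanMem W I L y r.2 v c).get s' t) :
    Run reduceTop (scanMem W I L y T v c).get s' (T.length * (W + 4) + 5 + t) := by
  have r1 : Run (popSome .lab (fun c => .push .lab c ;; countCrease c)) (scanMem W I L y T v c).get
      ((scanMem W I L y T v c).counting (count c (0, 0, false))).get 0 := by
    refine run_popSome (a := c) (l := []) rfl ((run_push _ _ _ 0).seq (t₂ := 0) ?_)
    refine (run_countCrease c (scanMem W I L y T v c) (0, 0, false)) |> fun h => ?_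
    rw [counting_zero _ rfl rfl rfl] at h
    convert h using 1
    simp [scanMem]
  have r2 := run_popRun W T v { scanMem W I L y T v c with acc := [.slash] } (count c (0, 0, false)) hT hv rfl rfl
  rw [hr] at r2
  have r3 := run_examine (m := scanMem W I L y r.2 v c) (s := r.1) h
  have hn := natAbs_popRun_le T (count c (0, 0, false))
  rw [hr] at hn
  have hc : (count c (0, 0, false)).1.natAbs = 1 ∧ (count c (0, 0, false)).2.1.natAbs = 1 := by
    simp only [count, loSign_eq, hiSign_eq]
    constructor <;> split_ifs <;> rfl
  have rp : Run (.push .acc .slash) ((scanMem W I L y T v c).counting (count c (0, 0, false))).get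
      (Mem.get (Mem.counting { scanMem W I L y T v c with acc := [.slash] } (count c (0, 0, false)))) 0 :=
    (run_push _ _ _ _).of_eq (by simp [Mem.counting, scanMem])
  refine r1.seq_le (rp.seq (r2.seq r3)) ?_
  -- For each entry, `W + 2` pays for popping it and `2` for its share in emptying the two counters.
  have : T.length * (W + 4) = T.length * (W + 2) + 2 * T.length := by ring
  omega

theorem run_insertStep_nil (W : ℕ) (I L : List Letter) (y v : ℤ) (c : Letter) :
    Run insertStep (scanMem W I L y [] v c).get
      (Mem.get { input := I, stack := encodeStack W [(v, c, false)], newVal := bits W y, newLab := L }) (2 * W + 4) := by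
  refine run_pop ?_
  have := run_deposit .minus c (scanMem W I L y [] v c) rfl rfl rfl
  simp only [scanMem, length_bits] at this
  simpa [scanMem, encodeStack, flagLetter] using this

/-- The first symbol is popped only to detect an empty stack and is put back. The comparison then
consumes the number on top, so that the flag of the entry is exposed when `react` takes over. -/
theorem run_insertStep_cons {W : ℕ} {I L : List Letter} {y v : ℤ} {c : Letter} {w : ℤ} {cw : Letter} {f : Bool}
    {T : List (ℤ × Letter × Bool)} (hy : 0 ≤ y ∧ y < 2 ^ W) (hw : 0 ≤ w ∧ w < 2 ^ W) {s' : Reg → List Letter} {t : ℕ}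
    (h : Run (react (flagLetter T.isEmpty f) (orderingLetters (compare y w)).head?)
      (Mem.get { scanMem W I L y T v c with
        stack := cw :: encodeStack W T
        newVal := []
        tmp := (bits W y).reverse
        aux := (bits W w).reverse }) s' t) :
    Run insertStep (scanMem W I L y ((w, cw, f) :: T) v c).get s' (W + 1 + t) := by
  obtain ⟨x, X, hx⟩ : ∃ x X, encodeStack W ((w, cw, f) :: T) = x :: X := by
    cases h : encodeStack W ((w, cw, f) :: T) with
    | nil => simp [encodeStack] at h
    | cons x X => exact ⟨x, X, rfl⟩
  have r2 := run_compareLoop W y w .eq (flagLetter T.isEmpty f :: cw :: encodeStack W T)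
    (scanMem W I L y ((w, cw, f) :: T) v c) hy.1 hy.2 hw.1 hw.2 rfl rfl rfl
  refine run_pop ?_
  have e : (scanMem W I L y ((w, cw, f) :: T) v c).get .stack = x :: X := hx
  simp only [e, List.head?_cons, List.tail_cons]
  refine (run_push _ _ _ 0).seq_le (r2.of_eq rfl |> fun r2 => ?_) (t₂ := W + 1 + t) (by omega)
  have e2 : Function.update (Function.update (scanMem W I L y ((w, cw, f) :: T) v c).get .stack X) .stack
      (x :: Function.update (scanMem W I L y ((w, cw, f) :: T) v c).get .stack X .stack) =
      (scanMem W I L y ((w, cw, f) :: T) v c).get := by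
    simp [← hx, scanMem]
  rw [e2]
  refine r2.seq (run_popSome (a := flagLetter T.isEmpty f) (l := cw :: encodeStack W T) (by simp) (run_pop ?_))
  convert h using 1
  · simp
  · simp only [scanMem, Mem.update_stack, Mem.update_acc]
    cases compare y w <;> simp [orderingLetters]

theorem run_react_restore {W : ℕ} {I L : List Letter} {y v : ℤ} {c : Letter} {w : ℤ} {cw : Letter} {f : Bool}
    {T : List (ℤ × Letter × Bool)} {s' : Reg → List Letter} {t : ℕ} {p : Prog Reg Letter}
    (h : Run p (scanMem W I L y ((w, cw, f) :: T) v c).get s' t) :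
    Run (restore (flagLetter T.isEmpty f) ;; p)
      (Mem.get { scanMem W I L y T v c with
        stack := cw :: encodeStack W T
        newVal := []
        tmp := (bits W y).reverse
        aux := (bits W w).reverse }) s' (2 * W + 2 + t) := by
  refine ((run_restore _ _).of_eq ?_).seq_le h (by simp; omega)
  simp [scanMem, encodeStack]

theorem run_replaceBottom (W : ℕ) (I L : List Letter) (y w v : ℤ) (c cw : Letter) :
    Run (popSome .stack (fun _ => .skip) ;; clear .tmp' ;; move Option.isSome .tmp .newVal ;; deposit .minus)
      (Mem.get { scanMem W I L y [] v c with
        stack := cw :: encodeStack W []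
        newVal := []
        tmp := (bits W y).reverse
        aux := (bits W w).reverse })
      (Mem.get { input := I, stack := encodeStack W [(v, c, false)], newVal := bits W y, newLab := L })
      (4 * W + 6) := by
  have r2 := run_clear Reg.tmp' (Mem.get { scanMem W I L y [] v c with
    newVal := [], tmp := (bits W y).reverse, aux := (bits W w).reverse })
  have r3 := run_move (c := Option.isSome) (a := Reg.tmp) (b := .newVal) (by decide) (bits W y).reverse
    (Mem.get { scanMem W I L y [] v c with newVal := [], tmp := (bits W y).reverse }) [] (by simp) (fun _ _ => rfl) rfl
  have r4 := run_deposit .minus c (scanMem W I L y [] v c) rfl rfl rfl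
  simp [scanMem, encodeStack] at r2 r3 r4
  refine (run_popSome (a := cw) (l := []) (by simp [encodeStack])
    (run_skip _ 0)).seq_le (t₂ := (W + 1) + ((W + 1) + (2 * W + 4))) ?_ (by omega)
  convert r2.seq (r3.seq r4) using 1
  · simp [scanMem]
  · simp [encodeStack, flagLetter]

/-- The insertion of the current vertex. -/
theorem run_insertLoop {W M : ℕ} {I L : List Letter} (y : ℤ) (hy : 0 ≤ y ∧ y < 2 ^ W) (hI : I.length ≤ M) (hW : W ≤ M)
    (n : ℕ) : ∀ (T : List (ℤ × Letter × Bool)) (v : ℤ) (c : Letter), T.length ≤ n → Decreasing v T →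
    (0 ≤ v ∧ v < 2 ^ W) → (∀ e ∈ T, 0 ≤ e.1 ∧ e.1 < 2 ^ W) → T.length * (W + 4) ≤ M →
    (∀ T', insertVertex T v c y = some T' →
      Run (.loop .flag Option.isSome insertStep) (scanMem W I L y T v c).get
        (Mem.get { input := I, stack := encodeStack W T', newVal := bits W y, newLab := L })
        ((T.length + 1) * (20 * (M + 1))) ∧
      (∀ e ∈ T', 0 ≤ e.1 ∧ e.1 < 2 ^ W) ∧ T'.length ≤ T.length + 1) ∧
    (insertVertex T v c y = none → ∃ S V C, S.length ≤ M ∧ V.length ≤ M ∧ C.length ≤ 1 ∧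
      Run (.loop .flag Option.isSome insertStep) (scanMem W I L y T v c).get
        (Mem.get { stack := S, val := V, lab := C, newVal := bits W y, newLab := L, out := [.minus] })
        ((T.length + 1) * (20 * (M + 1)))) := by
  induction n with
  | zero =>
    intro T v c hn hT hv hTW hM
    obtain rfl : T = [] := List.length_eq_zero_iff.1 (by omega)
    unfold insertVertex
    refine ⟨?_, by simp⟩
    rintro T' ⟨⟩
    refine ⟨?_, by simpa using hv, by simp⟩
    exact run_loop_step rfl (run_insertStep_nil W I L y v c) (run_loop_done (t := 1) rfl le_rfl) (by simp; omega)
  | succ n ih =>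
    intro T v c hn hT hv hTW hM
    have one_round : ∀ {m : Mem} {t : ℕ}, Run insertStep (scanMem W I L y T v c).get m.get t → m.flag = [] →
        t + 2 ≤ 20 * (M + 1) → Run (.loop .flag Option.isSome insertStep) (scanMem W I L y T v c).get m.get
          ((T.length + 1) * (20 * (M + 1))) := by
      intro m t h hf ht
      refine run_loop_step rfl h (run_loop_done (t := 1) (by simp [hf]) le_rfl) ?_
      nlinarith
    rcases T with _ | ⟨⟨w, cw, f⟩, T⟩
    · unfold insertVertex
      refine ⟨?_, by simp⟩
      rintro T' ⟨⟩
      exact ⟨one_round (run_insertStep_nil W I L y v c) rfl (by omega), by simpa using hv, by simp⟩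
    have hw := hTW (w, cw, f) (by simp)
    have deposit_step : ∀ (a : Letter) (f' : Bool), a = flagLetter false f' →
        react (flagLetter T.isEmpty f) (orderingLetters (compare y w)).head? =
          (restore (flagLetter T.isEmpty f) ;; deposit a) →
        Run insertStep (scanMem W I L y ((w, cw, f) :: T) v c).get
          (Mem.get { input := I, stack := encodeStack W ((v, c, f') :: (w, cw, f) :: T), newVal := bits W y, newLab := L })
          (5 * W + 7) := by
      rintro a f' rfl e
      have h := run_deposit (flagLetter false f') c (scanMem W I L y ((w, cw, f) :: T) v c) rfl rfl rfl
      have h2 := run_react_restore h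
      rw [← e] at h2
      refine ((run_insertStep_cons hy hw h2).mono ?_).of_eq ?_
      · simp [scanMem]; omega
      · simp [scanMem, encodeStack]
    have range_cons : ∀ b : Bool, ∀ e ∈ (v, c, b) :: (w, cw, f) :: T, 0 ≤ e.1 ∧ e.1 < 2 ^ W := by
      intro b e he
      rcases List.mem_cons.1 he with rfl | he
      · exact hv
      · exact hTW e he
    rcases T with _ | ⟨t, T⟩
    · unfold insertVertex
      split_ifs with hwy
      · refine ⟨?_, by simp⟩
        rintro T' ⟨⟩
        refine ⟨one_round (t := 5 * W + 7) ?_ rfl (by omega), by simpa using hv, by simp⟩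
        refine (run_insertStep_cons hy hw (t := 4 * W + 6) ?_).mono (by omega)
        have e : react (flagLetter ([] : List (ℤ × Letter × Bool)).isEmpty f) (orderingLetters (compare y w)).head? =
            (popSome .stack (fun _ => .skip) ;; clear .tmp' ;; move Option.isSome .tmp .newVal ;; deposit .minus) := by
          unfold react
          rw [if_neg, if_pos]
          · rfl
          · rcases hwy.lt_or_eq with h | h
            · rw [compare_gt_iff_gt.2 h]; simp [orderingLetters]
            · rw [compare_eq_iff_eq.2 h.symm]; simp [orderingLetters]
        rw [e]
        exact run_replaceBottom W I L y w v c cw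
      · refine ⟨?_, by simp⟩
        rintro T' ⟨⟩
        refine ⟨one_round (deposit_step .slash false rfl ?_) rfl (by omega), range_cons false, by simp⟩
        rw [compare_lt_iff_lt.2 (not_le.1 hwy)]
        rfl
    · have hne : flagLetter (t :: T).isEmpty f ≠ .minus := by cases f <;> simp [flagLetter]
      rcases lt_trichotomy y w with hyw | rfl | hyw
      · rw [insertVertex, if_pos hyw]
        refine ⟨?_, by simp⟩
        rintro T' ⟨⟩
        refine ⟨one_round (deposit_step .slash false rfl ?_) rfl (by omega), range_cons false, by simp⟩
        rw [compare_lt_iff_lt.2 hyw]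
        rfl
      · rw [insertVertex, if_neg (lt_irrefl _), if_pos rfl]
        refine ⟨?_, by simp⟩
        rintro T' ⟨⟩
        refine ⟨one_round (deposit_step .unassigned true rfl ?_) rfl (by omega), range_cons true, by simp⟩
        rw [compare_eq_iff_eq.2 rfl]
        unfold react
        rw [if_neg (by simp [orderingLetters]), if_neg hne, if_pos (by rfl)]
      · have e : react (flagLetter (t :: T).isEmpty f) (orderingLetters (compare y w)).head? =
            (restore (flagLetter (t :: T).isEmpty f) ;; reduceTop) := by
          rw [compare_gt_iff_gt.2 hyw]
          unfold react
          rw [if_neg (by simp [orderingLetters]), if_neg hne, if_neg (by simp [orderingLetters])]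
        obtain ⟨r, hr⟩ : ∃ r, popRun ((w, cw, f) :: t :: T) (count c (0, 0, false)) = r := ⟨_, rfl⟩
        have step : ∀ {s' : Reg → List Letter} {k : ℕ}, Run (if 1 < r.1.1 ∨ r.1.2.1 < -1 then fail
            else if r.1.2.2 then relabel (runLetter r.1.1 r.1.2.1) else retreat) (scanMem W I L y r.2 v c).get s' k →
            Run insertStep (scanMem W I L y ((w, cw, f) :: t :: T) v c).get s' (4 * M + 8 + k) := by
          intro s' k h
          have h2 := run_react_restore (run_reduceTop (by simp) hT hr h)
          rw [← e] at h2
          exact (run_insertStep_cons hy hw h2).mono (by omega)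
        have hlen : r.2.length ≤ T.length + 1 := by
          have := length_popRun_le ((w, cw, f) :: t :: T) (count c (0, 0, false))
          rwa [hr] at this
        have hrange : ∀ e ∈ r.2, 0 ≤ e.1 ∧ e.1 < 2 ^ W := fun e he =>
          hTW e ((hr ▸ popRun_suffix ((w, cw, f) :: t :: T) (count c (0, 0, false))).subset he)
        -- Only the order matters here, so the cast to `ℚ` serves as the key.
        obtain ⟨cs, a, T', hcs, -, heven, hodd⟩ :=
          popRun_spec (key := fun n : ℤ => (n : ℚ)) T t w cw f v (count c (0, 0, false)) hT
        rw [hr] at hcs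
        have hr2 : r.2 = a :: T' := by rw [hcs]
        have hpar : r.1.2.2 = decide (Even cs.length) := by
          rw [hcs, foldl_count]
          cases decide (Even cs.length) <;> rfl
        simp only [List.length_cons] at hn hM
        have hMr : r.2.length * (W + 4) ≤ M := by nlinarith
        -- A round that does not finish the insertion leaves a shorter stack, so the allowance of
        -- `20 * (M + 1)` for one lost entry pays for the round.
        have next : ∀ {T₁ : List (ℤ × Letter × Bool)} {v₁ : ℤ} {c₁ : Letter} {s' : Reg → List Letter} {k : ℕ},
            T₁.length ≤ T.length + 1 → k ≤ 4 * M + 10 → Run insertStep (scanMem W I L y ((w, cw, f) :: t :: T) v c).get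
              (scanMem W I L y T₁ v₁ c₁).get (4 * M + 8 + k) →
            Run (.loop .flag Option.isSome insertStep) (scanMem W I L y T₁ v₁ c₁).get s'
              ((T₁.length + 1) * (20 * (M + 1))) →
            Run (.loop .flag Option.isSome insertStep) (scanMem W I L y ((w, cw, f) :: t :: T) v c).get s'
              ((((w, cw, f) :: t :: T).length + 1) * (20 * (M + 1))) := by
          intro T₁ v₁ c₁ s' k h1 h2 h3 h4
          refine run_loop_step rfl h3 h4 ?_
          simp only [List.length_cons]
          nlinarith
        rw [insertVertex_of_lt hyw hr]
        -- A failure also erases the remaining input, so that the loop over the vertices ends.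
        by_cases h1 : 1 < r.1.1 ∨ r.1.2.1 < -1
        · rw [if_pos h1] at step ⊢
          refine ⟨by simp, fun _ => ⟨encodeStack W r.2, bits W v, [c], ?_, by simpa using hW, by simp, ?_⟩⟩
          · rw [length_encodeStack]
            nlinarith
          · refine one_round ((step (run_fail _)).of_eq ?_) rfl ?_
            · simp [scanMem]
            · simp [scanMem]
              omega
        rw [if_neg h1] at step ⊢
        by_cases h2 : r.1.2.2 = true
        · rw [if_pos h2] at step ⊢
          have hd : Decreasing v r.2 := hr2 ▸ (heven (by simpa [hpar] using h2)).2
          obtain ⟨i1, i2⟩ := ih r.2 v (runLetter r.1.1 r.1.2.1) (by omega) hd hv hrange hMr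
          have st := step (run_relabel _ c _ rfl)
          refine ⟨fun T₂ hT₂ => ?_, fun hnone => ?_⟩
          · obtain ⟨j1, j2, j3⟩ := i1 T₂ hT₂
            exact ⟨next hlen (by omega) st j1, j2, by simp; omega⟩
          · obtain ⟨S, V, C, j1, j2, j3, j4⟩ := i2 hnone
            exact ⟨S, V, C, j1, j2, j3, next hlen (by omega) st j4⟩
        · rw [if_neg h2] at step ⊢
          have hd : Decreasing w (a :: T') := (hodd (by simpa [hpar] using h2)).2
          rw [hr2] at hlen hrange hMr step ⊢
          obtain ⟨v', c', f'⟩ := a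
          simp only [List.length_cons] at hlen hMr
          obtain ⟨i1, i2⟩ := ih T' v' c' (by omega) hd.tail (hrange (v', c', f') (by simp))
            (fun e he => hrange e (by simp [he])) (by nlinarith)
          have st := step (run_retreat v' (flagLetter T'.isEmpty f') c' (encodeStack W T')
            (scanMem W I L y ((v', c', f') :: T') v c) rfl (isBit_flagLetter _ _) rfl)
          have hk : [c].length + (bits W v).length + 2 * W + 4 ≤ 4 * M + 10 := by simp; omega
          refine ⟨fun T₂ hT₂ => ?_, fun hnone => ?_⟩
          · obtain ⟨j1, j2, j3⟩ := i1 T₂ hT₂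
            exact ⟨next (by omega) hk st j1, j2, by simp; omega⟩
          · obtain ⟨S, V, C, j1, j2, j3, j4⟩ := i2 hnone
            exact ⟨S, V, C, j1, j2, j3, next (by omega) hk st j4⟩

/-! #### The whole scan -/

/-- Make the next vertex the current one. -/
def advance : Prog Reg Letter :=
  clear .val ;; move Option.isSome .newVal .tmp ;; move Option.isSome .tmp .val ;; clear .lab ;;
    move Option.isSome .newLab .lab

theorem run_advance (m : Mem) (ht : m.tmp = []) :
    Run advance m.get (Mem.get { m with val := m.newVal, newVal := [], lab := m.newLab.reverse, newLab := [] })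
      (m.val.length + 2 * m.newVal.length + m.lab.length + m.newLab.length + 5) := by
  have r1 := run_clear Reg.val m.get
  have r2 := run_move (c := Option.isSome) (a := Reg.newVal) (b := .tmp) (by decide) m.newVal
    (Mem.get { m with val := [] }) [] (by simp) (fun _ _ => rfl) rfl
  have r3 := run_move (c := Option.isSome) (a := Reg.tmp) (b := .val) (by decide) m.newVal.reverse
    (Mem.get { m with val := [], newVal := [], tmp := m.newVal.reverse }) [] (by simp) (fun _ _ => rfl) rfl
  have r4 := run_clear Reg.lab (Mem.get { m with val := m.newVal, newVal := [] })
  have r5 := run_move (c := Option.isSome) (a := Reg.newLab) (b := .lab) (by decide) m.newLab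
    (Mem.get { m with val := m.newVal, newVal := [], lab := [] }) [] (by simp) (fun _ _ => rfl) rfl
  simp [ht] at r1 r2 r3 r4 r5
  refine ((r1.seq (r2.seq (r3.seq (r4.seq r5)))).mono (by omega)).of_eq ?_
  simp [ht]

/-- Read the next vertex and treat it. -/
def vertexStep : Prog Reg Letter :=
  readEntry .newVal .newLab ;; .push .flag .slash ;; .loop .flag Option.isSome insertStep ;; advance

/-- The folded vertices as a string. -/
def encodeEntries (W : ℕ) (es : List (ℤ × Letter)) : List Letter := es.flatMap fun e => e.2 :: (bits W e.1).reverse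

theorem isBit_head_encodeEntries (W : ℕ) (es : List (ℤ × Letter)) (h : ∀ e ∈ es, isBit (some e.2) = false) :
    isBit (encodeEntries W es).head? = false := by
  cases es with
  | nil => rfl
  | cons e es => exact h e (by simp)

theorem length_encodeEntries (W : ℕ) (es : List (ℤ × Letter)) : (encodeEntries W es).length = es.length * (W + 1) := by
  simp [encodeEntries, List.length_flatMap]

/-- Each vertex adds at most one entry to the stack, so `T.length + es.length` never grows and `M`
bounds the contents of the stacks throughout. An insertion has at most `T.length + 1 ≤ M` rounds of
linear cost, whence the quadratic time for each vertex. -/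
theorem run_scan {W M : ℕ} (hW : W + 1 ≤ M) (es : List (ℤ × Letter)) : ∀ (T : List (ℤ × Letter × Bool)) (v : ℤ) (c : Letter),
    Decreasing v T → (0 ≤ v ∧ v < 2 ^ (W + 1)) → (∀ e ∈ T, 0 ≤ e.1 ∧ e.1 < 2 ^ (W + 1)) →
    (∀ e ∈ es, isBit (some e.2) = false ∧ 0 ≤ e.1 + 2 ^ W ∧ e.1 + 2 ^ W < 2 ^ (W + 1)) →
    (T.length + es.length) * (W + 5) ≤ M →
    ∃ m : Mem, Run (.loop .input Option.isSome vertexStep)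
      (Mem.get { input := encodeEntries (W + 1) es, stack := encodeStack (W + 1) T, val := bits (W + 1) v, lab := [c] })
      m.get (es.length * (60 * (M + 1) ^ 2) + 1) ∧ (∀ k, (m.get k).length ≤ M + 1) ∧
      m.out = if scan T v c (es.map fun e => (e.1 + 2 ^ W, e.2)) then [] else [.minus] := by
  induction es with
  | nil =>
    intro T v c _ _ _ _ hM
    refine ⟨_, run_loop_done rfl (by simp), fun k => ?_, rfl⟩
    have : (encodeStack (W + 1) T).length ≤ M := by
      rw [length_encodeStack]
      simp at hM
      nlinarith
    cases k <;> simp [Mem.get, encodeEntries] <;> omega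
  | cons e es ih =>
    intro T v c hT hv hTW hes hM
    obtain ⟨y, cy⟩ := e
    obtain ⟨-, hy⟩ := hes (y, cy) (by simp)
    simp only [List.length_cons] at hM
    have hI : (encodeEntries (W + 1) es).length ≤ M := by
      rw [length_encodeEntries]
      nlinarith
    have hTM : T.length * (W + 1 + 4) ≤ M := by nlinarith
    have hTM' : T.length + 1 ≤ M := by nlinarith
    have r1 := run_readEntry (v := .newVal) (l := .newLab) (by decide) (by decide) (by decide) W y cy
      (encodeEntries (W + 1) es) (isBit_head_encodeEntries _ _ fun e he => (hes e (by simp [he])).1)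
      (Mem.get {
        input := encodeEntries (W + 1) ((y, cy) :: es)
        stack := encodeStack (W + 1) T
        val := bits (W + 1) v
        lab := [c] }) (by simp [encodeEntries]) rfl rfl
    have r2 := run_push Reg.flag Letter.slash (Mem.get {
        input := encodeEntries (W + 1) es
        stack := encodeStack (W + 1) T
        val := bits (W + 1) v
        lab := [c]
        newVal := bits (W + 1) (y + 2 ^ W)
        newLab := [cy] }) 0
    simp only [Mem.update_input, Mem.update_newVal, Mem.update_newLab, Mem.update_flag, Mem.get_flag] at r1 r2
    have hprod : (T.length + 1) * (20 * (M + 1)) ≤ M * (20 * (M + 1)) := Nat.mul_le_mul_right _ hTM'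
    have hsq : M * (20 * (M + 1)) + 40 * (M + 1) ≤ 60 * (M + 1) ^ 2 := by nlinarith
    obtain ⟨i1, i2⟩ := run_insertLoop (W := W + 1) (M := M) (I := encodeEntries (W + 1) es) (L := [cy]) (y + 2 ^ W) hy hI hW
      T.length T v c le_rfl hT hv hTW hTM
    -- Only the invariant `Decreasing` is needed from this, so the rest of the word may be taken
    -- empty.
    have spec := insertVertex_spec (key := fun n : ℤ => (n : ℚ)) (fun a b h => by simpa using h) [] (y + 2 ^ W) cy
      T.length T v c le_rfl hT
    cases h : insertVertex T v c (y + 2 ^ W) with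
    | none =>
      obtain ⟨S, V, C, hS, hV, hC, r3⟩ := i2 h
      have r4 := run_advance { stack := S, val := V, lab := C, newVal := bits (W + 1) (y + 2 ^ W), newLab := [cy], out := [.minus] } rfl
      refine ⟨_, run_loop_step (by simp [encodeEntries]) (r1.seq (r2.seq (r3.seq r4))) (run_loop_done (t := 1) rfl le_rfl) ?_,
        fun k => ?_, ?_⟩
      · simp only [List.length_cons, length_bits, List.length_nil]
        nlinarith
      · cases k <;> simp [Mem.get] <;> omega
      · simp [scan, h]
    | some T' =>
      obtain ⟨r3, hT'W, hT'⟩ := i1 T' h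
      have r4 := run_advance {
        input := encodeEntries (W + 1) es
        stack := encodeStack (W + 1) T'
        newVal := bits (W + 1) (y + 2 ^ W)
        newLab := [cy] } rfl
      obtain ⟨m, j1, j2, j3⟩ := ih T' (y + 2 ^ W) cy (spec.2 T' h).1 hy hT'W (fun e he => hes e (by simp [he]))
        (by nlinarith)
      refine ⟨m, run_loop_step (by simp [encodeEntries]) (r1.seq (r2.seq (r3.seq r4))) j1 ?_, j2, ?_⟩
      · simp only [List.length_cons, length_bits, List.length_nil]
        nlinarith
      · simp only [j3, List.map_cons, scan, h]

end Prog

end SimpleFolding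

/-! ### The complete decision program and its running time -/

namespace SimpleFolding

namespace Prog

/-- The stacks that are not used for the output. -/
def scratch : List Reg :=
  [.inp, .scale, .base, .num, .table, .digits, .digits', .acc, .copy, .tmp, .tmp', .flag, .letter,
    .input, .stack, .val, .lab, .newVal, .newLab, .low, .high, .parity]

/-- The program that decides whether a pattern can be folded flat. -/
def decideFoldable : Prog Reg Letter :=
  prepare ;; .loop .inp Option.isSome readVertex ;; clear .scale ;; clear .base ;;
    move Option.isSome .table .input ;; readEntry .val .lab ;; .loop .input Option.isSome vertexStep ;;
    clearAll scratch ;; .pop .out fun o => if o.isSome then .skip else .push .out .slash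

theorem reverse_blocks (W : ℕ) (V : List (ℤ × Letter)) : (blocks W V).reverse = encodeEntries W V.reverse := by
  induction V with
  | nil => rfl
  | cons e V ih =>
    simp only [blocks, encodeEntries, List.flatMap_cons, List.reverse_append, List.reverse_cons,
      List.flatMap_append] at *
    rw [ih]
    simp

theorem map_snd_zig (es : List (ℚ × Letter)) : ∀ b, (zig b es).map Prod.snd = es.map Prod.snd := by
  induction es with
  | nil => exact fun b => rfl
  | cons e es ih => exact fun b => by simp [zig, ih]

theorem length_mem_encodeVertices {es : List (ℚ × Letter)} {e : ℚ × Letter} (he : e ∈ es) :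
    (e.2 :: encodeRat e.1).length ≤ (encodeVertices es).length := by
  obtain ⟨l₁, l₂, rfl⟩ := List.append_of_mem he
  simp only [encodeVertices, List.flatMap_append, List.flatMap_cons, List.length_append]
  omega

theorem length_le_encodeVertices (es : List (ℚ × Letter)) : es.length ≤ (encodeVertices es).length := by
  induction es with
  | nil => exact Nat.zero_le _
  | cons e es ih =>
    simp only [encodeVertices, List.flatMap_cons, List.length_append, List.length_cons] at *
    omega

/-- The summands are the times of the consecutive parts of `decideFoldable`, with `M = (L + 3) ^ 2`
for `L` input symbols. Reading and scanning dominate, both with `k` times a multiple of `(M + 1) ^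
2`. -/
theorem time_bound {L k : ℕ} (hk : k ≤ L) :
    (2 * L + 2) + ((k * (100 * ((L + 3) ^ 2 + 1) ^ 2 + 1) + 1) + ((L + 2 + 1) + ((L + 2 + 1) +
      ((k * (L + 2 + 1) + 1) + ((L + 1 + 1) + ((k * (60 * ((L + 3) ^ 2 + 1) ^ 2) + 1) +
      (22 * ((L + 3) ^ 2 + 1 + 1) + 0))))))) ≤ 400 * (L + 1) * ((L + 3) ^ 2 + 1) ^ 2 := by
  have h1 : k * (100 * ((L + 3) ^ 2 + 1) ^ 2 + 1) ≤ L * (100 * ((L + 3) ^ 2 + 1) ^ 2 + 1) := Nat.mul_le_mul_right _ hk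
  have h2 : k * (60 * ((L + 3) ^ 2 + 1) ^ 2) ≤ L * (60 * ((L + 3) ^ 2 + 1) ^ 2) := Nat.mul_le_mul_right _ hk
  have h3 : k * (L + 2 + 1) ≤ L * (L + 2 + 1) := Nat.mul_le_mul_right _ hk
  have h4 : L * (L + 3) ≤ (L + 3) ^ 2 := by nlinarith
  have h5 : 9 ≤ (L + 3) ^ 2 := by nlinarith
  have h6 : 3 * (L + 3) ≤ (L + 3) ^ 2 := by nlinarith
  generalize (L + 3) ^ 2 = A at *
  have h7 : A ^ 2 ≤ (A + 1) ^ 2 := by gcongr; omega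
  have h8 : 9 * A ≤ A ^ 2 := by nlinarith
  have h9 : L * 1 ≤ L * (A + 1) ^ 2 := Nat.mul_le_mul_left _ (by nlinarith)
  nlinarith

/-- Here `b` is the offset caused by reversing the highest bit and `D` is the common denominator, so
`u ↦ (u - b) / D` is an order-preserving key that recovers the folded positions from the integers on
the machine. -/
theorem run_decideFoldable (es : List (ℚ × Letter)) (hes : ∀ e ∈ es, isBit (some e.2) = false) (e : ℚ × Letter)
    (es' : List (ℚ × Letter)) (hcons : es = e :: es') :
    ∃ (D : ℤ) (b : ℤ) (n : ℤ) (c : Letter) (Z : List (ℤ × Letter)), 0 < D ∧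
      ((n, c) :: Z).map (fun e => (((e.1 - b : ℤ) : ℚ) / D, e.2)) = zig 0 es ∧
      Run decideFoldable (Function.update (fun _ => []) .inp (encodeVertices es))
        (Function.update (fun _ => []) .out (if scan [] n c Z then [.slash] else []))
        (400 * ((encodeVertices es).length + 1) * (((encodeVertices es).length + 3) ^ 2 + 1) ^ 2) := by
  obtain ⟨L, hL⟩ : ∃ L, L = (encodeVertices es).length := ⟨_, rfl⟩
  rw [← hL]
  have hk : es.length ≤ L := hL ▸ length_le_encodeVertices es
  have hM : L + 3 ≤ (L + 3) ^ 2 := by nlinarith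
  have r1 := run_prepare (encodeVertices es)
  rw [← hL] at r1
  have r2 := run_readVertices (W := L + 2) (M := (L + 3) ^ 2) (by omega) es 1 0 [] (by simp)
    (fun e he => ⟨hes e he, (length_mem_encodeVertices he).trans (by omega)⟩) (by simp; nlinarith)
  obtain ⟨s1, s2⟩ := readResults_spec es 1 0 [] one_pos
  have s3 := readResults_bound es 1 0 [] 1 one_pos le_rfl (by simp) (by simp)
  rw [← hL] at s3
  generalize readResults (1, 0, []) es = R at *
  obtain ⟨D, B, V⟩ := R
  simp only [Int.cast_zero, zero_div, List.map_nil, List.append_nil, one_mul] at r2 s1 s2 s3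
  have hV : V.reverse.map (fun e => ((e.1 : ℚ) / D, e.2)) = zig 0 es := by
    rw [List.map_reverse, s2, List.reverse_reverse]
  have hVk : V.length = es.length := by
    have := congrArg (List.length ∘ List.map Prod.snd) hV
    simpa [map_snd_zig] using this
  have hVbit : ∀ e ∈ V, isBit (some e.2) = false := by
    intro e he
    have h1 : e.2 ∈ (zig 0 es).map Prod.snd := by
      rw [← hV, List.map_map, List.mem_map]
      exact ⟨e, by simpa using he, rfl⟩
    rw [map_snd_zig, List.mem_map] at h1
    obtain ⟨f, hf, h2⟩ := h1
    rw [← h2]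
    exact hes f hf
  obtain ⟨⟨v, c⟩, Y, hY⟩ : ∃ x Y, V.reverse = x :: Y := by
    cases h : V.reverse with
    | nil =>
      rw [List.reverse_eq_nil_iff.1 h, hcons] at hVk
      simp at hVk
    | cons x Y => exact ⟨x, Y, rfl⟩
  have hmem : ∀ f, f = (v, c) ∨ f ∈ Y → f ∈ V := by
    intro f hf
    rw [← List.mem_reverse, hY]
    simpa using hf
  -- The bound `2 ^ L` on the absolute values is half the offset, so the shifted numbers are
  -- nonnegative and fit into `L + 2` bits.
  have hrange : ∀ f ∈ V, 0 ≤ f.1 + 2 ^ (L + 1) ∧ f.1 + 2 ^ (L + 1) < 2 ^ (L + 1 + 1) := by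
    intro f hf
    have h1 := abs_le.1 (s3 f hf)
    have h2 : (0 : ℤ) < 2 ^ L := by positivity
    simp only [pow_succ]
    constructor <;> linarith [h1.1, h1.2]
  have hYk : Y.length + 1 = es.length := by
    rw [← hVk]
    simpa using (congrArg List.length hY).symm
  refine ⟨D, 2 ^ (L + 1), v + 2 ^ (L + 1), c, Y.map fun e => (e.1 + 2 ^ (L + 1), e.2), s1, ?_, ?_⟩
  · rw [← hV, hY]
    simp
  have r3 := run_clear Reg.scale (readState [] (bits (L + 2) D) (bits (L + 2) B) [] (blocks (L + 2) V) [] [])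
  rw [update_readState_scale] at r3
  have r4 := run_clear Reg.base (readState [] [] (bits (L + 2) B) [] (blocks (L + 2) V) [] [])
  rw [update_readState_base] at r4
  have r5 := run_move (c := Option.isSome) (a := Reg.table) (b := .input) (by decide) (blocks (L + 2) V)
    (readState [] [] [] [] (blocks (L + 2) V) [] []) [] (by simp [readState]) (fun _ _ => rfl) rfl
  have r5 := r5.of_eq (s'' := Mem.get { input := encodeEntries (L + 2) V.reverse }) (by
    rw [reverse_blocks]
    funext k
    cases k <;> simp [readState, Mem.get])
  rw [hY] at r5
  have r6 := run_readEntry (v := .val) (l := .lab) (by decide) (by decide) (by decide) (L + 1) v c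
    (encodeEntries (L + 2) Y) (isBit_head_encodeEntries _ _ fun e he => hVbit e (hmem e (Or.inr he)))
    (Mem.get { input := encodeEntries (L + 2) ((v, c) :: Y) }) (by simp [encodeEntries]) rfl rfl
  obtain ⟨m, r7, hm, hout⟩ := run_scan (W := L + 1) (M := (L + 3) ^ 2) (by omega) Y [] (v + 2 ^ (L + 1)) c trivial
    (hrange _ (hmem _ (Or.inl rfl))) (by simp)
    (fun e he => ⟨hVbit e (hmem e (Or.inr he)), hrange e (hmem e (Or.inr he))⟩) (by simp; nlinarith)
  have r8 := run_clearAll scratch m.get _ fun a _ => hm a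
  simp only [Mem.update_input, Mem.update_val, Mem.update_lab] at r6
  -- So far `out` holds a symbol exactly in case of failure; the answer is the opposite.
  have r9 : Run (.pop .out fun o => if o.isSome then .skip else .push .out .slash)
      (fun a => if a ∈ scratch then [] else m.get a) (Function.update (fun _ => []) .out
        (if scan [] (v + 2 ^ (L + 1)) c (Y.map fun e => (e.1 + 2 ^ (L + 1), e.2)) then [.slash] else [])) 0 := by
    have e : (fun a => if a ∈ scratch then [] else m.get a) = Function.update (fun _ => []) .out m.out := by
      funext k
      cases k <;> simp [scratch]
    rw [e]
    refine run_pop ?_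
    rw [hout]
    cases scan [] (v + 2 ^ (L + 1)) c (Y.map fun e => (e.1 + 2 ^ (L + 1), e.2))
    · exact (run_skip _ _).of_eq (by simp)
    · exact (run_push _ _ _ _).of_eq (by simp)
  have e0 : Function.update (fun _ => []) Reg.inp (encodeVertices es) =
      readState (encodeVertices es) [] [] [] [] [] [] := by
    funext k
    cases k <;> rfl
  rw [e0]
  refine (r1.seq (r2.seq (r3.seq (r4.seq (r5.seq (r6.seq (r7.seq (r8.seq r9)))))))).mono ?_
  refine le_trans ?_ (time_bound hk)
  have hs : scratch.length = 22 := rfl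
  have : Y.length * (60 * ((L + 3) ^ 2 + 1) ^ 2) ≤ es.length * (60 * ((L + 3) ^ 2 + 1) ^ 2) :=
    Nat.mul_le_mul_right _ (by omega)
  rw [hs, length_blocks, hVk, show (readState [] (bits (L + 2) D) (bits (L + 2) B) [] (blocks (L + 2) V) [] []
    Reg.scale).length = L + 2 from length_bits _ _, show (readState [] [] (bits (L + 2) B) [] (blocks (L + 2) V) [] []
    Reg.base).length = L + 2 from length_bits _ _]
  gcongr

/-- The parameter of `zig` at vertex `k` is `v k - z k`. By the recursion for `z`, `2 * v k - (v k -
z k)` equals `v (k + 1) - z (k + 1)`, so this form persists. -/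
theorem zig_ofFn {v z : ℕ → ℚ} (h : ∀ k, z (k + 1) = v (k + 1) - v k - z k) (m : ℕ) : ∀ (k : ℕ) (l : Fin m → Letter),
    zig (v k - z k) (List.ofFn fun i => (v (k + i), l i)) = List.ofFn fun i => (z (k + i), l i) := by
  induction m with
  | zero => exact fun k l => rfl
  | succ m ih =>
    intro k l
    have e : 2 * v k - (v k - z k) = v (k + 1) - z (k + 1) := by rw [h]; ring
    have := ih (k + 1) fun i => l i.succ
    simp only [List.ofFn_succ, zig, Fin.val_zero, add_zero, e, Fin.val_succ, sub_sub_cancel]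
    simp only [show ∀ i : Fin m, k + ((i : ℕ) + 1) = k + 1 + i from fun i => by omega, this]

end Prog

namespace MixedPattern

variable (P : MixedPattern)

/-- The labelled vertices of a pattern. -/
def entries : List (ℚ × Letter) := List.ofFn fun k => (P.vertex k, P.letter k)

theorem letter_zero : P.letter 0 = .paperEnd := by simp [letter]

theorem letter_last : P.letter (Fin.last _) = .paperEnd := by simp [letter]

theorem encode_eq : P.encode = Prog.encodeVertices P.entries := by
  have e : P.entries = (P.vertex 0, .paperEnd) :: ((List.finRange P.numCreases).map
      fun j => (P.vertex j.succ.castSucc, creaseLetter (P.assignment j))) ++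
      [(P.vertex (Fin.last _), .paperEnd)] := by
    rw [entries, List.ofFn_succ, List.ofFn_succ_last, letter_zero, Fin.succ_last, letter_last, List.ofFn_eq_map]
    simp only [Fin.succ_castSucc, letter_succ, List.cons_append]
  rw [e]
  simp [encode, Prog.encodeVertices, List.flatMap_append, List.flatMap_map]

theorem zig_entries : Prog.zig 0 P.entries = P.word := by
  have h := Prog.zig_ofFn (v := P.coord) (z := P.zigzag) (fun k => rfl) (P.numCreases + 2) 0 P.letter
  have e : ∀ k : Fin (P.numCreases + 2), P.coord k = P.vertex k := fun k => dif_pos k.2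
  simp only [zero_add, e] at h
  rw [show P.coord 0 - P.zigzag 0 = 0 from sub_self _] at h
  exact h

theorem isBit_letter (k : Fin (P.numCreases + 2)) : Prog.isBit (some (P.letter k)) = false := by
  unfold letter
  split_ifs
  · cases P.assignment _ <;> rfl
  · rfl

end MixedPattern

/-- Flat foldability by some-layers simple folds can be decided in polynomial time. -/
theorem exists_decision :
    ∃ answer : MixedPattern → Bool,
      (∀ P, answer P = true ↔ P.FlatFoldableSomeLayers) ∧
        Nonempty (Turing.TM2ComputableInPolyTime
          MixedPattern.encode Computability.encodeBool answer) := by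
  classical
  -- The answer may be defined classically, since its computability is shown separately by means of
  -- a machine.
  refine ⟨fun P => decide P.FlatFoldableSomeLayers, fun P => decide_eq_true_iff, ?_⟩
  refine Prog.nonempty_computable _ _ Prog.decideFoldable .inp .out
    (400 * (Polynomial.X + 1) * ((Polynomial.X + 3) ^ 2 + 1) ^ 2) fun P => ?_
  obtain ⟨D, b, n, c, Z, hD, hZ, hr⟩ := Prog.run_decideFoldable P.entries (by
    intro e he
    obtain ⟨k, rfl⟩ := (List.mem_ofFn' _ _).1 he
    exact P.isBit_letter k) _ _ (List.ofFn_succ ..)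
  rw [P.zig_entries] at hZ
  have hlen : Z.length = P.numCreases + 1 := by
    simpa [MixedPattern.word] using congrArg List.length hZ
  -- The paper has two ends, so at least one vertex follows the first.
  obtain ⟨⟨y, cy⟩, ys, rfl⟩ := List.exists_cons_of_ne_nil (List.ne_nil_of_length_pos (by omega : 0 < Z.length))
  have hkey : StrictMono fun u : ℤ => (((u - b : ℤ) : ℚ) / D) := by
    intro u w huw
    have : (0 : ℚ) < D := by exact_mod_cast hD
    have h : ((u - b : ℤ) : ℚ) < ((w - b : ℤ) : ℚ) := by exact_mod_cast sub_lt_sub_right huw b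
    exact div_lt_div_of_pos_right h this
  have hscan := P.scan_iff hkey hZ
  rw [P.encode_eq]
  refine ⟨_, ?_, by simpa using hr⟩
  by_cases h : P.FlatFoldableSomeLayers
  · rw [if_pos (hscan.2 h)]
    simp [h]
  · rw [if_neg fun h' => h (hscan.1 h')]
    simp [h]

end SimpleFolding

theorem mainTheorem4 :
    ∃ answer : SimpleFolding.MixedPattern → Bool,
      (∀ P, answer P = true ↔ P.FlatFoldableSomeLayers) ∧
        Nonempty (Turing.TM2ComputableInPolyTime
          SimpleFolding.MixedPattern.encode Computability.encodeBool answer) :=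
  SimpleFolding.exists_decision
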